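/- Let $D\ge 1$, $d=D+1$, $m>0$. For $k,x\in\mathbb R^{d}$ write $kx=-k^0x^0+\vec k\cdot\vec x$, let $\omega_{\vec p}=\sqrt{m^2+\vec p^2}$, $\mathrm d\mu(\vec p)=\frac{\mathrm d^D\vec p}{2\omega_{\vec p}(2\pi)^D}$, and $\tilde f(k)=\int f(x)\,e^{-ikx}\,\mathrm d^dx$ for $f$ in the space $\mathcal S_{\mathbb R}(\mathbb R^d)$ of real-valued Schwartz functions. Put $$\omega_2(f,g)=\int \tilde f(-\omega_{\vec p},-\vec p)\,\tilde g(\omega_{\vec p},\vec p)\,\mathrm d\mu(\vec p),\qquad \Delta(f,g)=2\,\mathrm{Im}\,\omega_2(f,g),$$ $$(\Delta*g)(x)=-i\int\bigl[\tilde g(\omega_{\vec p},\vec p)\,e^{i(-\omega_{\vec p}x^0+\vec p\cdot\vec x)}-\tilde g(-\omega_{\vec p},\vec p)\,e^{i(\omega_{\vec p}x^0+\vec p\cdot\vec x)}\bigr]\mathrm d\mu(\vec p),$$ so that $\Delta(f,g)=\int f\,(\Delta*g)\,\mathrm d^dx$. Let $\mathcal F$ be the symmetric Fock space over $L^2(\mathbb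 R^D,\mathrm d\mu)$ with vacuum vector $\Omega$. For $f\in\mathcal S_{\mathbb R}(\mathbb R^d)$ let $\Phi(f)=a(f)+a^\dagger(f)$ be the field operator on the finite-particle vectors, where $a^\dagger(f)$ creates the one-particle vector $\vec p\mapsto\tilde f(\omega_{\vec p},\vec p)$ and $a(f)$ is its adjoint (so that $\langle\Omega,\Phi(f)\Phi(g)\Omega\rangle=\omega_2(f,g)$). Let $W_1(f)=\exp\bigl(i\,\overline{\Phi(f)}\bigr)$, where the bar denotes the operator closure; this closure is self-adjoint. Let $\mathcal A=\{W_1(f): f\in\mathcal S_{\mathbb R}(\mathbb R^d)\}''\subset B(\mathcal F)$ and $\omega(a)=\langle\Omega,a\,\Omega\rangle$ for $a\in\mathcal A$. For $h\in\mathcal S_{\mathbb R}(\mathbb R^d)$ let $t_h:\mathcal S_{\mathbb R}(\mathbb R^d)\to\mathcal S_{\mathbb R}(\mathbb R^d)$, $(t_hg)(x)=h(x)\,(\Delta*g)(x)$, and $T_h=\exp(t_h)=\sum_{n\ge0}\frac1{n!}t_h^n$. Then for every $h\in\mathcal S_{\mathbb R}(\mathbb R^d)$: 1. the series $T_hg$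 converges in the Schwartz space for every $g\in\mathcal S_{\mathbb R}(\mathbb R^d)$; 2. there is a unique $*$-automorphism $\alpha_{T_h}$ of $\mathcal A$ with $\alpha_{T_h}(W_1(f))=W_1(T_hf)$ for all $f\in\mathcal S_{\mathbb R}(\mathbb R^d)$; 3. the transformed Weyl operators generate the same algebra: $\{W_1(T_hf): f\in\mathcal S_{\mathbb R}(\mathbb R^d)\}''=\mathcal A$; 4. $\omega_{T_h}=\omega\circ\alpha_{T_h}$ is a quasi-free state with two-point function $\omega_{2,T_h}(f,g)=\omega_2(T_hf,T_hg)$. That is, $\omega_{T_h}$ is a state; $\omega_{2,T_h}$ is a real-bilinear Hermitian form with $\omega_{2,T_h}(f,f)\ge0$, $2\,\mathrm{Im}\,\omega_{2,T_h}(f,g)=\Delta(f,g)$ and $\omega_{2,T_h}(f,f)\,\omega_{2,T_h}(g,g)\ge\frac14\Delta(f,g)^2$; and $$\omega_{T_h}(W_1(f))=e^{-\frac12\omega_{2,T_h}(f,f)},\qquad -\partial_s\partial_t\,\omega_{T_h}\bigl(W_1(sf)W_1(tg)\bigr)\big|_{s=t=0}=\omega_{2,T_h}(f,g).$$ -/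

import Mathlib

noncomputable section

open MeasureTheory SchwartzMap
open scoped ENNReal FourierTransform InnerProductSpace ContDiff

namespace LocalSqueezing

/-! ### Minkowski space, the mass shell and the Fourier transform -/

/-- Spacetime `ℝ^{D+1}`; the coordinate with index `0` is time. -/
abbrev Spacetime (D : ℕ) : Type := EuclideanSpace ℝ (Fin (D + 1))

/-- Spatial momentum space `ℝ^D`. -/
abbrev Momentum (D : ℕ) : Type := EuclideanSpace ℝ (Fin D)

/-- Real-valued Schwartz functions on spacetime. -/
abbrev TestFun (D : ℕ) : Type := 𝓢(Spacetime D, ℝ)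

variable {D : ℕ} {m : ℝ}

/-- Minkowski product `k x = - k⁰ x⁰ + k⃗ · x⃗`. -/
def mink (k x : Spacetime D) : ℝ := -(k 0 * x 0) + ∑ i : Fin D, k i.succ * x i.succ

/-- `f̃(k) = ∫ f(x) e^{-i k x} dx`. -/
def mft (f : TestFun D) (k : Spacetime D) : ℂ :=
  ∫ x, (f x : ℂ) * Complex.exp (-(Complex.I * (mink k x : ℂ)))

/-- `ω_p = √(m² + |p|²)`. -/
def energy (m : ℝ) (p : Momentum D) : ℝ := Real.sqrt (m ^ 2 + ‖p‖ ^ 2)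

/-- The point `(s ω_p, p)`; it lies on the upper (lower) mass shell for `s = 1` (`s = -1`). -/
def shell (m s : ℝ) (p : Momentum D) : Spacetime D :=
  WithLp.toLp 2 (Fin.cons (s * energy m p) (fun i => p i))

/-- The measure `dμ(p) = d^D p / (2 ω_p (2π)^D)`. -/
def shellMeasure (D : ℕ) (m : ℝ) : Measure (Momentum D) :=
  volume.withDensity fun p => ENNReal.ofReal (1 / (2 * energy m p * (2 * Real.pi) ^ D))

/-- The vacuum two-point function
`ω₂(f, g) = ∫ f̃(-ω_p, -p) g̃(ω_p, p) d^D p / (2 ω_p (2π)^D)`. -/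
def twoPoint (m : ℝ) (f g : TestFun D) : ℂ :=
  ∫ p, mft f (shell m (-1) (-p)) * mft g (shell m 1 p) ∂(shellMeasure D m)

/-- The Pauli–Jordan commutator function `Δ(f, g) = 2 Im ω₂(f, g)`. -/
def commutatorFun (m : ℝ) (f g : TestFun D) : ℝ := 2 * (twoPoint m f g).im

/-- `Δ ∗ g`, the convolution with the distribution `Δ` whose Fourier transform is
`-i (π / ω_k) (δ(k⁰ - ω_k) - δ(k⁰ + ω_k))`, that is
`(Δ ∗ g)(x) = ∫ Δ̃(k) g̃(k) e^{i k x} dk / (2π)^{D+1}`. -/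
def pauliJordanConv (m : ℝ) (g : TestFun D) (x : Spacetime D) : ℂ :=
  ∫ p, -Complex.I *
    (mft g (shell m 1 p) * Complex.exp (Complex.I * (mink (shell m 1 p) x : ℂ)) -
      mft g (shell m (-1) p) * Complex.exp (Complex.I * (mink (shell m (-1) p) x : ℂ)))
    ∂(shellMeasure D m)

/-- The time reflection. -/
def timeReflect (k : Spacetime D) : Spacetime D :=
  WithLp.toLp 2 (Fin.cons (-(k 0)) (fun i => k i.succ))

theorem norm_timeReflect (k : Spacetime D) : ‖timeReflect k‖ = ‖k‖ := by
  simp [timeReflect, EuclideanSpace.norm_eq, Fin.sum_univ_succ]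

theorem inner_timeReflect (k x : Spacetime D) : ⟪x, timeReflect k⟫_ℝ = mink k x := by
  simp [timeReflect, mink, PiLp.inner_apply, Fin.sum_univ_succ]

theorem continuous_timeReflect : Continuous (timeReflect : Spacetime D → Spacetime D) := by
  unfold timeReflect
  refine (PiLp.continuous_toLp 2 _).comp (continuous_pi fun i => ?_)
  refine Fin.cases ?_ (fun j => ?_) i <;> simp <;> fun_prop

/-- The complexification of a real Schwartz function. -/
def toComplex (f : TestFun D) : 𝓢(Spacetime D, ℂ) :=
  SchwartzMap.postcompCLM (𝕜 := ℝ) (Complex.ofRealCLM) f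

theorem mft_eq_fourier (f : TestFun D) (k : Spacetime D) :
    mft f k = (𝓕 (toComplex f)) ((2 * Real.pi)⁻¹ • timeReflect k) := by
  rw [SchwartzMap.fourier_coe, Real.fourier_eq']
  unfold mft
  congr 1
  ext x
  rw [inner_smul_right, inner_timeReflect, smul_eq_mul, mul_comm]
  congr 1
  congr 1
  push_cast
  field_simp

theorem continuous_mft (f : TestFun D) : Continuous (mft f) := by
  have : mft f = fun k => (𝓕 (toComplex f)) ((2 * Real.pi)⁻¹ • timeReflect k) :=
    funext (mft_eq_fourier f)
  rw [this]
  have h := continuous_timeReflect (D := D)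
  exact (SchwartzMap.continuous _).comp (by fun_prop)

theorem mft_decay (f : TestFun D) (n : ℕ) :
    ∃ C, 0 ≤ C ∧ ∀ k, (1 + ‖k‖) ^ n * ‖mft f k‖ ≤ C := by
  obtain ⟨C, hC⟩ : ∃ C, ∀ y, (1 + ‖y‖) ^ n * ‖(𝓕 (toComplex f)) y‖ ≤ C := by
    refine ⟨2 ^ n * ((Finset.Iic (n, 0)).sup fun j => SchwartzMap.seminorm ℝ j.1 j.2)
      (𝓕 (toComplex f)), fun y => ?_⟩
    simpa using SchwartzMap.one_add_le_sup_seminorm_apply (𝕜 := ℝ) (m := (n, 0)) le_rfl le_rfl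
      (𝓕 (toComplex f)) y
  have hC0 : 0 ≤ C := le_trans (by positivity) (hC 0)
  refine ⟨(2 * Real.pi) ^ n * C, by positivity, fun k => ?_⟩
  have h1 : 1 + ‖k‖ ≤ 2 * Real.pi * (1 + ‖(2 * Real.pi)⁻¹ • timeReflect k‖) := by
    rw [norm_smul, norm_timeReflect, Real.norm_of_nonneg (by positivity), mul_add,
      mul_inv_cancel_left₀ (by positivity)]
    have := Real.pi_gt_three
    linarith
  calc (1 + ‖k‖) ^ n * ‖mft f k‖
      ≤ (2 * Real.pi * (1 + ‖(2 * Real.pi)⁻¹ • timeReflect k‖)) ^ n * ‖mft f k‖ := by gcongr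
    _ = (2 * Real.pi) ^ n * ((1 + ‖(2 * Real.pi)⁻¹ • timeReflect k‖) ^ n *
          ‖(𝓕 (toComplex f)) ((2 * Real.pi)⁻¹ • timeReflect k)‖) := by
        rw [mul_pow, mul_assoc, mft_eq_fourier]
    _ ≤ _ := by gcongr; exact hC _

theorem continuous_energy : Continuous (energy m : Momentum D → ℝ) := by
  unfold energy; fun_prop

theorem continuous_shell (s : ℝ) : Continuous (shell m s : Momentum D → Spacetime D) := by
  unfold shell
  refine (PiLp.continuous_toLp 2 _).comp (continuous_pi fun i => ?_)
  have := continuous_energy (m := m) (D := D)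
  refine Fin.cases ?_ (fun j => ?_) i <;> simp <;> fun_prop

theorem norm_le_norm_shell (s : ℝ) (p : Momentum D) : ‖p‖ ≤ ‖shell m s p‖ := by
  rw [EuclideanSpace.norm_eq, EuclideanSpace.norm_eq]
  apply Real.sqrt_le_sqrt
  simp only [shell, Fin.sum_univ_succ, Fin.cons_zero, Fin.cons_succ]
  have := sq_nonneg ‖s * energy m p‖
  linarith

theorem le_energy (p : Momentum D) : m ≤ energy m p :=
  Real.le_sqrt_of_sq_le (by nlinarith [sq_nonneg ‖p‖])

theorem shellMeasure_le (hm : 0 < m) :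
    shellMeasure D m ≤ ENNReal.ofReal (1 / (2 * m * (2 * Real.pi) ^ D)) • volume := by
  rw [shellMeasure, ← withDensity_const]
  refine withDensity_mono (Filter.Eventually.of_forall fun p => ?_)
  have := le_energy (m := m) p
  have := Real.pi_pos
  dsimp only
  gcongr

instance : SigmaFinite (shellMeasure D m) := by
  unfold shellMeasure; infer_instance

theorem integrable_shell (hm : 0 < m) {F : Type*} [NormedAddCommGroup F] {u : Momentum D → F}
    (hu : Continuous u) {C : ℝ} (hC : ∀ p, (1 + ‖p‖) ^ (D + 1) * ‖u p‖ ≤ C) :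
    Integrable u (shellMeasure D m) := by
  refine Integrable.mono_measure (ν := ENNReal.ofReal (1 / (2 * m * (2 * Real.pi) ^ D)) • volume) ?_
    (shellMeasure_le hm)
  refine Integrable.smul_measure ?_ ENNReal.ofReal_ne_top
  have h1 : Integrable (fun p : Momentum D => (1 + ‖p‖) ^ (-((D : ℝ) + 1))) volume :=
    integrable_one_add_norm (by simp)
  refine (h1.const_mul C).mono' hu.aestronglyMeasurable (Filter.Eventually.of_forall fun p => ?_)
  have hp : 0 < 1 + ‖p‖ := by positivity
  have : (1 + ‖p‖) ^ (-((D : ℝ) + 1)) = ((1 + ‖p‖) ^ (D + 1))⁻¹ := by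
    rw [Real.rpow_neg hp.le]; norm_cast
  rw [this, ← div_eq_mul_inv, le_div_iff₀ (by positivity), mul_comm]
  exact hC p

theorem integrable_pow_mft_shell (hm : 0 < m) (s : ℝ) (f : TestFun D) (n : ℕ) :
    Integrable (fun p => ‖shell m s p‖ ^ n * ‖mft f (shell m s p)‖) (shellMeasure D m) := by
  obtain ⟨C, -, hC⟩ := mft_decay f (D + 1 + n)
  have h1 := continuous_shell (D := D) (m := m) s
  have h2 := (continuous_mft f).comp h1
  refine integrable_shell hm ((h1.norm.pow n).mul h2.norm) (C := C) fun p => ?_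
  refine le_trans ?_ (hC (shell m s p))
  rw [Real.norm_of_nonneg (by positivity), pow_add _ (D + 1), mul_assoc]
  have := norm_le_norm_shell (m := m) s p
  gcongr
  simp

theorem memLp_mft_shell (hm : 0 < m) (s : ℝ) (f : TestFun D) :
    MemLp (fun p => mft f (shell m s p)) 2 (shellMeasure D m) := by
  have h2 := (continuous_mft f).comp (continuous_shell (D := D) (m := m) s)
  refine (memLp_two_iff_integrable_sq_norm h2.aestronglyMeasurable).2 ?_
  obtain ⟨C, hC0, hC⟩ := mft_decay f (D + 1)
  refine integrable_shell hm (h2.norm.pow 2) (C := C * C) fun p => ?_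
  have hb : (1 + ‖p‖) ^ (D + 1) * ‖mft f (shell m s p)‖ ≤ C := by
    refine le_trans ?_ (hC (shell m s p))
    have := norm_le_norm_shell (m := m) s p
    gcongr
  have hb' : ‖mft f (shell m s p)‖ ≤ C := by
    refine le_trans ?_ hb
    refine le_mul_of_one_le_left (norm_nonneg _) (one_le_pow₀ ?_)
    linarith [norm_nonneg p]
  simp only [Function.comp, Real.norm_of_nonneg (sq_nonneg _)]
  rw [sq, ← mul_assoc]
  gcongr

/-- The Minkowski product as a continuous bilinear form, in the normalization of the
Fourier integral. -/
def minkBilin (D : ℕ) : Spacetime D →L[ℝ] Spacetime D →L[ℝ] ℝ :=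
  LinearMap.toContinuousLinearMap
    { toFun := fun k => LinearMap.toContinuousLinearMap
        { toFun := fun x => -(2 * Real.pi)⁻¹ * mink k x
          map_add' := fun x y => by
            simp only [mink, PiLp.add_apply, mul_add, Finset.sum_add_distrib]; ring
          map_smul' := fun c x => by
            simp only [mink, PiLp.smul_apply, smul_eq_mul, RingHom.id_apply, mul_left_comm _ c,
              ← Finset.mul_sum]; ring }
      map_add' := fun k l => by
        ext x
        simp only [mink, PiLp.add_apply, add_mul, Finset.sum_add_distrib,
          LinearMap.coe_toContinuousLinearMap', LinearMap.coe_mk, AddHom.coe_mk,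
          add_apply]
        ring
      map_smul' := fun c k => by
        ext x
        simp only [mink, PiLp.smul_apply, smul_eq_mul, RingHom.id_apply, mul_assoc,
          ← Finset.mul_sum, LinearMap.coe_toContinuousLinearMap', LinearMap.coe_mk, AddHom.coe_mk,
          smul_apply]
        ring }

theorem minkBilin_apply (k x : Spacetime D) :
    minkBilin D k x = -(2 * Real.pi)⁻¹ * mink k x := rfl

theorem hasTemperateGrowth_shellWave (hm : 0 < m) (s : ℝ) (g : TestFun D) :
    (fun x => ∫ p, mft g (shell m s p) * Complex.exp (Complex.I * (mink (shell m s p) x : ℂ))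
      ∂(shellMeasure D m)).HasTemperateGrowth := by
  set ν : Measure (Spacetime D) := (shellMeasure D m).map (shell m s) with hν
  have hmeas : Measurable (shell m s : Momentum D → Spacetime D) := (continuous_shell s).measurable
  have hint : ∀ n : ℕ, Integrable (fun k => ‖k‖ ^ n * ‖mft g k‖) ν := fun n => by
    rw [hν, integrable_map_measure _ hmeas.aemeasurable]
    · exact integrable_pow_mft_shell hm s g n
    · exact ((continuous_norm.pow n).mul (continuous_mft g).norm).aestronglyMeasurable
  have heq : (fun x => ∫ p, mft g (shell m s p) *
      Complex.exp (Complex.I * (mink (shell m s p) x : ℂ)) ∂(shellMeasure D m)) =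
      VectorFourier.fourierIntegral Real.fourierChar ν (minkBilin D).toLinearMap₁₂ (mft g) := by
    ext x
    rw [VectorFourier.fourierIntegral, hν, integral_map hmeas.aemeasurable]
    · congr 1
      ext p
      rw [Circle.smul_def, Real.fourierChar_apply, smul_eq_mul, mul_comm]
      congr 2
      change _ = ((2 * Real.pi * -(minkBilin D (shell m s p) x) : ℝ) : ℂ) * Complex.I
      rw [minkBilin_apply]
      push_cast
      have : (Real.pi : ℂ) ≠ 0 := by exact_mod_cast Real.pi_ne_zero
      field_simp
    · refine Continuous.aestronglyMeasurable ?_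
      have h1 : Continuous fun v : Spacetime D => Real.fourierChar (-(minkBilin D v x)) :=
        Real.continuous_fourierChar.comp (by fun_prop)
      exact (continuous_subtype_val.comp h1).mul (continuous_mft g)
  rw [heq]
  refine ⟨VectorFourier.contDiff_fourierIntegral (N := ⊤) _ fun n _ => hint n, fun n => ?_⟩
  refine ⟨0, ∫ k, ‖VectorFourier.fourierPowSMulRight (minkBilin D) (mft g) k n‖ ∂ν, fun x => ?_⟩
  rw [VectorFourier.iteratedFDeriv_fourierIntegral (N := ⊤) _ (fun n _ => hint n)
    (continuous_mft g).aestronglyMeasurable (by exact_mod_cast le_top), pow_zero, mul_one]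
  exact VectorFourier.norm_fourierIntegral_le_integral_norm _ _ _ _ _

theorem integrable_shellWave (hm : 0 < m) (s : ℝ) (g : TestFun D) (x : Spacetime D) :
    Integrable (fun p => mft g (shell m s p) *
      Complex.exp (Complex.I * (mink (shell m s p) x : ℂ))) (shellMeasure D m) := by
  have h0 := integrable_pow_mft_shell hm s g 0
  have hc := (continuous_mft g).comp (continuous_shell (D := D) (m := m) s)
  refine h0.mono' ?_ (Filter.Eventually.of_forall fun p => ?_)
  · refine (Continuous.mul hc ?_).aestronglyMeasurable
    have h1 : Continuous fun k : Spacetime D =>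
        Complex.exp (Complex.I * (mink k x : ℂ)) := by
      unfold mink; fun_prop
    exact h1.comp (continuous_shell s)
  · rw [norm_mul, mul_comm Complex.I, Complex.norm_exp_ofReal_mul_I]
    simp

theorem pauliJordanConv_eq (hm : 0 < m) (g : TestFun D) (x : Spacetime D) :
    pauliJordanConv m g x = -Complex.I *
      ((∫ p, mft g (shell m 1 p) * Complex.exp (Complex.I * (mink (shell m 1 p) x : ℂ))
          ∂(shellMeasure D m)) -
        ∫ p, mft g (shell m (-1) p) * Complex.exp (Complex.I * (mink (shell m (-1) p) x : ℂ))
          ∂(shellMeasure D m)) := by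
  rw [pauliJordanConv, integral_const_mul,
    integral_sub (integrable_shellWave hm 1 g x) (integrable_shellWave hm (-1) g x)]

theorem conj_mft (f : TestFun D) (k : Spacetime D) :
    (starRingEnd ℂ) (mft f k) = mft f (-k) := by
  unfold mft
  rw [← integral_conj]
  congr 1
  ext x
  have : mink (-k) x = -mink k x := by simp [mink, Finset.sum_neg_distrib]; ring
  rw [this, map_mul, Complex.conj_ofReal, ← Complex.exp_conj]
  simp

theorem neg_shell (s : ℝ) (p : Momentum D) : -shell m s p = shell m (-s) (-p) := by
  ext i
  refine Fin.cases ?_ (fun j => ?_) i <;> simp [shell, energy]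

instance : (shellMeasure D m).IsNegInvariant := by
  refine ⟨?_⟩
  ext t ht
  rw [Measure.neg, Measure.map_apply measurable_neg ht, shellMeasure,
    withDensity_apply _ ht, withDensity_apply _ (measurable_neg ht)]
  have h := (Measure.measurePreserving_neg (volume : Measure (Momentum D))
    ).setLIntegral_comp_preimage_emb (MeasurableEquiv.neg (Momentum D)).measurableEmbedding
    (fun p => ENNReal.ofReal (1 / (2 * energy m p * (2 * Real.pi) ^ D))) t
  rw [← h]
  simp [energy]

/-- For real `g` the function `Δ ∗ g` is real. -/
theorem pauliJordanConv_im (hm : 0 < m) (g : TestFun D) (x : Spacetime D) :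
    (pauliJordanConv m g x).im = 0 := by
  have key : (starRingEnd ℂ) (∫ p, mft g (shell m 1 p) *
      Complex.exp (Complex.I * (mink (shell m 1 p) x : ℂ)) ∂(shellMeasure D m)) =
      ∫ p, mft g (shell m (-1) p) * Complex.exp (Complex.I * (mink (shell m (-1) p) x : ℂ))
          ∂(shellMeasure D m) := by
    rw [← integral_conj, ← integral_neg_eq_self (μ := shellMeasure D m)]
    congr 1
    ext p
    have h1 : mink (shell m 1 (-p)) x = -mink (shell m (-1) p) x := by
      rw [← neg_neg (1 : ℝ), ← neg_shell]
      simp [mink, Finset.sum_neg_distrib]; ring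
    rw [map_mul, conj_mft, neg_shell, neg_neg, ← Complex.exp_conj, h1]
    simp
  rw [pauliJordanConv_eq hm, ← key]
  simp

theorem hasTemperateGrowth_pauliJordanConv (hm : 0 < m) (g : TestFun D) :
    (pauliJordanConv m g).HasTemperateGrowth := by
  rw [funext (pauliJordanConv_eq hm g)]
  have h1 := hasTemperateGrowth_shellWave hm 1 g
  have h2 := hasTemperateGrowth_shellWave hm (-1) g
  exact (Function.HasTemperateGrowth.const _).mul (h1.sub h2)

theorem hasTemperateGrowth_re_pauliJordanConv (hm : 0 < m) (g : TestFun D) :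
    (fun x => (pauliJordanConv m g x).re).HasTemperateGrowth :=
  (Complex.reCLM.hasTemperateGrowth).comp (hasTemperateGrowth_pauliJordanConv hm g)

/-! ### The generator of local squeezing and its exponential -/

/-- `(t_h g)(x) = h(x) (Δ ∗ g)(x)`. -/
def squeezeGen (m : ℝ) (h g : TestFun D) : TestFun D :=
  SchwartzMap.smulLeftCLM ℝ (fun x => (pauliJordanConv m g x).re) h

theorem squeezeGen_apply (hm : 0 < m) (h g : TestFun D) (x : Spacetime D) :
    ((squeezeGen m h g x : ℝ) : ℂ) = (h x : ℂ) * pauliJordanConv m g x := by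
  rw [squeezeGen, SchwartzMap.smulLeftCLM_apply_apply (hasTemperateGrowth_re_pauliJordanConv hm g)]
  have : pauliJordanConv m g x = ((pauliJordanConv m g x).re : ℂ) :=
    Complex.ext (by simp) (by simp [pauliJordanConv_im hm])
  rw [this]
  simp [mul_comm]

/-- The terms `t_h^n g / n!` of the exponential series. -/
def squeezeTerm (m : ℝ) (h g : TestFun D) (n : ℕ) : TestFun D :=
  (n.factorial : ℝ)⁻¹ • (squeezeGen m h)^[n] g

/-- `T_h g = exp(t_h) g = ∑ₙ t_h^n g / n!`, the sum being taken in the Schwartz space. -/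
def squeeze (m : ℝ) (h g : TestFun D) : TestFun D := ∑' n, squeezeTerm m h g n

/-! ### The symmetric Fock space over `L²(ℝ^D, dμ)` -/

/-- The one-particle space. -/
abbrev OneParticle (D : ℕ) (m : ℝ) : Type := Lp ℂ 2 (shellMeasure D m)

/-- `L²(ℝ^{nD}, dμ^{⊗ n})`. -/
abbrev NBody (D : ℕ) (m : ℝ) (n : ℕ) : Type :=
  Lp ℂ 2 (Measure.pi fun _ : Fin n => shellMeasure D m)

theorem measurePreserving_perm {n : ℕ} (σ : Equiv.Perm (Fin n)) :
    MeasurePreserving (fun p : Fin n → Momentum D => fun i => p (σ i))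
      (Measure.pi fun _ : Fin n => shellMeasure D m)
      (Measure.pi fun _ : Fin n => shellMeasure D m) := by
  have := measurePreserving_piCongrLeft (fun _ : Fin n => shellMeasure D m) σ.symm
  convert this using 1
  ext p i : 2
  simpa using (MeasurableEquiv.piCongrLeft_apply_apply (β := fun _ => Momentum D)
    σ.symm p (σ i)).symm

/-- The action of permutations, `(σ ψ)(p₁, …, pₙ) = ψ(p_{σ 1}, …, p_{σ n})`. -/
def permute {n : ℕ} (σ : Equiv.Perm (Fin n)) : NBody D m n →ₗᵢ[ℂ] NBody D m n :=
  Lp.compMeasurePreservingₗᵢ ℂ (fun p i => p (σ i)) (measurePreserving_perm σ)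

/-- The `n`-particle space: the symmetric functions in `L²(ℝ^{nD}, dμ^{⊗ n})`. -/
def nParticle (D : ℕ) (m : ℝ) (n : ℕ) : Submodule ℂ (NBody D m n) where
  carrier := {ψ | ∀ σ : Equiv.Perm (Fin n), permute σ ψ = ψ}
  add_mem' ha hb σ := by rw [map_add, ha σ, hb σ]
  zero_mem' σ := map_zero _
  smul_mem' c _ ha σ := by rw [map_smul, ha σ]

theorem isClosed_nParticle (n : ℕ) : IsClosed (nParticle D m n : Set (NBody D m n)) := by
  have : (nParticle D m n : Set (NBody D m n)) = ⋂ σ, {ψ | permute σ ψ = ψ} := by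
    ext ψ; simp [nParticle]
  rw [this]
  exact isClosed_iInter fun σ => isClosed_eq (permute σ).continuous continuous_id

instance (n : ℕ) : CompleteSpace (nParticle D m n) :=
  (isClosed_nParticle n).completeSpace_coe

/-- The symmetric Fock space, the Hilbert sum of the `n`-particle spaces. -/
abbrev Fock (D : ℕ) (m : ℝ) : Type := lp (fun n => nParticle D m n) 2

/-- `(φ ⊗ ψ)(p₀, …, pₙ) = φ(p₀) ψ(p₁, …, pₙ)`. -/
def tensorFun {n : ℕ} (φ : OneParticle D m) (ψ : NBody D m n) :
    (Fin (n + 1) → Momentum D) → ℂ :=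
  fun p => φ (p 0) * ψ (fun i => p i.succ)

theorem measurePreserving_split (n : ℕ) :
    MeasurePreserving (fun p : Fin (n + 1) → Momentum D => (p 0, fun i : Fin n => p i.succ))
      (Measure.pi fun _ : Fin (n + 1) => shellMeasure D m)
      ((shellMeasure D m).prod (Measure.pi fun _ : Fin n => shellMeasure D m)) := by
  have := measurePreserving_piFinSuccAbove (fun _ : Fin (n + 1) => shellMeasure D m) 0
  exact this

theorem aestronglyMeasurable_tensorFun {n : ℕ} (φ : OneParticle D m) (ψ : NBody D m n) :
    AEStronglyMeasurable (tensorFun φ ψ) (Measure.pi fun _ : Fin (n + 1) => shellMeasure D m) := by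
  have h : AEStronglyMeasurable (fun z : Momentum D × (Fin n → Momentum D) => φ z.1 * ψ z.2)
      ((shellMeasure D m).prod (Measure.pi fun _ : Fin n => shellMeasure D m)) :=
    (Lp.aestronglyMeasurable φ).comp_fst.mul (Lp.aestronglyMeasurable ψ).comp_snd
  exact h.comp_measurePreserving (measurePreserving_split n)

theorem eLpNorm_tensorFun {n : ℕ} (φ : OneParticle D m) (ψ : NBody D m n) :
    eLpNorm (tensorFun φ ψ) 2 (Measure.pi fun _ : Fin (n + 1) => shellMeasure D m) =
      eLpNorm φ 2 (shellMeasure D m) *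
        eLpNorm ψ 2 (Measure.pi fun _ : Fin n => shellMeasure D m) := by
  have h : AEStronglyMeasurable (fun z : Momentum D × (Fin n → Momentum D) => φ z.1 * ψ z.2)
      ((shellMeasure D m).prod (Measure.pi fun _ : Fin n => shellMeasure D m)) :=
    (Lp.aestronglyMeasurable φ).comp_fst.mul (Lp.aestronglyMeasurable ψ).comp_snd
  have e1 := eLpNorm_comp_measurePreserving (p := 2) h (measurePreserving_split n)
  have e2 : (fun z : Momentum D × (Fin n → Momentum D) => φ z.1 * ψ z.2) ∘
      (fun p : Fin (n + 1) → Momentum D => (p 0, fun i : Fin n => p i.succ)) =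
      tensorFun φ ψ := rfl
  rw [← e2, e1]
  simp only [eLpNorm_eq_lintegral_rpow_enorm_toReal (two_ne_zero) ENNReal.ofNat_ne_top, enorm_mul,
    ENNReal.mul_rpow_of_nonneg _ _ (ENNReal.toReal_nonneg)]
  rw [lintegral_prod_mul (f := fun p => ‖φ p‖ₑ ^ ENNReal.toReal 2)
    (g := fun p => ‖ψ p‖ₑ ^ ENNReal.toReal 2)
    ((Lp.aestronglyMeasurable φ).enorm.pow_const _)
    ((Lp.aestronglyMeasurable ψ).enorm.pow_const _),
    ENNReal.mul_rpow_of_nonneg _ _ (by positivity)]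

theorem memLp_tensorFun {n : ℕ} (φ : OneParticle D m) (ψ : NBody D m n) :
    MemLp (tensorFun φ ψ) 2 (Measure.pi fun _ : Fin (n + 1) => shellMeasure D m) :=
  ⟨aestronglyMeasurable_tensorFun φ ψ, by
    rw [eLpNorm_tensorFun]
    exact ENNReal.mul_lt_top (Lp.eLpNorm_lt_top φ) (Lp.eLpNorm_lt_top ψ)⟩

/-- `ψ ↦ φ ⊗ ψ` as a bounded operator `L²(ℝ^{nD}) → L²(ℝ^{(n+1)D})`. -/
def tensorLeft {n : ℕ} (φ : OneParticle D m) : NBody D m n →L[ℂ] NBody D m (n + 1) :=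
  LinearMap.mkContinuous
    { toFun := fun ψ => (memLp_tensorFun φ ψ).toLp _
      map_add' := fun ψ χ => by
        rw [← MemLp.toLp_add]
        refine MemLp.toLp_congr _ _ ?_
        have := ((measurePreserving_split n).quasiMeasurePreserving.ae
          ((Measure.quasiMeasurePreserving_snd (μ := shellMeasure D m)).ae (Lp.coeFn_add ψ χ)))
        filter_upwards [this] with p hp
        simp only [tensorFun, Pi.add_apply] at hp ⊢
        rw [hp, mul_add]
      map_smul' := fun c ψ => by
        rw [RingHom.id_apply, ← MemLp.toLp_const_smul]
        refine MemLp.toLp_congr _ _ ?_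
        have := ((measurePreserving_split n).quasiMeasurePreserving.ae
          ((Measure.quasiMeasurePreserving_snd (μ := shellMeasure D m)).ae (Lp.coeFn_smul c ψ)))
        filter_upwards [this] with p hp
        simp only [tensorFun, Pi.smul_apply, smul_eq_mul] at hp ⊢
        rw [hp, mul_left_comm] }
    ‖φ‖ fun ψ => by
      change ‖(memLp_tensorFun φ ψ).toLp _‖ ≤ _
      rw [Lp.norm_toLp, eLpNorm_tensorFun, ENNReal.toReal_mul]
      rfl

/-- The creation operator `a†(φ)` from the `n`- to the `(n+1)`-particle space,
`a†(φ) ψ = √(n+1) S (φ ⊗ ψ)`, where `S` is the orthogonal projection onto the symmetric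
functions. -/
def creation (n : ℕ) (φ : OneParticle D m) : nParticle D m n →L[ℂ] nParticle D m (n + 1) :=
  (Real.sqrt (n + 1) : ℂ) •
    ((nParticle D m (n + 1)).orthogonalProjectionOnto ∘L tensorLeft φ ∘L (nParticle D m n).subtypeL)

/-- The annihilation operator `a(φ)`, the adjoint of `a†(φ)`. -/
def annihilation (n : ℕ) (φ : OneParticle D m) :
    nParticle D m (n + 1) →L[ℂ] nParticle D m n :=
  ContinuousLinearMap.adjoint (creation n φ)

/-- The finite-particle vectors. -/
def finiteParticle (D : ℕ) (m : ℝ) : Submodule ℂ (Fock D m) where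
  carrier := {ψ | {n | ψ n ≠ 0}.Finite}
  add_mem' {a b} ha hb := (ha.union hb).subset fun n hn => by
    by_contra hc
    simp only [Set.mem_union, Set.mem_ofPred_eq, not_or, not_not] at hc
    exact hn (by rw [lp.coeFn_add, Pi.add_apply, hc.1, hc.2, add_zero])
  zero_mem' := by simp
  smul_mem' c a ha := ha.subset fun n hn => by
    intro hc
    exact hn (by rw [lp.coeFn_smul, Pi.smul_apply, hc, smul_zero])

/-- The components of `(a(φ) + a†(φ)) ψ`. -/
def fieldComponent (φ : OneParticle D m) (ψ : Fock D m) : (n : ℕ) → nParticle D m n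
  | 0 => annihilation 0 φ (ψ 1)
  | n + 1 => creation n φ (ψ n) + annihilation (n + 1) φ (ψ (n + 2))

theorem fieldComponent_add (φ : OneParticle D m) (ψ χ : Fock D m) (n : ℕ) :
    fieldComponent φ (ψ + χ) n = fieldComponent φ ψ n + fieldComponent φ χ n := by
  have e : ∀ k, (ψ + χ) k = ψ k + χ k := fun _ => rfl
  cases n with
  | zero => rw [fieldComponent, fieldComponent, fieldComponent, e, map_add]
  | succ n =>
    rw [fieldComponent, fieldComponent, fieldComponent, e, e, map_add, map_add]
    exact add_add_add_comm _ _ _ _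

theorem fieldComponent_smul (φ : OneParticle D m) (c : ℂ) (ψ : Fock D m) (n : ℕ) :
    fieldComponent φ (c • ψ) n = c • fieldComponent φ ψ n := by
  have e : ∀ k, (c • ψ) k = c • ψ k := fun _ => rfl
  cases n with
  | zero => rw [fieldComponent, fieldComponent, e, map_smul]
  | succ n => rw [fieldComponent, fieldComponent, e, e, map_smul, map_smul, smul_add]

theorem memℓp_fieldComponent (φ : OneParticle D m) (ψ : finiteParticle D m) :
    Memℓp (fieldComponent φ (ψ : Fock D m)) 2 := by
  refine (memℓp_zero ?_).of_exponent_ge zero_le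
  have hfin : {n | (ψ : Fock D m) n ≠ 0}.Finite := ψ.2
  obtain ⟨N, hN⟩ := hfin.bddAbove
  have hz : ∀ k, N < k → (ψ : Fock D m) k = 0 := fun k hk => by
    by_contra hc
    exact absurd (hN hc) (not_le.2 hk)
  refine (Set.finite_Iic (N + 1)).subset fun n hn => ?_
  by_contra hc
  simp only [Set.mem_Iic, not_le] at hc
  refine hn ?_
  cases n with
  | zero => omega
  | succ n =>
    rw [fieldComponent, hz n (by omega), hz (n + 2) (by omega), map_zero, map_zero, add_zero]

/-- The vector of a real test function in the one-particle space, `p ↦ f̃(ω_p, p)`. -/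
def onShell (hm : 0 < m) (f : TestFun D) : OneParticle D m :=
  (memLp_mft_shell hm 1 f).toLp _

/-- The field operator `Φ(f) = a(f) + a†(f)` on the finite-particle vectors. With this
normalization `⟨Ω, Φ(f) Φ(g) Ω⟩ = ω₂(f, g)`. -/
def field (hm : 0 < m) (f : TestFun D) : Fock D m →ₗ.[ℂ] Fock D m where
  domain := finiteParticle D m
  toFun :=
    { toFun := fun ψ => ⟨fieldComponent (onShell hm f) ψ, memℓp_fieldComponent _ ψ⟩
      map_add' := fun _ _ => lp.ext (funext fun n => fieldComponent_add _ _ _ n)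
      map_smul' := fun c _ => lp.ext (funext fun n => fieldComponent_smul _ c _ n) }

theorem memLp_vacuum :
    MemLp (fun _ : Fin 0 → Momentum D => (1 : ℂ)) 2
      (Measure.pi fun _ : Fin 0 => shellMeasure D m) := by
  rw [Measure.pi_of_empty]
  exact memLp_const 1

/-- The Fock vacuum `Ω`: the constant `1` in the zero-particle space. -/
def vacuum (D : ℕ) (m : ℝ) : Fock D m :=
  lp.single 2 0 ⟨memLp_vacuum.toLp _, fun σ => by
    obtain rfl : σ = 1 := Subsingleton.elim _ _
    rfl⟩

/-! ### Exponentials of self-adjoint operators and Weyl operators -/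

section Exponential

variable {H : Type*} [NormedAddCommGroup H] [InnerProductSpace ℂ H] [CompleteSpace H]

/-- A strongly continuous one-parameter group of unitaries. -/
structure IsUnitaryGroup (U : ℝ → H →L[ℂ] H) : Prop where
  mem_unitary : ∀ t, U t ∈ unitary (H →L[ℂ] H)
  map_zero : U 0 = 1
  map_add : ∀ s t, U (s + t) = U s * U t
  continuous : ∀ ψ, Continuous fun t => U t ψ

/-- `W = exp(i A)`: there is a strongly continuous unitary group `U t = exp(i t A)`, that is one
whose generator is exactly the (self-adjoint, possibly unbounded) operator `A`, with `U 1 = W`. -/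
def IsExpI (A : H →ₗ.[ℂ] H) (W : H →L[ℂ] H) : Prop :=
  ∃ U : ℝ → H →L[ℂ] H, IsUnitaryGroup U ∧
    (∀ ψ χ : H, (ψ, χ) ∈ A.graph ↔ HasDerivAt (fun t => U t ψ) (Complex.I • χ) 0) ∧ U 1 = W

/-- The double commutant `S''` of (the set generated under adjoints by) `S`. -/
def doubleCommutant (S : Set (H →L[ℂ] H)) : StarSubalgebra ℂ (H →L[ℂ] H) :=
  StarSubalgebra.centralizer ℂ (StarSubalgebra.centralizer ℂ S : Set (H →L[ℂ] H))

theorem subset_doubleCommutant (S : Set (H →L[ℂ] H)) : S ⊆ doubleCommutant S :=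
  fun _ hx => StarAlgebra.adjoin_le_centralizer_centralizer ℂ S
    (StarAlgebra.subset_adjoin ℂ S hx)

end Exponential

open Classical in
/-- The Weyl operator `W₁(f) = exp(i Φ(f)‾)`, the exponential of the closure of `Φ(f)`. -/
def weyl (hm : 0 < m) (f : TestFun D) : Fock D m →L[ℂ] Fock D m :=
  if h : ∃ W, IsExpI (field hm f).closure W then h.choose else 0

/-- The algebra `𝒜 = {W₁(f)}''` on Fock space. -/
def weylAlgebra (D : ℕ) (hm : 0 < m) : StarSubalgebra ℂ (Fock D m →L[ℂ] Fock D m) :=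
  doubleCommutant (Set.range fun f : TestFun D => weyl hm f)

/-- The Weyl operator as an element of the algebra. -/
def weylElem (hm : 0 < m) (f : TestFun D) : weylAlgebra D hm :=
  ⟨weyl hm f, subset_doubleCommutant _ ⟨f, rfl⟩⟩

/-- The vacuum state `ω(a) = ⟨Ω, a Ω⟩`. -/
def vacuumState (D : ℕ) (hm : 0 < m) : weylAlgebra D hm →ₗ[ℂ] ℂ where
  toFun a := ⟪vacuum D m, (a : Fock D m →L[ℂ] Fock D m) (vacuum D m)⟫_ℂ
  map_add' a b := by simp
  map_smul' c a := by simp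

/-- `φ` is a state on the algebra. -/
structure IsState {hm : 0 < m} (φ : weylAlgebra D hm →ₗ[ℂ] ℂ) : Prop where
  map_one : φ 1 = 1
  nonneg : ∀ a, 0 ≤ (φ (star a * a)).re ∧ (φ (star a * a)).im = 0

/-- `w` is the two-point function of `φ`: `w(f, g) = - ∂_s ∂_t φ(W₁(s f) W₁(t g))` at
`s = t = 0`. -/
def HasTwoPointFunction {hm : 0 < m} (φ : weylAlgebra D hm →ₗ[ℂ] ℂ)
    (w : TestFun D → TestFun D → ℂ) : Prop :=
  ∀ f g, ∃ F : ℝ → ℂ,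
    (∀ s : ℝ, HasDerivAt (fun t : ℝ => φ (weylElem hm (s • f) * weylElem hm (t • g))) (F s) 0) ∧
      HasDerivAt F (-w f g) 0

/-- `φ` is a quasi-free state with two-point function `w`. The form `w` is real bilinear and
Hermitian, its antisymmetric part is fixed by the commutator function `Δ`, its symmetric part
dominates `Δ`, and `φ(W₁(f)) = exp(-w(f, f) / 2)`. -/
structure IsQuasiFree {hm : 0 < m} (φ : weylAlgebra D hm →ₗ[ℂ] ℂ)
    (w : TestFun D → TestFun D → ℂ) : Prop where
  isState : IsState φ
  add_left : ∀ f f' g, w (f + f') g = w f g + w f' g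
  smul_left : ∀ (c : ℝ) f g, w (c • f) g = c * w f g
  conj_symm : ∀ f g, (starRingEnd ℂ) (w f g) = w g f
  commutator : ∀ f g, 2 * (w f g).im = commutatorFun m f g
  nonneg : ∀ f, 0 ≤ (w f f).re
  dominates : ∀ f g, (commutatorFun m f g) ^ 2 / 4 ≤ (w f f).re * (w g g).re
  apply_weyl : ∀ f, φ (weylElem hm f) = Complex.exp (-(w f f) / 2)
  twoPoint : HasTwoPointFunction φ w

end LocalSqueezing

end

/-! Everything is reduced to the one-particle space, where the vectors `onShell hm f` are dense.
There `squeeze m h` acts as `exp B` for a bounded real-linear integral operator `B`. Its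
complex-linear kernel is `-i h̃(p - q)` and its antilinear kernel is `i h̃(p + q)`, with both
momenta on the upper mass shell (`mft_squeezeGen`, `onShell_squeeze`). Rapid decay of `h̃` gives
boundedness by the Schur test. Two momenta on the same shell cannot cancel, so the second kernel
decays in each variable separately and the antilinear part of `B` is Hilbert–Schmidt
(`exists_kernel_bound`, `exists_hsLe`). Since `Δ(t_h f, g) = ∫ h (Δ∗f)(Δ∗g)` is symmetric in `f` and
`g`, `B` is skew for the symplectic form `Im ⟪·,·⟫`.

Convergence in the Schwartz space rests on one fact: the seminorms of `t_h g` are controlled by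
weighted suprema of `g̃` on the shell alone, and each such supremum grows at most by a fixed factor
under `t_h`. The iterates are therefore bounded geometrically and the factorials win
(`weighted_squeezeGen_le`, `summable_squeezeTerm`).

The exponential of a skew operator with Hilbert–Schmidt antilinear part is implemented by a unitary
`V` (`implementable_exp`, a form of Shale's criterion). The exponential is first cut into many
factors near the identity. For such a factor, with linear part `T₊` and antilinear part `T₋`, the
operator `L = -T₋ T₊⁻¹` is symmetric and has small Hilbert–Schmidt norm, so the squeezed vector
`exp(½ ∑ a†(bⱼ) a†(L bⱼ)) Ω` exists. It is annihilated by all `a(χ) - a†(L χ)`, and after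
normalization the Weyl operators of `T u` have in it the vacuum expectation values of those of `u`.
Equality of Gram matrices then yields an isometry, and irreducibility makes it unitary.

The Weyl operators themselves are constructed from their action on coherent vectors and identified
with the exponentials of the closed fields through the uniqueness of a unitary group with given
generator (`IsField.isExpI`, `IsExpI.eq`). They act irreducibly, even when labelled by a dense set,
so the original and the transformed family both generate all bounded operators. The automorphism is
conjugation by `V`. It is unique because a purely algebraic automorphism that fixes these Weyl
operators must fix the vacuum projection, and hence all matrix elements
(`starAlgEquiv_apply_eq_self`). Quasi-freeness is then a computation with Gaussian expectation
values. -/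

noncomputable section

open MeasureTheory SchwartzMap
open scoped ENNReal FourierTransform InnerProductSpace ContDiff

namespace LocalSqueezing

/-! ### Unitary groups and their generators -/

section UnitaryGroup

variable {H : Type*} [NormedAddCommGroup H] [InnerProductSpace ℂ H]

/-- A set of vectors is total if only the zero vector is orthogonal to it. -/
def Total (s : Set H) : Prop := ∀ y : H, (∀ η ∈ s, ⟪η, y⟫_ℂ = 0) → y = 0

theorem Total.eq {s : Set H} (hs : Total s) {x y : H} (h : ∀ η ∈ s, ⟪η, x⟫_ℂ = ⟪η, y⟫_ℂ) :
    x = y :=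
  sub_eq_zero.1 (hs _ fun η hη => by rw [inner_sub_right, h η hη, sub_self])

theorem Total.dense_span [CompleteSpace H] {s : Set H} (hs : Total s) :
    Dense (Submodule.span ℂ s : Set H) := by
  rw [Submodule.dense_iff_topologicalClosure_eq_top, Submodule.topologicalClosure_eq_top_iff,
    Submodule.eq_bot_iff]
  exact fun y hy => hs y fun η hη => hy η (Submodule.subset_span hη)

theorem Total.clm_ext [CompleteSpace H] {s : Set H} (hs : Total s) {F : Type*}
    [NormedAddCommGroup F] [NormedSpace ℂ F] {A B : H →L[ℂ] F} (h : ∀ η ∈ s, A η = B η) : A = B :=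
  ContinuousLinearMap.ext_on hs.dense_span h

/-- Tested against the total set, `f` and `f 0 + ∫ g` have the same derivative and the same initial
value, hence they coincide. The integral is strongly differentiable because `g` is continuous. -/
theorem hasDerivAt_of_weak [CompleteSpace H] {f g : ℝ → H} (hg : Continuous g) {s : Set H}
    (hs : Total s)
    (h : ∀ η ∈ s, ∀ t, HasDerivAt (fun t => ⟪η, f t⟫_ℂ) ⟪η, g t⟫_ℂ t) (t : ℝ) :
    HasDerivAt f (g t) t := by
  have hF : ∀ t, HasDerivAt (fun t => ∫ u in (0 : ℝ)..t, g u) (g t) t := fun t =>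
    intervalIntegral.integral_hasDerivAt_right (hg.intervalIntegrable _ _)
      hg.stronglyMeasurable.stronglyMeasurableAtFilter hg.continuousAt
  have key : ∀ t, f t = f 0 + ∫ u in (0 : ℝ)..t, g u := fun t => by
    refine hs.eq fun η hη => ?_
    have hd : ∀ t, HasDerivAt (fun t => ⟪η, f t⟫_ℂ - ⟪η, ∫ u in (0 : ℝ)..t, g u⟫_ℂ) 0 t :=
      fun t => by
        have h2 := (hasDerivAt_const t η).inner ℂ (hF t)
        refine ((h η hη t).fun_sub h2).congr_deriv ?_
        simp
    have hc := is_const_of_deriv_eq_zero (fun t => (hd t).differentiableAt)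
      (fun t => (hd t).deriv) t 0
    simp only [intervalIntegral.integral_same, inner_zero_right, sub_zero] at hc
    rw [inner_add_right, ← hc]
    ring
  rw [show f = fun t => f 0 + ∫ u in (0 : ℝ)..t, g u from funext key]
  exact (hF t).const_add _

theorem hasDerivAt_clm_apply {F : Type*} [NormedAddCommGroup F] [NormedSpace ℂ F] (A : H →L[ℂ] F)
    {f : ℝ → H} {f' : H} {t : ℝ} (h : HasDerivAt f f' t) :
    HasDerivAt (fun s => A (f s)) (A f') t :=
  (A.restrictScalars ℝ).hasFDerivAt.comp_hasDerivAt t h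

/-- The hypothesis makes the inner product real, so the cross term is purely imaginary. With `χ = A
ψ` for a symmetric `A`, this shows that the range vector `(A + i) ψ` controls the graph norm. -/
theorem norm_add_I_smul_sq {χ ψ : H} (h : ⟪χ, ψ⟫_ℂ = ⟪ψ, χ⟫_ℂ) :
    ‖χ + Complex.I • ψ‖ ^ 2 = ‖χ‖ ^ 2 + ‖ψ‖ ^ 2 := by
  have h1 : (⟪χ, ψ⟫_ℂ).im = 0 := by
    have := congrArg Complex.im (inner_conj_symm (𝕜 := ℂ) ψ χ)
    rw [h, Complex.conj_im] at this
    rw [h]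
    linarith
  rw [norm_add_sq (𝕜 := ℂ), inner_smul_right, norm_smul, Complex.norm_I]
  simp [h1]

/-- A family is continuous if its Gram matrix is. -/
theorem continuous_of_gram {X : Type*} [TopologicalSpace X] {f : X → H}
    (h : ∀ x₀, Continuous fun x => ⟪f x₀, f x⟫_ℂ) (hd : Continuous fun x => ⟪f x, f x⟫_ℂ) :
    Continuous f := by
  rw [continuous_iff_continuousAt]
  intro x₀
  rw [ContinuousAt, tendsto_iff_norm_sub_tendsto_zero]
  have h1 : Continuous fun x => ‖f x - f x₀‖ ^ 2 := by
    have e : (fun x => ‖f x - f x₀‖ ^ 2) = fun x => (⟪f x, f x⟫_ℂ).re - 2 * (⟪f x₀, f x⟫_ℂ).re +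
        (⟪f x₀, f x₀⟫_ℂ).re := by
      ext x
      rw [norm_sub_sq (𝕜 := ℂ), inner_self_eq_norm_sq_to_K, inner_self_eq_norm_sq_to_K,
        ← inner_conj_symm (f x) (f x₀)]
      norm_cast
    rw [e]
    have := h x₀
    fun_prop
  have h2 := (Real.continuous_sqrt.comp h1).tendsto x₀
  simpa [Function.comp_def] using h2

variable {U V : ℝ → H →L[ℂ] H}

variable [CompleteSpace H]

theorem inner_unitary_apply {W : H →L[ℂ] H} (hW : W ∈ unitary (H →L[ℂ] H)) (x y : H) :
    ⟪W x, W y⟫_ℂ = ⟪x, y⟫_ℂ := by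
  rw [← ContinuousLinearMap.adjoint_inner_left, ← ContinuousLinearMap.star_eq_adjoint,
    ← mul_apply_eq_comp, (Unitary.mem_iff.1 hW).1, one_apply_eq_self]

theorem norm_unitary_apply {W : H →L[ℂ] H} (hW : W ∈ unitary (H →L[ℂ] H)) (x : H) :
    ‖W x‖ = ‖x‖ := by
  have := inner_unitary_apply hW x x
  rw [inner_self_eq_norm_sq_to_K, inner_self_eq_norm_sq_to_K] at this
  have h2 : ‖W x‖ ^ 2 = ‖x‖ ^ 2 := by exact_mod_cast this
  exact (sq_eq_sq₀ (norm_nonneg _) (norm_nonneg _)).1 h2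

theorem IsUnitaryGroup.hasDerivAt (hU : IsUnitaryGroup U) {ψ χ : H}
    (h : HasDerivAt (fun t => U t ψ) χ 0) (t : ℝ) : HasDerivAt (fun t => U t ψ) (U t χ) t := by
  have h1 : (fun s => U s ψ) = fun s => U t (U (s - t) ψ) := by
    ext s
    rw [← mul_apply_eq_comp, ← hU.map_add, add_sub_cancel]
  rw [h1]
  have h2 : HasDerivAt (fun s => U (s - t) ψ) χ t := by
    have h0 : HasDerivAt (fun s => U s ψ) χ (t - t) := by rwa [sub_self]
    simpa using h0.comp_sub_const t t
  exact hasDerivAt_clm_apply _ h2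

/-- Generators are symmetric: differentiate the constant function `⟪U t ψ, U t ψ'⟫` at `0`. -/
theorem IsUnitaryGroup.inner_generator (hU : IsUnitaryGroup U) {ψ χ ψ' χ' : H}
    (h : HasDerivAt (fun t => U t ψ) (Complex.I • χ) 0)
    (h' : HasDerivAt (fun t => U t ψ') (Complex.I • χ') 0) : ⟪χ, ψ'⟫_ℂ = ⟪ψ, χ'⟫_ℂ := by
  have h1 := h.inner ℂ h'
  have h2 : (fun t => ⟪U t ψ, U t ψ'⟫_ℂ) = fun _ => ⟪ψ, ψ'⟫_ℂ :=
    funext fun t => inner_unitary_apply (hU.mem_unitary t) _ _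
  rw [h2] at h1
  have h3 := h1.unique (hasDerivAt_const _ _)
  rw [hU.map_zero] at h3
  simp only [one_apply_eq_self, inner_smul_left, inner_smul_right,
    Complex.conj_I] at h3
  have h4 : Complex.I * (⟪ψ, χ'⟫_ℂ - ⟪χ, ψ'⟫_ℂ) = 0 := by linear_combination h3
  rcases mul_eq_zero.1 h4 with h5 | h5
  · exact absurd h5 Complex.I_ne_zero
  · exact (sub_eq_zero.1 h5).symm

theorem IsUnitaryGroup.map_generator (hU : IsUnitaryGroup U) {ψ χ : H}
    (h : HasDerivAt (fun t => U t ψ) χ 0) (s : ℝ) :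
    HasDerivAt (fun t => U t (U s ψ)) (U s χ) 0 := by
  have h1 : (fun t => U t (U s ψ)) = fun t => U s (U t ψ) := by
    ext t
    rw [← mul_apply_eq_comp, ← mul_apply_eq_comp, ← hU.map_add,
      ← hU.map_add, add_comm]
  rw [h1]
  exact hasDerivAt_clm_apply _ h

/-- A unitary group is determined by its generator. -/
theorem IsUnitaryGroup.eq_of_generator (hU : IsUnitaryGroup U) (hV : IsUnitaryGroup V)
    (hUV : ∀ ψ χ : H, HasDerivAt (fun t => U t ψ) (Complex.I • χ) 0 ↔
      HasDerivAt (fun t => V t ψ) (Complex.I • χ) 0)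
    (hd : Total {ψ : H | ∃ χ, HasDerivAt (fun t => U t ψ) (Complex.I • χ) 0}) (t : ℝ) :
    U t = V t := by
  -- The common generator is symmetric, so the derivatives of the two factors cancel. For `ψ' = ψ`
  -- this overlap, together with the norms, gives `‖U t ψ - V t ψ‖ = 0`.
  have key : ∀ ψ χ ψ' χ' : H, HasDerivAt (fun t => U t ψ) (Complex.I • χ) 0 →
      HasDerivAt (fun t => U t ψ') (Complex.I • χ') 0 → ∀ t, ⟪U t ψ, V t ψ'⟫_ℂ = ⟪ψ, ψ'⟫_ℂ := by
    intro ψ χ ψ' χ' h h' t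
    have hder : ∀ t, HasDerivAt (fun t => ⟪U t ψ, V t ψ'⟫_ℂ) 0 t := fun t => by
      have h1 := (hU.hasDerivAt h t).inner ℂ (hV.hasDerivAt ((hUV _ _).1 h') t)
      refine h1.congr_deriv ?_
      have h2 := hU.map_generator h t
      have h3 := hV.map_generator ((hUV _ _).1 h') t
      rw [map_smul] at h2 h3
      have h4 := hU.inner_generator h2 ((hUV _ _).2 h3)
      rw [map_smul, map_smul, inner_smul_left, inner_smul_right, h4]
      simp
    have := is_const_of_deriv_eq_zero (fun t => (hder t).differentiableAt)
      (fun t => (hder t).deriv) t 0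
    simpa [hU.map_zero, hV.map_zero] using this
  refine hd.clm_ext ?_
  rintro ψ ⟨χ, h⟩
  have e1 := key ψ χ ψ χ h h t
  have n1 := norm_unitary_apply (hU.mem_unitary t) ψ
  have n2 := norm_unitary_apply (hV.mem_unitary t) ψ
  rw [← sub_eq_zero, ← norm_eq_zero, ← sq_eq_zero_iff, norm_sub_sq (𝕜 := ℂ), e1, n1, n2,
    inner_self_eq_norm_sq]
  ring

/-- A closed part of the generator whose domain contains a total set that is invariant under the
group is the whole generator. -/
theorem IsUnitaryGroup.mem_of_hasDerivAt (hU : IsUnitaryGroup U) {K : Submodule ℂ (H × H)}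
    (hK : IsClosed (K : Set (H × H)))
    (hgen : ∀ ψ χ : H, (ψ, χ) ∈ K → HasDerivAt (fun t => U t ψ) (Complex.I • χ) 0)
    (hinv : Total {η : H | ∀ t, ∃ ζ, (U t η, ζ) ∈ K}) {ψ χ : H}
    (h : HasDerivAt (fun t => U t ψ) (Complex.I • χ) 0) : (ψ, χ) ∈ K := by
  -- `R` is the range of `A + i`, where `A` is the operator with graph `K`. It is total: if `y` is
  -- orthogonal to `R` and `η` is in the invariant set, then `⟪U t η, y⟫` satisfies `f' = f`. It
  -- thus equals `eᵗ ⟪η, y⟫`, which is bounded in `t` only if `⟪η, y⟫ = 0`.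
  set R : Set H := {y | ∃ p ∈ K, y = p.2 + Complex.I • p.1} with hR
  have htot : Total R := by
    intro y hy
    refine hinv y fun η hη => ?_
    choose ζ hζ using hη
    have hperp : ∀ t, ⟪ζ t, y⟫_ℂ = Complex.I * ⟪U t η, y⟫_ℂ := fun t => by
      have := hy _ ⟨_, hζ t, rfl⟩
      rw [inner_add_left, inner_smul_left, Complex.conj_I] at this
      linear_combination this
    have hf : ∀ t, HasDerivAt (fun t => ⟪U t η, y⟫_ℂ) ⟪U t η, y⟫_ℂ t := fun t => by
      have h1 : HasDerivAt (fun s => U s η) (Complex.I • ζ t) t := by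
        have h0 := hgen _ _ (hζ t)
        have h2 : HasDerivAt (fun s => U (s - t) (U t η)) (Complex.I • ζ t) t := by
          have h0' : HasDerivAt (fun s => U s (U t η)) (Complex.I • ζ t) (t - t) := by
            rwa [sub_self]
          simpa using h0'.comp_sub_const t t
        have h3 : (fun s => U (s - t) (U t η)) = fun s => U s η := by
          ext s
          rw [← mul_apply_eq_comp, ← hU.map_add, sub_add_cancel]
        rwa [h3] at h2
      have h4 := h1.inner ℂ (hasDerivAt_const t y)
      refine h4.congr_deriv ?_
      rw [inner_zero_right, zero_add, inner_smul_left, hperp, Complex.conj_I, ← mul_assoc]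
      simp
    have hg : ∀ t, HasDerivAt (fun t : ℝ => Complex.exp (-(t : ℂ)) * ⟪U t η, y⟫_ℂ) 0 t := fun t => by
      have h1 : HasDerivAt (fun t : ℝ => Complex.exp (-(t : ℂ))) (-Complex.exp (-(t : ℂ))) t := by
        simpa using ((hasDerivAt_neg (t : ℂ)).cexp).comp_ofReal
      refine (h1.fun_mul (hf t)).congr_deriv ?_
      ring
    have hc : ∀ t : ℝ, Complex.exp (-(t : ℂ)) * ⟪U t η, y⟫_ℂ = ⟪η, y⟫_ℂ := fun t => by
      have := is_const_of_deriv_eq_zero (fun t => (hg t).differentiableAt)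
        (fun t => (hg t).deriv) t 0
      simpa [hU.map_zero] using this
    have hb : ∀ t : ℝ, ‖⟪η, y⟫_ℂ‖ ≤ Real.exp (-t) * (‖η‖ * ‖y‖) := fun t => by
      rw [← hc t, norm_mul, Complex.norm_exp]
      simp only [Complex.neg_re, Complex.ofReal_re]
      gcongr
      refine (norm_inner_le_norm _ _).trans ?_
      rw [norm_unitary_apply (hU.mem_unitary t)]
    have hlim : Filter.Tendsto (fun t : ℝ => Real.exp (-t) * (‖η‖ * ‖y‖)) Filter.atTop
        (nhds (0 * (‖η‖ * ‖y‖))) := Real.tendsto_exp_neg_atTop_nhds_zero.mul_const _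
    rw [zero_mul] at hlim
    exact norm_le_zero_iff.1 (ge_of_tendsto' hlim hb)
  have hspan : (Submodule.span ℂ R : Set H) ⊆ R := by
    intro y hy
    induction hy using Submodule.span_induction with
    | mem x hx => exact hx
    | zero => exact ⟨0, K.zero_mem, by simp⟩
    | add x y _ _ hx hy =>
      obtain ⟨p, hp, rfl⟩ := hx
      obtain ⟨q, hq, rfl⟩ := hy
      exact ⟨p + q, K.add_mem hp hq, by simp [add_add_add_comm]⟩
    | smul c x _ hx =>
      obtain ⟨p, hp, rfl⟩ := hx
      exact ⟨c • p, K.smul_mem c hp, by simp [smul_comm c Complex.I]⟩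
  have hdense : Dense R := htot.dense_span.mono hspan
  -- Choose `p ∈ K` whose image under `A + i` approximates `χ + i ψ`. The difference of the two
  -- pairs still belongs to the symmetric generator, so the Pythagorean identity bounds both of its
  -- components.
  have hmem : (ψ, χ) ∈ closure (K : Set (H × H)) := by
    rw [Metric.mem_closure_iff]
    intro ε hε
    obtain ⟨y, hy, ⟨p, hp, rfl⟩⟩ := Metric.dense_iff.1 hdense (χ + Complex.I • ψ) ε hε
    refine ⟨p, hp, ?_⟩
    rw [Metric.mem_ball, dist_comm, dist_eq_norm] at hy
    have e : χ + Complex.I • ψ - (p.2 + Complex.I • p.1) = (χ - p.2) + Complex.I • (ψ - p.1) := by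
      rw [smul_sub]; abel
    have hdiff : HasDerivAt (fun t => U t (ψ - p.1)) (Complex.I • (χ - p.2)) 0 := by
      simpa [smul_sub] using h.fun_sub (hgen p.1 p.2 hp)
    have hs := norm_add_I_smul_sq (hU.inner_generator hdiff hdiff)
    rw [e] at hy
    have hsq : ‖χ - p.2‖ ^ 2 + ‖ψ - p.1‖ ^ 2 < ε ^ 2 := by
      rw [← hs]; gcongr
    rw [Prod.dist_eq, max_lt_iff, dist_eq_norm, dist_eq_norm]
    constructor
    · exact lt_of_pow_lt_pow_left₀ 2 hε.le (by nlinarith [sq_nonneg ‖χ - p.2‖])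
    · exact lt_of_pow_lt_pow_left₀ 2 hε.le (by nlinarith [sq_nonneg ‖ψ - p.1‖])
  rwa [hK.closure_eq] at hmem

theorem IsExpI.eq {A : H →ₗ.[ℂ] H} {W W' : H →L[ℂ] H} (hA : Total (A.domain : Set H))
    (h : IsExpI A W) (h' : IsExpI A W') : W = W' := by
  obtain ⟨U, hU, hg, rfl⟩ := h
  obtain ⟨V, hV, hg', rfl⟩ := h'
  refine hU.eq_of_generator hV (fun ψ χ => (hg ψ χ).symm.trans (hg' ψ χ)) ?_ 1
  intro y hy
  exact hA y fun η hη => hy η ⟨A ⟨η, hη⟩, (hg _ _).1 (A.mem_graph ⟨η, hη⟩)⟩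

/-- Two families with the same Gram matrix, the first of them total, are related by an isometry. -/
theorem exists_isometry_of_gram {ι : Type*} {u v : ι → H} (hu : Total (Set.range u))
    (h : ∀ i j, ⟪v i, v j⟫_ℂ = ⟪u i, u j⟫_ℂ) :
    ∃ W : H →L[ℂ] H, (∀ i, W (u i) = v i) ∧ ∀ x y, ⟪W x, W y⟫_ℂ = ⟪x, y⟫_ℂ := by
  set e := Finsupp.linearCombination ℂ u
  set f := Finsupp.linearCombination ℂ v
  have hinner : ∀ x y, ⟪f x, f y⟫_ℂ = ⟪e x, e y⟫_ℂ := fun x y => by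
    simp only [e, f, Finsupp.linearCombination_apply, Finsupp.sum, sum_inner, inner_sum,
      inner_smul_left, inner_smul_right, h]
  have hnorm : ∀ x, ‖f x‖ = ‖e x‖ := fun x => by
    rw [norm_eq_sqrt_re_inner (𝕜 := ℂ), norm_eq_sqrt_re_inner (𝕜 := ℂ), hinner]
  have hdense : DenseRange e := by
    have : Set.range e = (Submodule.span ℂ (Set.range u) : Set H) := by
      rw [← Finsupp.range_linearCombination]; rfl
    rw [DenseRange, this]
    exact hu.dense_span
  have hex : ∀ x, f.extendOfNorm e (e x) = f x := fun x =>
    LinearMap.extendOfNorm_eq hdense ⟨1, fun x => by rw [hnorm, one_mul]⟩ x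
  refine ⟨f.extendOfNorm e, fun i => ?_, fun x y => ?_⟩
  · have := hex (Finsupp.single i 1)
    simpa [e, f] using this
  · refine hdense.induction_on₂ (p := fun x y => ⟪f.extendOfNorm e x, f.extendOfNorm e y⟫_ℂ =
      ⟪x, y⟫_ℂ) (isClosed_eq (by fun_prop) (by fun_prop)) (fun x y => ?_) x y
    rw [hex, hex, hinner]

/-- An isometry with total range is unitary. -/
theorem mem_unitary_of_isometry {W : H →L[ℂ] H} (h : ∀ x y, ⟪W x, W y⟫_ℂ = ⟪x, y⟫_ℂ)
    (hr : Total (Set.range W)) : W ∈ unitary (H →L[ℂ] H) := by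
  have h1 : ∀ x, star W (W x) = x := fun x => by
    refine ext_inner_left ℂ fun y => ?_
    rw [ContinuousLinearMap.star_eq_adjoint, ContinuousLinearMap.adjoint_inner_right, h]
  refine Unitary.mem_iff.2 ⟨ContinuousLinearMap.ext h1, ContinuousLinearMap.ext fun y => ?_⟩
  refine hr.eq ?_
  rintro _ ⟨x, rfl⟩
  rw [mul_apply_eq_comp, h, ContinuousLinearMap.star_eq_adjoint,
    ContinuousLinearMap.adjoint_inner_right, one_apply_eq_self]

end UnitaryGroup

/-! ### Symmetric Fock spaces: coherent vectors -/

/-- The structure of a symmetric Fock space over `𝔥` on the Hilbert sum of the spaces `H n`: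
creation operators that satisfy the canonical commutation relations, with a cyclic vacuum. -/
structure FockStructure (𝔥 : Type*) [NormedAddCommGroup 𝔥] [InnerProductSpace ℂ 𝔥]
    (H : ℕ → Type*) [∀ n, NormedAddCommGroup (H n)] [∀ n, InnerProductSpace ℂ (H n)]
    [∀ n, CompleteSpace (H n)] where
  /-- The creation operators. -/
  cr : ∀ n, 𝔥 →ₗ[ℂ] (H n →L[ℂ] H (n + 1))
  /-- The vacuum. -/
  vac : H 0
  norm_vac : ‖vac‖ = 1
  norm_cr_le : ∀ n φ ψ, ‖cr n φ ψ‖ ≤ Real.sqrt (n + 1) * ‖φ‖ * ‖ψ‖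
  cr_comm : ∀ n φ χ ψ, cr (n + 1) φ (cr n χ ψ) = cr (n + 1) χ (cr n φ ψ)
  ccr_zero : ∀ φ χ ψ, ContinuousLinearMap.adjoint (cr 0 φ) (cr 0 χ ψ) = ⟪φ, χ⟫_ℂ • ψ
  ccr_succ : ∀ n φ χ ψ, ContinuousLinearMap.adjoint (cr (n + 1) φ) (cr (n + 1) χ ψ) =
    ⟪φ, χ⟫_ℂ • ψ + cr n χ (ContinuousLinearMap.adjoint (cr n φ) ψ)
  zero_eq : ∀ ψ : H 0, ∃ c : ℂ, ψ = c • vac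
  eq_zero : ∀ n (ψ : H (n + 1)), (∀ φ, ContinuousLinearMap.adjoint (cr n φ) ψ = 0) → ψ = 0

/-- A power series that vanishes on the real line has vanishing coefficients. -/
theorem coeff_eq_zero_of_hasSum {c : ℕ → ℂ} (h : ∀ r : ℝ, HasSum (fun n => r ^ n • c n) 0)
    (n : ℕ) : c n = 0 := by
  set p : FormalMultilinearSeries ℝ ℝ ℂ := fun n =>
    ContinuousMultilinearMap.mkPiRing ℝ (Fin n) (c n)
  have hr : (1 : ℝ≥0∞) ≤ p.radius := by
    have h1 : Filter.Tendsto (fun n => ‖p n‖ * ((1 : NNReal) : ℝ) ^ n) Filter.atTop (nhds 0) := by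
      have := (h 1).summable.tendsto_atTop_zero.norm
      simpa [p, ContinuousMultilinearMap.norm_mkPiRing] using this
    exact_mod_cast p.le_radius_of_tendsto h1
  have hp : HasFPowerSeriesOnBall (fun _ : ℝ => (0 : ℂ)) p 0 1 :=
    { r_le := hr
      r_pos := one_pos
      hasSum := fun {y} _ => by simpa [p] using h y }
  have h0 : p = 0 := hp.hasFPowerSeriesAt.eq_zero
  have := congrArg (fun q : FormalMultilinearSeries ℝ ℝ ℂ => q n fun _ => 1) h0
  simpa [p] using this

theorem hasSum_of_eq {ι E : Type*} [AddCommMonoid E] [TopologicalSpace E] {f g : ι → E} {a : E}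
    (h : HasSum f a) (e : ∀ n, f n = g n) : HasSum g a :=
  funext e ▸ h

theorem memℓp_two_of_summable_sq {H : ℕ → Type*} [∀ n, NormedAddCommGroup (H n)]
    {f : ∀ n, H n} (h : Summable fun n => ‖f n‖ ^ 2) : Memℓp f 2 :=
  memℓp_gen (by simpa using h)

namespace FockStructure

variable {𝔥 : Type*} [NormedAddCommGroup 𝔥] [InnerProductSpace ℂ 𝔥]
variable {H : ℕ → Type*} [∀ n, NormedAddCommGroup (H n)] [∀ n, InnerProductSpace ℂ (H n)]
variable [∀ n, CompleteSpace (H n)] (S : FockStructure 𝔥 H)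

/-- The annihilation operators. -/
def an (n : ℕ) (φ : 𝔥) : H (n + 1) →L[ℂ] H n := ContinuousLinearMap.adjoint (S.cr n φ)

theorem inner_cr_left (n : ℕ) (φ : 𝔥) (ψ : H n) (χ : H (n + 1)) :
    ⟪S.cr n φ ψ, χ⟫_ℂ = ⟪ψ, S.an n φ χ⟫_ℂ :=
  (ContinuousLinearMap.adjoint_inner_right _ _ _).symm

theorem inner_cr_right (n : ℕ) (φ : 𝔥) (ψ : H n) (χ : H (n + 1)) :
    ⟪χ, S.cr n φ ψ⟫_ℂ = ⟪S.an n φ χ, ψ⟫_ℂ :=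
  (ContinuousLinearMap.adjoint_inner_left _ _ _).symm

/-- The vectors `a†(χ)ⁿ Ω`. -/
def pow (χ : 𝔥) : ∀ n, H n
  | 0 => S.vac
  | n + 1 => S.cr n χ (pow χ n)

theorem an_pow (φ χ : 𝔥) (n : ℕ) :
    S.an n φ (S.pow χ (n + 1)) = ((n + 1 : ℂ) * ⟪φ, χ⟫_ℂ) • S.pow χ n := by
  induction n with
  | zero => simpa [pow, an] using S.ccr_zero φ χ S.vac
  | succ n ih =>
    have h := S.ccr_succ n φ χ (S.pow χ (n + 1))
    rw [show ContinuousLinearMap.adjoint (S.cr n φ) (S.pow χ (n + 1)) = _ from ih, map_smul,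
      show S.cr n χ (S.pow χ n) = S.pow χ (n + 1) from rfl, ← add_smul] at h
    refine h.trans ?_
    congr 1
    push_cast
    ring

theorem inner_pow (φ χ : 𝔥) (n : ℕ) :
    ⟪S.pow φ n, S.pow χ n⟫_ℂ = n.factorial * ⟪φ, χ⟫_ℂ ^ n := by
  induction n with
  | zero => simp [pow, inner_self_eq_norm_sq_to_K, S.norm_vac]
  | succ n ih =>
    rw [show S.pow φ (n + 1) = S.cr n φ (S.pow φ n) from rfl, inner_cr_left, an_pow,
      inner_smul_right, ih, Nat.factorial_succ]
    push_cast
    ring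

theorem norm_pow_sq (χ : 𝔥) (n : ℕ) : ‖S.pow χ n‖ ^ 2 = n.factorial * (‖χ‖ ^ 2) ^ n := by
  have := S.inner_pow χ χ n
  rw [inner_self_eq_norm_sq_to_K, inner_self_eq_norm_sq_to_K] at this
  apply Complex.ofReal_injective
  push_cast
  exact this

theorem pow_smul (z : ℂ) (χ : 𝔥) (n : ℕ) : S.pow (z • χ) n = z ^ n • S.pow χ n := by
  induction n with
  | zero => simp [pow]
  | succ n ih =>
    simp only [pow] at ih ⊢
    rw [ih, map_smul, map_smul, smul_apply, smul_smul, pow_succ]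

/-- Leibniz rule; all `n + 1` terms agree because creation operators commute. This replaces
polarization in the proof of totality. -/
theorem hasDerivAt_pow (φ χ : 𝔥) (n : ℕ) :
    HasDerivAt (fun t : ℝ => S.pow (χ + (t : ℂ) • φ) (n + 1))
      ((n + 1 : ℂ) • S.cr n φ (S.pow χ n)) 0 := by
  have step : ∀ n (g : ℝ → H n) (g' : H n), HasDerivAt g g' 0 →
      HasDerivAt (fun t : ℝ => S.cr n (χ + (t : ℂ) • φ) (g t))
        (S.cr n φ (g 0) + S.cr n χ g') 0 := fun n g g' hg => by
    have h1 := hasDerivAt_clm_apply (S.cr n χ) hg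
    have h2 := (Complex.ofRealCLM.hasDerivAt (x := 0)).smul (hasDerivAt_clm_apply (S.cr n φ) hg)
    have h3 := h1.fun_add h2
    refine (h3.congr_deriv ?_).congr_of_eventuallyEq (Filter.Eventually.of_forall fun t => ?_)
    · simp [add_comm]
    · simp
  induction n with
  | zero =>
    have := step 0 (fun _ => S.vac) 0 (hasDerivAt_const _ _)
    simpa [pow] using this
  | succ n ih =>
    refine (step (n + 1) _ _ ih).congr_deriv ?_
    rw [map_smul, S.cr_comm n χ φ]
    simp only [Complex.ofReal_zero, zero_smul, add_zero]
    rw [show S.cr n χ (S.pow χ n) = S.pow χ (n + 1) from rfl]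
    push_cast
    module

/-- Differentiating the orthogonality relation at `χ` in the direction `φ` shows that `a(φ) ψ` is
orthogonal to all powers one level below. By induction `a(φ) ψ = 0` for all `φ`, which forces `ψ =
0`. -/
theorem total_pow : ∀ (n : ℕ) (ψ : H n), (∀ χ, ⟪S.pow χ n, ψ⟫_ℂ = 0) → ψ = 0
  | 0, ψ, h => by
    obtain ⟨c, rfl⟩ := S.zero_eq ψ
    have := h 0
    rw [pow, inner_smul_right, inner_self_eq_norm_sq_to_K, S.norm_vac] at this
    simp_all
  | n + 1, ψ, h => by
    refine S.eq_zero n ψ fun φ => total_pow n _ fun χ => ?_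
    rw [← an, ← inner_cr_left]
    have h1 := (S.hasDerivAt_pow φ χ n).inner ℂ (hasDerivAt_const 0 ψ)
    simp only [h, inner_zero_right, zero_add, inner_smul_left] at h1
    have h2 := h1.unique (hasDerivAt_const _ _)
    have h3 : (n + 1 : ℂ) ≠ 0 := by exact_mod_cast n.succ_ne_zero
    simpa [h3] using h2

theorem summable_pow_mul (x : ℝ) : Summable fun n : ℕ => (n + 1) * (x ^ n / n.factorial) := by
  refine Summable.of_norm_bounded (g := fun n => (2 * |x|) ^ n / n.factorial)
    (Real.summable_pow_div_factorial _) fun n => ?_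
  rw [norm_mul, norm_div, norm_pow, Real.norm_eq_abs x, mul_pow, mul_div_assoc]
  have h1 : ((n : ℝ) + 1) ≤ 2 ^ n := by exact_mod_cast Nat.lt_two_pow_self
  rw [Real.norm_of_nonneg (by positivity), Real.norm_of_nonneg (by positivity)]
  gcongr

/-- The coherent vector with components `a†(χ)ⁿ Ω / n!`. -/
def coh (χ : 𝔥) : lp H 2 :=
  ⟨fun n => (n.factorial : ℂ)⁻¹ • S.pow χ n, memℓp_two_of_summable_sq <| by
    refine (Real.summable_pow_div_factorial (‖χ‖ ^ 2)).congr fun n => ?_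
    rw [norm_smul, _root_.mul_pow, S.norm_pow_sq, norm_inv, RCLike.norm_natCast]
    field_simp⟩

theorem coh_apply (χ : 𝔥) (n : ℕ) : S.coh χ n = (n.factorial : ℂ)⁻¹ • S.pow χ n := rfl

theorem inner_coh (φ χ : 𝔥) : ⟪S.coh φ, S.coh χ⟫_ℂ = Complex.exp ⟪φ, χ⟫_ℂ := by
  refine (lp.hasSum_inner (S.coh φ) (S.coh χ)).unique ?_
  have h := NormedSpace.expSeries_div_hasSum_exp (𝔸 := ℂ) ⟪φ, χ⟫_ℂ
  rw [← Complex.exp_eq_exp_ℂ] at h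
  refine hasSum_of_eq h fun n => ?_
  rw [coh_apply, coh_apply, inner_smul_left, inner_smul_right, inner_pow]
  have : (n.factorial : ℂ) ≠ 0 := by exact_mod_cast n.factorial_ne_zero
  simp only [map_inv₀, map_natCast]
  field_simp

/-- The components of `a†(η) coh χ`. -/
def crCohFun (η χ : 𝔥) : ∀ n, H n
  | 0 => 0
  | n + 1 => S.cr n η (S.coh χ n)

theorem memℓp_crCohFun (η χ : 𝔥) : Memℓp (S.crCohFun η χ) 2 := memℓp_two_of_summable_sq <| by
  rw [← summable_nat_add_iff 1]
  refine Summable.of_nonneg_of_le (fun _ => by positivity) (fun n => ?_)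
    ((summable_pow_mul (‖χ‖ ^ 2)).mul_left (‖η‖ ^ 2))
  have h := S.norm_cr_le n η (S.coh χ n)
  calc ‖S.cr n η (S.coh χ n)‖ ^ 2
      ≤ (Real.sqrt (n + 1) * ‖η‖ * ((n.factorial : ℝ)⁻¹ * ‖S.pow χ n‖)) ^ 2 := by
        rw [coh_apply, norm_smul, norm_inv, RCLike.norm_natCast, ← coh_apply] at h; gcongr
    _ = _ := by
        rw [_root_.mul_pow, _root_.mul_pow, _root_.mul_pow, S.norm_pow_sq,
          Real.sq_sqrt (by positivity)]
        field_simp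

/-- The vector `a†(η) coh χ`. -/
def crCoh (η χ : 𝔥) : lp H 2 := ⟨S.crCohFun η χ, S.memℓp_crCohFun η χ⟩

/-- `V = a†(φ) ψ`. -/
def IsCr (φ : 𝔥) (ψ V : lp H 2) : Prop := V 0 = 0 ∧ ∀ n, V (n + 1) = S.cr n φ (ψ n)

/-- `Y = a(φ) ψ`. -/
def IsAn (φ : 𝔥) (ψ Y : lp H 2) : Prop := ∀ n, Y n = S.an n φ (ψ (n + 1))

theorem IsCr.inner {φ : 𝔥} {ψ V ψ' Y : lp H 2} (hV : S.IsCr φ ψ V) (hY : S.IsAn φ ψ' Y) :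
    ⟪V, ψ'⟫_ℂ = ⟪ψ, Y⟫_ℂ := by
  rw [lp.inner_eq_tsum, lp.inner_eq_tsum, (lp.summable_inner (𝕜 := ℂ) V ψ').tsum_eq_zero_add, hV.1,
    inner_zero_left, zero_add]
  exact tsum_congr fun n => by rw [hV.2, hY n, inner_cr_left]

theorem isCr_crCoh (η χ : 𝔥) : S.IsCr η (S.coh χ) (S.crCoh η χ) :=
  ⟨rfl, fun _ => rfl⟩

theorem isAn_coh (η χ : 𝔥) : S.IsAn η (S.coh χ) (⟪η, χ⟫_ℂ • S.coh χ) := fun n => by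
  rw [coh_apply, map_smul, an_pow, lp.coeFn_smul, Pi.smul_apply, coh_apply, smul_smul, smul_smul,
    Nat.factorial_succ]
  congr 1
  have : (n.factorial : ℂ) ≠ 0 := by exact_mod_cast n.factorial_ne_zero
  have h3 : (n + 1 : ℂ) ≠ 0 := by exact_mod_cast n.succ_ne_zero
  push_cast
  field_simp

theorem isAn_crCoh (η χ : 𝔥) :
    S.IsAn η (S.crCoh η χ) (⟪η, η⟫_ℂ • S.coh χ + ⟪η, χ⟫_ℂ • S.crCoh η χ) := fun n => by
  rw [(S.isCr_crCoh η χ).2, lp.coeFn_add, Pi.add_apply, lp.coeFn_smul, lp.coeFn_smul,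
    Pi.smul_apply, Pi.smul_apply]
  cases n with
  | zero =>
    rw [(S.isCr_crCoh η χ).1, smul_zero, add_zero]
    exact (S.ccr_zero η η _).symm
  | succ n =>
    rw [(S.isCr_crCoh η χ).2]
    refine Eq.trans ?_ (S.ccr_succ n η η _).symm
    rw [← an, ← S.isAn_coh η χ n, lp.coeFn_smul, Pi.smul_apply, map_smul]

theorem inner_crCoh_coh (η χ β : 𝔥) :
    ⟪S.crCoh η χ, S.coh β⟫_ℂ = ⟪η, β⟫_ℂ * Complex.exp ⟪χ, β⟫_ℂ := by
  rw [(S.isCr_crCoh η χ).inner S (S.isAn_coh η β), inner_smul_right, inner_coh]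

theorem inner_coh_crCoh (η χ β : 𝔥) :
    ⟪S.coh β, S.crCoh η χ⟫_ℂ = ⟪β, η⟫_ℂ * Complex.exp ⟪β, χ⟫_ℂ := by
  rw [← inner_conj_symm, inner_crCoh_coh, map_mul, inner_conj_symm, ← Complex.exp_conj,
    inner_conj_symm]

theorem inner_crCoh_crCoh (η χ χ' : 𝔥) :
    ⟪S.crCoh η χ, S.crCoh η χ'⟫_ℂ =
      (⟪η, η⟫_ℂ + ⟪η, χ'⟫_ℂ * ⟪χ, η⟫_ℂ) * Complex.exp ⟪χ, χ'⟫_ℂ := by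
  rw [(S.isCr_crCoh η χ).inner S (S.isAn_crCoh η χ'), inner_add_right, inner_smul_right,
    inner_smul_right, inner_coh, inner_coh_crCoh]
  ring

/-- Scaling `χ` by a real `r` turns orthogonality into a vanishing power series in `r`. Its
coefficients are the overlaps with the individual powers. -/
theorem total_coh : Total (Set.range S.coh) := by
  intro ψ hψ
  refine lp.ext (funext fun n => S.total_pow n _ fun χ => ?_)
  have h : ∀ r : ℝ, HasSum (fun n => r ^ n • ((n.factorial : ℂ)⁻¹ * ⟪S.pow χ n, ψ n⟫_ℂ)) 0 := by
    intro r
    have h1 := lp.hasSum_inner (𝕜 := ℂ) (S.coh ((r : ℂ) • χ)) ψ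
    rw [hψ _ ⟨_, rfl⟩] at h1
    refine hasSum_of_eq h1 fun n => ?_
    rw [coh_apply, pow_smul, inner_smul_left, inner_smul_left]
    simp only [map_inv₀, map_natCast, map_pow, Complex.conj_ofReal, Complex.real_smul]
    push_cast
    ring
  have h1 := coeff_eq_zero_of_hasSum h n
  have : (n.factorial : ℂ) ≠ 0 := by exact_mod_cast n.factorial_ne_zero
  simpa [this] using h1

theorem continuous_coh : Continuous S.coh :=
  continuous_of_gram (fun x => by simp only [inner_coh]; fun_prop)
    (by simp only [inner_coh]; fun_prop)

theorem continuous_crCoh (η : 𝔥) : Continuous (S.crCoh η) :=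
  continuous_of_gram (fun x => by simp only [inner_crCoh_crCoh]; fun_prop)
    (by simp only [inner_crCoh_crCoh]; fun_prop)

theorem hasDerivAt_coh (η χ : 𝔥) (t : ℝ) :
    HasDerivAt (fun t : ℝ => S.coh (χ + (t : ℂ) • η)) (S.crCoh η (χ + (t : ℂ) • η)) t := by
  refine hasDerivAt_of_weak (g := fun t : ℝ => S.crCoh η (χ + (t : ℂ) • η))
    ((S.continuous_crCoh η).comp (by fun_prop)) S.total_coh ?_ t
  rintro _ ⟨β, rfl⟩ t
  simp only [inner_coh, inner_coh_crCoh, inner_add_right, inner_smul_right]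
  have h1 : HasDerivAt (fun t : ℝ => ⟪β, χ⟫_ℂ + (t : ℂ) * ⟪β, η⟫_ℂ) ⟪β, η⟫_ℂ t := by
    simpa using (((hasDerivAt_id (t : ℂ)).mul_const ⟪β, η⟫_ℂ).const_add ⟪β, χ⟫_ℂ).comp_ofReal
  refine h1.cexp.congr_deriv (by ring)

theorem crCoh_smul (c : ℂ) (η χ : 𝔥) : S.crCoh (c • η) χ = c • S.crCoh η χ :=
  S.total_coh.eq <| by
    rintro _ ⟨β, rfl⟩
    rw [inner_coh_crCoh, inner_smul_right, inner_smul_right, inner_coh_crCoh, mul_assoc]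

/-- The vector `(a(φ) + a†(φ)) coh χ`. -/
def fieldCoh (φ χ : 𝔥) : lp H 2 := S.crCoh φ χ + ⟪φ, χ⟫_ℂ • S.coh χ

end FockStructure

/-- The truncation of a vector in a Hilbert sum to its first `N` components. -/
def trunc {H : ℕ → Type*} [∀ n, NormedAddCommGroup (H n)] (N : ℕ) (ψ : lp H 2) : lp H 2 :=
  ∑ i ∈ Finset.range N, lp.single 2 i (ψ i)

theorem trunc_apply {H : ℕ → Type*} [∀ n, NormedAddCommGroup (H n)] (N : ℕ) (ψ : lp H 2) (n : ℕ) :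
    trunc N ψ n = if n < N then ψ n else 0 := by
  rw [trunc, lp.coeFn_sum, Finset.sum_apply]
  simp only [lp.single_apply, Finset.sum_pi_single, Finset.mem_range]

theorem tendsto_trunc {H : ℕ → Type*} [∀ n, NormedAddCommGroup (H n)] (ψ : lp H 2) :
    Filter.Tendsto (fun N => trunc N ψ) Filter.atTop (nhds ψ) :=
  (lp.hasSum_single ENNReal.ofNat_ne_top ψ).tendsto_sum_nat

namespace FockStructure

variable {𝔥 : Type*} [NormedAddCommGroup 𝔥] [InnerProductSpace ℂ 𝔥]
variable {H : ℕ → Type*} [∀ n, NormedAddCommGroup (H n)] [∀ n, InnerProductSpace ℂ (H n)]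
variable [∀ n, CompleteSpace (H n)] (S : FockStructure 𝔥 H)

/-! ### Weyl operators -/

theorem inner_self_im_zero (φ : 𝔥) : (⟪φ, φ⟫_ℂ).im = 0 := inner_self_im (𝕜 := ℂ) φ

/-- The phase and normalization in the action of Weyl operators on coherent vectors. -/
def weylFactor (φ χ : 𝔥) : ℂ := Complex.exp (-⟪φ, φ⟫_ℂ / 2 + Complex.I * ⟪φ, χ⟫_ℂ)

theorem weylFactor_ne_zero (φ χ : 𝔥) : weylFactor φ χ ≠ 0 := Complex.exp_ne_zero _

/-- The shift by `iφ` changes the exponent `⟪χ, χ'⟫` of the Gram matrix by `⟪φ, φ⟫ + i⟪χ, φ⟫ - i⟪φ,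
χ'⟫`. The two factors `weylFactor` contribute exactly the negative of this. -/
theorem exists_weylOp (φ : 𝔥) : ∃ W : lp H 2 →L[ℂ] lp H 2,
    (∀ χ, W (S.coh χ) = weylFactor φ χ • S.coh (χ + Complex.I • φ)) ∧
      ∀ x y, ⟪W x, W y⟫_ℂ = ⟪x, y⟫_ℂ := by
  refine exists_isometry_of_gram S.total_coh fun χ χ' => ?_
  rw [inner_smul_left, inner_smul_right, inner_coh, inner_coh, weylFactor, weylFactor,
    ← Complex.exp_conj, ← Complex.exp_add, ← Complex.exp_add]
  congr 1
  simp only [map_add, map_mul, map_div₀, map_neg, inner_conj_symm, Complex.conj_I, inner_add_left,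
    inner_add_right, inner_smul_left, inner_smul_right, map_ofNat]
  linear_combination (-(⟪φ, φ⟫_ℂ)) * Complex.I_sq

/-- The Weyl operators of a Fock structure. -/
def weylOp (φ : 𝔥) : lp H 2 →L[ℂ] lp H 2 := (S.exists_weylOp φ).choose

theorem weylOp_coh (φ χ : 𝔥) :
    S.weylOp φ (S.coh χ) = weylFactor φ χ • S.coh (χ + Complex.I • φ) :=
  (S.exists_weylOp φ).choose_spec.1 χ

theorem inner_weylOp (φ : 𝔥) (x y : lp H 2) : ⟪S.weylOp φ x, S.weylOp φ y⟫_ℂ = ⟪x, y⟫_ℂ :=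
  (S.exists_weylOp φ).choose_spec.2 x y

theorem weylOp_zero : S.weylOp 0 = 1 :=
  S.total_coh.clm_ext <| by
    rintro _ ⟨χ, rfl⟩
    rw [weylOp_coh]
    simp [weylFactor]

/-- The Weyl relations. -/
theorem weylOp_mul (φ η : 𝔥) : S.weylOp φ * S.weylOp η =
    Complex.exp (-(Complex.I * (⟪φ, η⟫_ℂ).im)) • S.weylOp (φ + η) :=
  S.total_coh.clm_ext <| by
    rintro _ ⟨χ, rfl⟩
    rw [mul_apply_eq_comp, weylOp_coh, map_smul, weylOp_coh, smul_apply, weylOp_coh, smul_smul,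
      smul_smul, smul_add, add_right_comm, add_assoc χ]
    congr 1
    rw [weylFactor, weylFactor, weylFactor, ← Complex.exp_add, ← Complex.exp_add]
    congr 1
    have h : (2 * Complex.I) * ((⟪φ, η⟫_ℂ).im : ℂ) = ⟪φ, η⟫_ℂ - ⟪η, φ⟫_ℂ := by
      rw [← inner_conj_symm η φ, Complex.sub_conj]; push_cast; ring
    simp only [inner_add_left, inner_add_right, inner_smul_right]
    linear_combination (1 / 2 : ℂ) * h + ⟪φ, η⟫_ℂ * Complex.I_sq

theorem weylOp_mul_neg (φ : 𝔥) : S.weylOp φ * S.weylOp (-φ) = 1 := by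
  rw [weylOp_mul, add_neg_cancel, weylOp_zero, inner_neg_right, Complex.neg_im, inner_self_im_zero]
  simp

theorem weylOp_mem_unitary (φ : 𝔥) : S.weylOp φ ∈ unitary (lp H 2 →L[ℂ] lp H 2) := by
  -- A vector orthogonal to the range is orthogonal to itself, since it equals `W(φ) W(-φ) y`.
  refine mem_unitary_of_isometry (S.inner_weylOp φ) fun y hy => hy y ⟨S.weylOp (-φ) y, ?_⟩ |>
    inner_self_eq_zero.1
  rw [← mul_apply_eq_comp, weylOp_mul_neg, one_apply_eq_self]

theorem star_weylOp (φ : 𝔥) : star (S.weylOp φ) = S.weylOp (-φ) := by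
  have h := (Unitary.mem_iff.1 (S.weylOp_mem_unitary φ)).1
  calc star (S.weylOp φ) = star (S.weylOp φ) * (S.weylOp φ * S.weylOp (-φ)) := by
        rw [weylOp_mul_neg, mul_one]
    _ = S.weylOp (-φ) := by rw [← mul_assoc, h, one_mul]

theorem inner_weylOp_left (φ : 𝔥) (x y : lp H 2) :
    ⟪S.weylOp φ x, y⟫_ℂ = ⟪x, S.weylOp (-φ) y⟫_ℂ := by
  rw [← star_weylOp, ContinuousLinearMap.star_eq_adjoint, ContinuousLinearMap.adjoint_inner_right]

/-- The operators are isometric, so vectors with continuous orbits form a closed subspace. It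
contains the coherent vectors, whose orbits are explicit. -/
theorem continuous_weylOp (ψ : lp H 2) : Continuous fun φ => S.weylOp φ ψ := by
  have hclosed : IsClosed {ψ : lp H 2 | Continuous fun φ => S.weylOp φ ψ} := by
    refine isClosed_of_closure_subset fun ψ hψ => ?_
    refine continuous_of_uniform_approx_of_continuous fun u hu => ?_
    obtain ⟨ε, hε, hu⟩ := Metric.mem_uniformity_dist.1 hu
    obtain ⟨ψ', hψ', hd⟩ := Metric.mem_closure_iff.1 hψ ε hε
    refine ⟨fun φ => S.weylOp φ ψ', hψ', fun φ => hu ?_⟩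
    rw [dist_eq_norm, ← map_sub, norm_unitary_apply (S.weylOp_mem_unitary φ), ← dist_eq_norm]
    exact hd
  have hspan : (Submodule.span ℂ (Set.range S.coh) : Set (lp H 2)) ⊆
      {ψ : lp H 2 | Continuous fun φ => S.weylOp φ ψ} := by
    intro ψ hψ
    induction hψ using Submodule.span_induction with
    | mem x hx =>
      obtain ⟨χ, rfl⟩ := hx
      simp only [Set.mem_ofPred_eq, weylOp_coh, weylFactor]
      have := S.continuous_coh
      fun_prop
    | zero => simpa using continuous_const
    | add x y _ _ hx hy => simpa using Continuous.fun_add hx hy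
    | smul c x _ hx => simpa using Continuous.fun_const_smul hx c
  have := hclosed.closure_subset_iff.2 hspan
  exact this (S.total_coh.dense_span ψ)

theorem isUnitaryGroup_weylOp (φ : 𝔥) :
    IsUnitaryGroup fun t : ℝ => S.weylOp ((t : ℂ) • φ) where
  mem_unitary t := S.weylOp_mem_unitary _
  map_zero := by simp [weylOp_zero]
  map_add s t := by
    rw [weylOp_mul, Complex.ofReal_add, add_smul, inner_smul_left, inner_smul_right,
      Complex.conj_ofReal, Complex.im_ofReal_mul, Complex.im_ofReal_mul, inner_self_im_zero]
    simp
  continuous ψ := (S.continuous_weylOp ψ).comp (by fun_prop)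

theorem hasDerivAt_weylOp_coh (φ χ : 𝔥) :
    HasDerivAt (fun t : ℝ => S.weylOp ((t : ℂ) • φ) (S.coh χ)) (Complex.I • S.fieldCoh φ χ) 0 := by
  have h1 := S.hasDerivAt_coh (Complex.I • φ) χ 0
  have h2 : HasDerivAt (fun t : ℝ => weylFactor ((t : ℂ) • φ) χ) (Complex.I * ⟪φ, χ⟫_ℂ) 0 := by
    have e : (fun t : ℝ => weylFactor ((t : ℂ) • φ) χ) = fun t : ℝ => Complex.exp
        (-((t : ℂ) * (t : ℂ) * ⟪φ, φ⟫_ℂ) / 2 + Complex.I * ((t : ℂ) * ⟪φ, χ⟫_ℂ)) := by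
      ext t
      simp only [weylFactor, inner_smul_left, inner_smul_right, Complex.conj_ofReal]
      ring_nf
    rw [e]
    have h3 : HasDerivAt (fun z : ℂ => -(z * z * ⟪φ, φ⟫_ℂ) / 2 + Complex.I * (z * ⟪φ, χ⟫_ℂ))
        (Complex.I * ⟪φ, χ⟫_ℂ) ((0 : ℝ) : ℂ) := by
      have a := (hasDerivAt_id ((0 : ℝ) : ℂ))
      have b := ((((a.fun_mul a).mul_const ⟪φ, φ⟫_ℂ).fun_neg).div_const 2).fun_add
        ((a.mul_const ⟪φ, χ⟫_ℂ).const_mul Complex.I)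
      simpa using b
    simpa using h3.comp_ofReal.cexp
  have h4 := h2.fun_smul h1
  refine (h4.congr_deriv ?_).congr_of_eventuallyEq (Filter.Eventually.of_forall fun t => ?_)
  · simp [weylFactor, fieldCoh, crCoh_smul, smul_smul]
  · simp only [weylOp_coh, smul_comm Complex.I (t : ℂ)]

/-- A weak form of `Φ(φ) ψ = ξ` suffices for `ξ` to be the derivative of the Weyl group. -/
theorem hasDerivAt_weylOp {φ : 𝔥} {ψ ξ : lp H 2}
    (h : ∀ χ, ⟪S.fieldCoh φ χ, ψ⟫_ℂ = ⟪S.coh χ, ξ⟫_ℂ) :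
    HasDerivAt (fun t : ℝ => S.weylOp ((t : ℂ) • φ) ψ) (Complex.I • ξ) 0 := by
  have hU := S.isUnitaryGroup_weylOp φ
  have key := hasDerivAt_of_weak (f := fun t : ℝ => S.weylOp ((t : ℂ) • φ) ψ)
    (g := fun t : ℝ => S.weylOp ((t : ℂ) • φ) (Complex.I • ξ)) (hU.continuous _) S.total_coh ?_ 0
  · exact key.congr_deriv (by simp [weylOp_zero])
  rintro _ ⟨χ, rfl⟩ t
  have e : ∀ (t : ℝ) (y : lp H 2), ⟪S.coh χ, S.weylOp ((t : ℂ) • φ) y⟫_ℂ =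
      ⟪S.weylOp (((-t : ℝ) : ℂ) • φ) (S.coh χ), y⟫_ℂ := fun t y => by
    rw [inner_weylOp_left]; simp
  simp only [e]
  have h1 := hU.hasDerivAt (S.hasDerivAt_weylOp_coh φ χ) (-t)
  have h2 := (h1.scomp t (hasDerivAt_neg t)).inner ℂ (hasDerivAt_const t ψ)
  refine h2.congr_deriv ?_
  -- The group commutes with its generator, so the derivative at the translated coherent vector is
  -- again a scalar times a `fieldCoh`. This makes the weak hypothesis `h` applicable at every time,
  -- not only at `0`.
  have h3 : S.weylOp (((-t : ℝ) : ℂ) • φ) (Complex.I • S.fieldCoh φ χ) =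
      weylFactor (((-t : ℝ) : ℂ) • φ) χ • Complex.I •
        S.fieldCoh φ (χ + Complex.I • ((-t : ℝ) : ℂ) • φ) := by
    have h4 := hU.map_generator (S.hasDerivAt_weylOp_coh φ χ) (-t)
    have h5 := (S.hasDerivAt_weylOp_coh φ
      (χ + Complex.I • ((-t : ℝ) : ℂ) • φ)).const_smul (weylFactor (((-t : ℝ) : ℂ) • φ) χ)
    refine h4.unique (h5.congr_of_eventuallyEq (Filter.Eventually.of_forall fun s => ?_))
    simp only [weylOp_coh _ (((-t : ℝ) : ℂ) • φ), map_smul, Pi.smul_apply]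
  rw [h3, weylOp_coh]
  simp only [inner_zero_right, zero_add, inner_smul_left, inner_smul_right, neg_smul, one_smul,
    inner_neg_left, Complex.conj_I, h]
  ring

/-! ### Field operators -/

/-- `A` is the field operator `a(φ) + a†(φ)` on the finite-particle vectors. -/
def IsField (φ : 𝔥) (A : lp H 2 →ₗ.[ℂ] lp H 2) : Prop :=
  ∀ ψ χ : lp H 2, (ψ, χ) ∈ A.graph ↔ {n | ψ n ≠ 0}.Finite ∧ χ 0 = S.an 0 φ (ψ 1) ∧
    ∀ n, χ (n + 1) = S.cr n φ (ψ n) + S.an (n + 1) φ (ψ (n + 2))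

variable {S}

theorem IsField.mem_closure_graph {φ : 𝔥} {A : lp H 2 →ₗ.[ℂ] lp H 2} (hA : S.IsField φ A)
    {ψ V Y : lp H 2} (hV : S.IsCr φ ψ V) (hY : S.IsAn φ ψ Y) :
    (ψ, V + Y) ∈ closure (A.graph : Set (lp H 2 × lp H 2)) := by
  -- Creation raises and annihilation lowers the particle number. Cutting `ψ` to the components
  -- below `N + 1` therefore cuts `a†(φ) ψ` below `N + 2` and `a(φ) ψ` below `N`.
  have hlim : Filter.Tendsto (fun N => (trunc (N + 1) ψ, trunc (N + 2) V + trunc N Y))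
      Filter.atTop (nhds (ψ, V + Y)) :=
    ((tendsto_trunc ψ).comp (Filter.tendsto_add_atTop_nat 1)).prodMk_nhds
      (((tendsto_trunc V).comp (Filter.tendsto_add_atTop_nat 2)).add (tendsto_trunc Y))
  refine mem_closure_of_tendsto hlim (Filter.Eventually.of_forall fun N => ?_)
  refine (hA _ _).2 ⟨(Finset.range (N + 1)).finite_toSet.subset fun n hn => ?_, ?_, fun n => ?_⟩
  · by_contra hc
    simp only [Finset.coe_range, Set.mem_Iio] at hc
    exact hn (by rw [trunc_apply, if_neg hc])
  · rw [lp.coeFn_add, Pi.add_apply, trunc_apply, trunc_apply, trunc_apply, hV.1, hY 0]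
    simp only [ite_self, zero_add]
    by_cases h : 0 < N <;> simp [h]
  · rw [lp.coeFn_add, Pi.add_apply, trunc_apply, trunc_apply, trunc_apply, trunc_apply, hV.2,
      hY (n + 1)]
    by_cases h : n + 1 < N
    · rw [if_pos h, if_pos (by omega), if_pos (by omega), if_pos (by omega)]
    · rw [if_neg h, if_neg (show ¬n + 2 < N + 1 by omega), map_zero, add_zero, add_zero]
      by_cases h' : n < N + 1
      · rw [if_pos h', if_pos (by omega)]
      · rw [if_neg h', if_neg (by omega), map_zero]

theorem exists_isCr_isAn (S : FockStructure 𝔥 H) (φ : 𝔥) {ψ : lp H 2}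
    (hfin : {n | ψ n ≠ 0}.Finite) : ∃ V Y, S.IsCr φ ψ V ∧ S.IsAn φ ψ Y := by
  obtain ⟨N, hN⟩ := hfin.bddAbove
  have hz : ∀ k, N < k → ψ k = 0 := fun k hk => by
    by_contra hc
    exact absurd (hN hc) (not_le.2 hk)
  let v : ∀ n, H n := fun n => match n with
    | 0 => 0
    | n + 1 => S.cr n φ (ψ n)
  have hv : Memℓp v 2 := by
    refine (memℓp_zero ?_).of_exponent_ge zero_le
    refine (Set.finite_Iic (N + 1)).subset fun n hn => ?_
    by_contra hc
    simp only [Set.mem_Iic, not_le] at hc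
    cases n with
    | zero => omega
    | succ n => exact hn (by simp [v, hz n (by omega)])
  have hy : Memℓp (fun n => S.an n φ (ψ (n + 1))) 2 := by
    refine (memℓp_zero ?_).of_exponent_ge zero_le
    refine (Set.finite_Iic (N + 1)).subset fun n hn => ?_
    by_contra hc
    simp only [Set.mem_Iic, not_le] at hc
    exact hn (by simp [hz (n + 1) (by omega)])
  exact ⟨⟨v, hv⟩, ⟨_, hy⟩, ⟨rfl, fun n => rfl⟩, fun n => rfl⟩

theorem IsField.exists_isCr_isAn {φ : 𝔥} {A : lp H 2 →ₗ.[ℂ] lp H 2} (hA : S.IsField φ A)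
    {ψ χ : lp H 2} (h : (ψ, χ) ∈ A.graph) :
    ∃ V Y, S.IsCr φ ψ V ∧ S.IsAn φ ψ Y ∧ χ = V + Y := by
  obtain ⟨hfin, h0, hs⟩ := (hA ψ χ).1 h
  obtain ⟨V, Y, hV, hY⟩ := S.exists_isCr_isAn φ hfin
  refine ⟨V, Y, hV, hY, lp.ext (funext fun n => ?_)⟩
  rw [lp.coeFn_add, Pi.add_apply]
  cases n with
  | zero => rw [hV.1, hY 0, zero_add, h0]
  | succ n => rw [hV.2, hY (n + 1), hs n]

theorem IsCr.inner_add {φ : 𝔥} {ψ V Y ψ' V' Y' : lp H 2} (hV : S.IsCr φ ψ V) (hY : S.IsAn φ ψ Y)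
    (hV' : S.IsCr φ ψ' V') (hY' : S.IsAn φ ψ' Y') : ⟪V + Y, ψ'⟫_ℂ = ⟪ψ, V' + Y'⟫_ℂ := by
  rw [inner_add_left, inner_add_right, hV.inner S hY', add_comm]
  congr 1
  rw [← inner_conj_symm, ← hV'.inner S hY, inner_conj_symm]

theorem IsField.inner_graph {φ : 𝔥} {A : lp H 2 →ₗ.[ℂ] lp H 2} (hA : S.IsField φ A)
    {ψ χ ψ' V' Y' : lp H 2} (h : (ψ, χ) ∈ A.graph) (hV' : S.IsCr φ ψ' V') (hY' : S.IsAn φ ψ' Y') :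
    ⟪χ, ψ'⟫_ℂ = ⟪ψ, V' + Y'⟫_ℂ := by
  obtain ⟨V, Y, hV, hY, rfl⟩ := hA.exists_isCr_isAn h
  exact hV.inner_add hY hV' hY'

theorem IsField.total_domain {φ : 𝔥} {A : lp H 2 →ₗ.[ℂ] lp H 2} (hA : S.IsField φ A) :
    Total (A.domain : Set (lp H 2)) := by
  intro y hy
  refine lp.ext (funext fun n => ?_)
  have hfin : {k | (lp.single 2 n (y n) : lp H 2) k ≠ 0}.Finite :=
    (Set.finite_singleton n).subset fun k hk => by
      by_contra hc
      exact hk (by rw [lp.single_apply, Pi.single_eq_of_ne hc])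
  obtain ⟨V, Y, hV, hY⟩ := S.exists_isCr_isAn φ hfin
  have hg : (lp.single 2 n (y n), V + Y) ∈ A.graph := by
    refine (hA _ _).2 ⟨hfin, ?_, fun k => ?_⟩
    · rw [lp.coeFn_add, Pi.add_apply, hV.1, hY 0, zero_add]
    · rw [lp.coeFn_add, Pi.add_apply, hV.2, hY (k + 1)]
  have h1 := hy _ (LinearPMap.mem_domain_of_mem_graph hg)
  rw [lp.inner_single_left] at h1
  exact inner_self_eq_zero.1 h1

/-- The field is densely defined and symmetric, hence contained in its adjoint, which is closed. -/
theorem IsField.isClosable {φ : 𝔥} {A : lp H 2 →ₗ.[ℂ] lp H 2} (hA : S.IsField φ A) :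
    A.IsClosable := by
  have hdense : Dense (A.domain : Set (lp H 2)) := by
    have := hA.total_domain.dense_span
    rwa [Submodule.span_eq] at this
  refine (A.adjoint_isClosed hdense).isClosable.leIsClosable ?_
  refine LinearPMap.IsFormalAdjoint.le_adjoint hdense fun x y => ?_
  obtain ⟨V, Y, hV, hY, e⟩ := hA.exists_isCr_isAn (A.mem_graph y)
  rw [hA.inner_graph (A.mem_graph x) hV hY, e]

/-- That the closure lies in the generator follows from the weak identity against coherent vectors,
which survives limits in the graph. The converse uses the coherent vectors as a core: they are
total, they lie in the domain of the closure, and the Weyl group maps each of them to a multiple of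
another. -/
theorem IsField.isExpI {φ : 𝔥} {A : lp H 2 →ₗ.[ℂ] lp H 2} (hA : S.IsField φ A) :
    IsExpI A.closure (S.weylOp φ) := by
  have hcl : ∀ p, p ∈ A.closure.graph ↔ p ∈ closure (A.graph : Set (lp H 2 × lp H 2)) := fun p => by
    rw [← hA.isClosable.graph_closure_eq_closure_graph]; rfl
  have hgen : ∀ ψ χ : lp H 2, (ψ, χ) ∈ A.closure.graph →
      HasDerivAt (fun t : ℝ => S.weylOp ((t : ℂ) • φ) ψ) (Complex.I • χ) 0 := by
    intro ψ ξ h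
    refine S.hasDerivAt_weylOp fun χ => ?_
    have hc : IsClosed {p : lp H 2 × lp H 2 | ⟪S.fieldCoh φ χ, p.1⟫_ℂ = ⟪S.coh χ, p.2⟫_ℂ} :=
      isClosed_eq (by fun_prop) (by fun_prop)
    refine hc.closure_subset_iff.2 ?_ ((hcl _).1 h)
    rintro ⟨ψ, ξ⟩ hp
    have := hA.inner_graph hp (S.isCr_crCoh φ χ) (S.isAn_coh φ χ)
    simp only [Set.mem_ofPred_eq]
    rw [← inner_conj_symm, fieldCoh, ← this, inner_conj_symm]
  refine ⟨fun t => S.weylOp ((t : ℂ) • φ), S.isUnitaryGroup_weylOp φ,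
    fun ψ χ => ⟨hgen ψ χ, fun h => ?_⟩, by simp⟩
  refine (S.isUnitaryGroup_weylOp φ).mem_of_hasDerivAt hA.isClosable.closure_isClosed hgen ?_ h
  intro y hy
  refine S.total_coh y ?_
  rintro _ ⟨χ, rfl⟩
  refine hy _ fun t => ?_
  refine ⟨weylFactor ((t : ℂ) • φ) χ • S.fieldCoh φ (χ + Complex.I • (t : ℂ) • φ), ?_⟩
  rw [weylOp_coh]
  exact A.closure.graph.smul_mem _ ((hcl _).2
    (hA.mem_closure_graph (S.isCr_crCoh φ _) (S.isAn_coh φ _)))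

theorem IsField.eq_weylOp {φ : 𝔥} {A : lp H 2 →ₗ.[ℂ] lp H 2} (hA : S.IsField φ A)
    {W : lp H 2 →L[ℂ] lp H 2} (hW : IsExpI A.closure W) : W = S.weylOp φ := by
  refine IsExpI.eq ?_ hW hA.isExpI
  intro y hy
  exact hA.total_domain y fun η hη => hy η ((LinearPMap.le_closure A).1 hη)

variable (S)

/-! ### Irreducibility -/

theorem coh_eq_weylOp (χ : 𝔥) : ∃ c : ℂ, ∃ φ, S.coh χ = c • S.weylOp φ (S.coh 0) := by
  refine ⟨(weylFactor (-Complex.I • χ) 0)⁻¹, -Complex.I • χ, ?_⟩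
  rw [weylOp_coh, smul_smul, inv_mul_cancel₀ (weylFactor_ne_zero _ _), one_smul, zero_add,
    smul_smul]
  simp

/-- The Weyl operators act irreducibly. -/
theorem eq_smul_one_of_commute {C : lp H 2 →L[ℂ] lp H 2}
    (hC : ∀ φ, C * S.weylOp φ = S.weylOp φ * C) : ∃ z : ℂ, C = z • 1 := by
  set ξ := C (S.coh 0)
  set ζ := star C (S.coh 0)
  -- Commutation of `C` with the Weyl operators, read between vacuum vectors. The normalizing
  -- factors on the two sides are equal and cancel.
  have h1 : ∀ φ, ⟪S.coh φ, ξ⟫_ℂ = ⟪ζ, S.coh (-φ)⟫_ℂ := by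
    intro φ
    have e1 : ⟪S.weylOp (-Complex.I • φ) (S.coh 0), ξ⟫_ℂ =
        ⟪ζ, S.weylOp (-(-Complex.I • φ)) (S.coh 0)⟫_ℂ := by
      rw [inner_weylOp_left, ← mul_apply_eq_comp, ← hC, mul_apply_eq_comp]
      simp only [ζ, ContinuousLinearMap.star_eq_adjoint, ContinuousLinearMap.adjoint_inner_left]
    rw [weylOp_coh, weylOp_coh, inner_smul_left, inner_smul_right, weylFactor, weylFactor,
      ← Complex.exp_conj] at e1
    simp only [inner_zero_right, mul_zero, add_zero, map_div₀, map_neg, inner_conj_symm,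
      inner_neg_left, inner_neg_right, neg_neg, map_ofNat, zero_add, smul_neg, smul_smul,
      neg_smul, Complex.I_mul_I, one_smul] at e1
    exact mul_left_cancel₀ (Complex.exp_ne_zero _) e1
  have h2 : ∀ φ n, (n.factorial : ℂ)⁻¹ * ⟪S.pow φ n, ξ n⟫_ℂ =
      (n.factorial : ℂ)⁻¹ * ⟪ζ n, S.pow (-φ) n⟫_ℂ := by
    intro φ n
    refine sub_eq_zero.1 (coeff_eq_zero_of_hasSum (c := fun n =>
      (n.factorial : ℂ)⁻¹ * ⟪S.pow φ n, ξ n⟫_ℂ - (n.factorial : ℂ)⁻¹ * ⟪ζ n, S.pow (-φ) n⟫_ℂ)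
      (fun r => ?_) n)
    have a := lp.hasSum_inner (𝕜 := ℂ) (S.coh ((r : ℂ) • φ)) ξ
    have b := lp.hasSum_inner (𝕜 := ℂ) ζ (S.coh (-((r : ℂ) • φ)))
    have c := a.sub b
    rw [h1, sub_self] at c
    refine hasSum_of_eq c fun n => ?_
    rw [← smul_neg, coh_apply, coh_apply, pow_smul, pow_smul, inner_smul_left, inner_smul_left,
      inner_smul_right, inner_smul_right]
    simp only [map_inv₀, map_natCast, map_pow, Complex.conj_ofReal, Complex.real_smul]
    push_cast
    ring
  have h3 : ∀ n, ξ (n + 1) = 0 := by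
    intro n
    refine S.total_pow _ _ fun φ => ?_
    -- The left side of `h2` is antilinear in the power of `φ`, the right side linear. Replacing `φ`
    -- by `u φ` with `u ^ (n + 1) = i` multiplies them by `-i` and `i`, so both vanish, and `C Ω`
    -- has no component above the vacuum.
    set u : ℂ := Complex.exp ((Real.pi / (2 * (n + 1)) : ℝ) * Complex.I)
    have hu : u ^ (n + 1) = Complex.I := by
      rw [← Complex.exp_nat_mul]
      have hn : (n + 1 : ℂ) ≠ 0 := by exact_mod_cast n.succ_ne_zero
      have : ((n + 1 : ℕ) : ℂ) * ((Real.pi / (2 * (n + 1)) : ℝ) * Complex.I) =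
          Real.pi / 2 * Complex.I := by push_cast; field_simp
      rw [this, Complex.exp_pi_div_two_mul_I]
    have a := h2 φ (n + 1)
    have b := h2 (u • φ) (n + 1)
    rw [← smul_neg, pow_smul, pow_smul, inner_smul_left, inner_smul_right, map_pow, ← map_pow, hu,
      Complex.conj_I] at b
    have hf : ((n + 1).factorial : ℂ) ≠ 0 := by exact_mod_cast (n + 1).factorial_ne_zero
    field_simp at a b
    have h4 : (2 * Complex.I) * ⟪S.pow φ (n + 1), ξ (n + 1)⟫_ℂ = 0 := by
      linear_combination Complex.I * (a - b)
    simpa using h4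
  obtain ⟨z, hz⟩ := S.zero_eq (ξ 0)
  have hξ : ξ = z • S.coh 0 := by
    refine lp.ext (funext fun n => ?_)
    rw [lp.coeFn_smul, Pi.smul_apply, coh_apply]
    cases n with
    | zero => simpa [pow] using hz
    | succ n => rw [h3]; simp [pow]
  refine ⟨z, S.total_coh.clm_ext ?_⟩
  rintro _ ⟨χ, rfl⟩
  obtain ⟨c, φ, e⟩ := S.coh_eq_weylOp χ
  have : C (S.weylOp φ (S.coh 0)) = S.weylOp φ ξ := by
    rw [← mul_apply_eq_comp, hC, mul_apply_eq_comp]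
  rw [e, map_smul, this, hξ, map_smul, smul_apply, one_apply_eq_self, smul_comm]

end FockStructure

namespace FockStructure

variable {𝔥 : Type*} [NormedAddCommGroup 𝔥] [InnerProductSpace ℂ 𝔥]
variable {H : ℕ → Type*} [∀ n, NormedAddCommGroup (H n)] [∀ n, InnerProductSpace ℂ (H n)]
variable [∀ n, CompleteSpace (H n)] (S : FockStructure 𝔥 H)

/-! ### Pair creation -/

/-- Duality: the row of annihilation operators is the adjoint of the column map `(ψⱼ) ↦ ∑ a†(eⱼ)
ψⱼ`, so it inherits the bound. Concretely, pair `ψ` with `∑ a†(eⱼ) a(eⱼ) ψ` and cancel one factor of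
the sum. -/
theorem sum_norm_an_sq_le_of {ι : Type*} {n : ℕ} {e : ι → 𝔥}
    (h : ∀ (F : Finset ι) (ψ : ι → H n), ‖∑ j ∈ F, S.cr n (e j) (ψ j)‖ ^ 2 ≤
      (n + 1) * ∑ j ∈ F, ‖ψ j‖ ^ 2) (F : Finset ι) (ψ : H (n + 1)) :
    ∑ j ∈ F, ‖S.an n (e j) ψ‖ ^ 2 ≤ (n + 1) * ‖ψ‖ ^ 2 := by
  set a := ∑ j ∈ F, ‖S.an n (e j) ψ‖ ^ 2
  have ha : 0 ≤ a := Finset.sum_nonneg fun _ _ => by positivity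
  have h1 : ⟪ψ, ∑ j ∈ F, S.cr n (e j) (S.an n (e j) ψ)⟫_ℂ = (a : ℂ) := by
    rw [inner_sum, Complex.ofReal_sum]
    refine Finset.sum_congr rfl fun j _ => ?_
    rw [inner_cr_right, inner_self_eq_norm_sq_to_K]
    exact (Complex.ofReal_pow _ _).symm
  have h2 : a ≤ ‖ψ‖ * ‖∑ j ∈ F, S.cr n (e j) (S.an n (e j) ψ)‖ := by
    have := norm_inner_le_norm (𝕜 := ℂ) ψ (∑ j ∈ F, S.cr n (e j) (S.an n (e j) ψ))
    rwa [h1, Complex.norm_real, Real.norm_of_nonneg ha] at this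
  have h3 := h F fun j => S.an n (e j) ψ
  have h4 : a ^ 2 ≤ ‖ψ‖ ^ 2 * ((n + 1) * a) :=
    calc a ^ 2 ≤ (‖ψ‖ * ‖∑ j ∈ F, S.cr n (e j) (S.an n (e j) ψ)‖) ^ 2 := by gcongr
      _ ≤ _ := by rw [mul_pow]; gcongr
  rcases ha.eq_or_lt with h0 | h0
  · rw [← h0]; positivity
  · nlinarith

/-- Induction on the particle number. The commutation relations split the square into the diagonal
`∑ ‖ψⱼ‖²` and an exchange term. By Cauchy–Schwarz and the dual bound one level below, the exchange
term costs `n + 1` times the diagonal. -/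
theorem norm_sum_cr_sq_le {ι : Type*} [DecidableEq ι] {e : ι → 𝔥} (he : Orthonormal ℂ e) (n : ℕ) :
    ∀ (F : Finset ι) (ψ : ι → H n), ‖∑ j ∈ F, S.cr n (e j) (ψ j)‖ ^ 2 ≤
      (n + 1) * ∑ j ∈ F, ‖ψ j‖ ^ 2 := by
  have hexp : ∀ (n : ℕ) (F : Finset ι) (ψ : ι → H n), ‖∑ j ∈ F, S.cr n (e j) (ψ j)‖ ^ 2 =
      ∑ j ∈ F, ∑ k ∈ F, (⟪ψ j, S.an n (e j) (S.cr n (e k) (ψ k))⟫_ℂ).re := by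
    intro n F ψ
    rw [← inner_self_eq_norm_sq (𝕜 := ℂ), sum_inner]
    simp only [inner_sum, inner_cr_left]
    simp
  have hdiag : ∀ (n : ℕ) (F : Finset ι) (ψ : ι → H n),
      ∑ j ∈ F, ∑ k ∈ F, (⟪ψ j, ⟪e j, e k⟫_ℂ • ψ k⟫_ℂ).re = ∑ j ∈ F, ‖ψ j‖ ^ 2 := by
    intro n F ψ
    refine Finset.sum_congr rfl fun j hj => ?_
    rw [Finset.sum_eq_single j]
    · rw [orthonormal_iff_ite.1 he, if_pos rfl, one_smul, ← inner_self_eq_norm_sq (𝕜 := ℂ)]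
      rfl
    · intro k _ hk
      rw [orthonormal_iff_ite.1 he, if_neg (Ne.symm hk)]
      simp
    · exact fun h => absurd hj h
  induction n with
  | zero =>
    intro F ψ
    rw [hexp]
    simp only [an, S.ccr_zero, hdiag]
    simp
  | succ n ih =>
    intro F ψ
    rw [hexp]
    have e1 : ∀ j k, (⟪ψ j, S.an (n + 1) (e j) (S.cr (n + 1) (e k) (ψ k))⟫_ℂ).re =
        (⟪ψ j, ⟪e j, e k⟫_ℂ • ψ k⟫_ℂ).re + (⟪S.an n (e k) (ψ j), S.an n (e j) (ψ k)⟫_ℂ).re := by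
      intro j k
      rw [an, S.ccr_succ, inner_add_right, Complex.add_re, ← an, inner_cr_right]
    simp only [e1, Finset.sum_add_distrib, hdiag]
    have e2 : ∑ j ∈ F, ∑ k ∈ F, (⟪S.an n (e k) (ψ j), S.an n (e j) (ψ k)⟫_ℂ).re ≤
        ∑ j ∈ F, ∑ k ∈ F, (‖S.an n (e k) (ψ j)‖ ^ 2 / 2 + ‖S.an n (e j) (ψ k)‖ ^ 2 / 2) := by
      refine Finset.sum_le_sum fun j _ => Finset.sum_le_sum fun k _ => ?_
      have := re_inner_le_norm (𝕜 := ℂ) (S.an n (e k) (ψ j)) (S.an n (e j) (ψ k))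
      have h2 := two_mul_le_add_sq ‖S.an n (e k) (ψ j)‖ ‖S.an n (e j) (ψ k)‖
      simp only [RCLike.re_to_complex] at this
      linarith
    have e3 : ∑ j ∈ F, ∑ k ∈ F, (‖S.an n (e k) (ψ j)‖ ^ 2 / 2 + ‖S.an n (e j) (ψ k)‖ ^ 2 / 2) =
        ∑ j ∈ F, ∑ k ∈ F, ‖S.an n (e k) (ψ j)‖ ^ 2 := by
      simp only [Finset.sum_add_distrib]
      rw [Finset.sum_comm (f := fun j k => ‖S.an n (e j) (ψ k)‖ ^ 2 / 2),
        ← Finset.sum_add_distrib]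
      refine Finset.sum_congr rfl fun j _ => ?_
      rw [← Finset.sum_add_distrib]
      exact Finset.sum_congr rfl fun k _ => by ring
    have e4 : ∑ j ∈ F, ∑ k ∈ F, ‖S.an n (e k) (ψ j)‖ ^ 2 ≤ ∑ j ∈ F, (n + 1) * ‖ψ j‖ ^ 2 :=
      Finset.sum_le_sum fun j _ => S.sum_norm_an_sq_le_of ih F (ψ j)
    rw [← Finset.mul_sum] at e4
    push_cast
    linarith

theorem norm_cr_sq_le (n : ℕ) (φ : 𝔥) (ψ : H n) :
    ‖S.cr n φ ψ‖ ^ 2 ≤ (n + 1) * ‖φ‖ ^ 2 * ‖ψ‖ ^ 2 := by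
  have := S.norm_cr_le n φ ψ
  calc ‖S.cr n φ ψ‖ ^ 2 ≤ (Real.sqrt (n + 1) * ‖φ‖ * ‖ψ‖) ^ 2 := by gcongr
    _ = _ := by rw [mul_pow, mul_pow, Real.sq_sqrt (by positivity)]

/-- `φ ↦ a†(φ) ψ` as a bounded operator. -/
def crRight (n : ℕ) (ψ : H n) : 𝔥 →L[ℂ] H (n + 1) :=
  LinearMap.mkContinuous
    { toFun := fun φ => S.cr n φ ψ
      map_add' := by simp
      map_smul' := by simp } (Real.sqrt (n + 1) * ‖ψ‖) fun φ => by
      have := S.norm_cr_le n φ ψ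
      simp only [LinearMap.coe_mk, AddHom.coe_mk]
      linarith

theorem crRight_apply (n : ℕ) (ψ : H n) (φ : 𝔥) : S.crRight n ψ φ = S.cr n φ ψ := rfl

variable {ι : Type*} (b : HilbertBasis ι ℂ 𝔥) (L : 𝔥 →L⋆[ℂ] 𝔥)

/-- The pair creation operator `∑ⱼ a†(bⱼ) a†(L bⱼ)`. -/
def pairCr (n : ℕ) (ψ : H n) : H (n + 2) := ∑' j, S.cr (n + 1) (b j) (S.cr n (L (b j)) ψ)

variable {b L} {ℓ : ℝ}

/-- Orthonormality of the outer vectors makes square summability of `‖L (b j)‖` sufficient; the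
triangle inequality would require summability. The outer and inner creation operators contribute `n
+ 2` and `n + 1`. -/
theorem norm_sum_pair_sq_le (n : ℕ) (ψ : H n) (F : Finset ι) :
    ‖∑ j ∈ F, S.cr (n + 1) (b j) (S.cr n (L (b j)) ψ)‖ ^ 2 ≤
      (n + 2) * (n + 1) * ‖ψ‖ ^ 2 * ∑ j ∈ F, ‖L (b j)‖ ^ 2 := by
  classical
  refine (S.norm_sum_cr_sq_le b.orthonormal (n + 1) F _).trans ?_
  have : ∑ j ∈ F, ‖S.cr n (L (b j)) ψ‖ ^ 2 ≤ ∑ j ∈ F, (n + 1) * ‖L (b j)‖ ^ 2 * ‖ψ‖ ^ 2 :=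
    Finset.sum_le_sum fun j _ => S.norm_cr_sq_le _ _ _
  rw [← Finset.sum_mul, ← Finset.mul_sum] at this
  push_cast
  calc ((n : ℝ) + 1 + 1) * ∑ j ∈ F, ‖S.cr n (L (b j)) ψ‖ ^ 2
      ≤ (n + 1 + 1) * ((n + 1) * (∑ j ∈ F, ‖L (b j)‖ ^ 2) * ‖ψ‖ ^ 2) := by gcongr
    _ = _ := by ring

theorem hasSum_pairCr (hL : ∀ F : Finset ι, ∑ j ∈ F, ‖L (b j)‖ ^ 2 ≤ ℓ ^ 2)
    (n : ℕ) (ψ : H n) :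
    HasSum (fun j => S.cr (n + 1) (b j) (S.cr n (L (b j)) ψ)) (S.pairCr b L n ψ) := by
  refine Summable.hasSum ?_
  have hs : Summable fun j => ‖L (b j)‖ ^ 2 :=
    summable_of_sum_le (fun _ => by positivity) hL
  rw [summable_iff_vanishing_norm]
  intro ε hε
  set K : ℝ := (n + 2) * (n + 1) * ‖ψ‖ ^ 2 + 1
  have hK : 0 < K := by positivity
  obtain ⟨s, hs⟩ := summable_iff_vanishing_norm.1 hs (ε ^ 2 / K) (by positivity)
  refine ⟨s, fun t ht => ?_⟩
  have h1 := hs t ht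
  have h0 : 0 ≤ ∑ j ∈ t, ‖L (b j)‖ ^ 2 := Finset.sum_nonneg fun _ _ => by positivity
  rw [Real.norm_of_nonneg h0, lt_div_iff₀ hK] at h1
  have h2 := S.norm_sum_pair_sq_le (b := b) (L := L) n ψ t
  refine lt_of_pow_lt_pow_left₀ 2 hε.le (h2.trans_lt ?_)
  nlinarith

theorem norm_pairCr_sq_le (hL : ∀ F : Finset ι, ∑ j ∈ F, ‖L (b j)‖ ^ 2 ≤ ℓ ^ 2)
    (n : ℕ) (ψ : H n) :
    ‖S.pairCr b L n ψ‖ ^ 2 ≤ (n + 2) * (n + 1) * ‖ψ‖ ^ 2 * ℓ ^ 2 := by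
  refine le_of_tendsto ((S.hasSum_pairCr hL n ψ).norm.pow 2) (Filter.Eventually.of_forall fun F => ?_)
  refine (S.norm_sum_pair_sq_le (b := b) (L := L) n ψ F).trans ?_
  gcongr
  exact hL F

theorem pairCr_cr (hL : ∀ F : Finset ι, ∑ j ∈ F, ‖L (b j)‖ ^ 2 ≤ ℓ ^ 2)
    (n : ℕ) (φ : 𝔥) (ψ : H n) :
    S.pairCr b L (n + 1) (S.cr n φ ψ) = S.cr (n + 2) φ (S.pairCr b L n ψ) := by
  refine (S.hasSum_pairCr hL (n + 1) _).unique ?_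
  refine hasSum_of_eq ((S.cr (n + 2) φ).hasSum (S.hasSum_pairCr hL n ψ)) fun j => ?_
  rw [S.cr_comm (n + 1) φ, S.cr_comm n φ]

theorem hasSum_cr_left (n : ℕ) (χ : 𝔥) (ψ : H n) :
    HasSum (fun j => ⟪χ, b j⟫_ℂ • S.cr n (L (b j)) ψ) (S.cr n (L χ) ψ) := by
  refine hasSum_of_eq ((S.crRight n ψ).hasSum (L.hasSum (b.hasSum_repr χ))) fun j => ?_
  rw [map_smulₛₗ, map_smul, crRight_apply, b.repr_apply_apply, inner_conj_symm]

/-- Symmetry of `L` turns the coefficients into those of the basis expansion of `L χ`. Contracting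
either member of a pair therefore produces the same operator. -/
theorem hasSum_cr_right (hsymm : ∀ x y, ⟪x, L y⟫_ℂ = ⟪y, L x⟫_ℂ) (n : ℕ) (χ : 𝔥) (ψ : H n) :
    HasSum (fun j => ⟪χ, L (b j)⟫_ℂ • S.cr n (b j) ψ) (S.cr n (L χ) ψ) := by
  refine hasSum_of_eq ((S.crRight n ψ).hasSum (b.hasSum_repr (L χ))) fun j => ?_
  rw [map_smul, crRight_apply, b.repr_apply_apply, hsymm]

theorem an_pairCr_zero (hL : ∀ F : Finset ι, ∑ j ∈ F, ‖L (b j)‖ ^ 2 ≤ ℓ ^ 2)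
    (hsymm : ∀ x y, ⟪x, L y⟫_ℂ = ⟪y, L x⟫_ℂ) (χ : 𝔥) (ψ : H 0) :
    S.an 1 χ (S.pairCr b L 0 ψ) = (2 : ℂ) • S.cr 0 (L χ) ψ := by
  refine ((S.an 1 χ).hasSum (S.hasSum_pairCr hL 0 ψ)).unique ?_
  rw [two_smul]
  refine hasSum_of_eq ((S.hasSum_cr_left (b := b) 0 χ ψ).add (S.hasSum_cr_right (b := b) hsymm 0 χ ψ)) fun j => ?_
  refine Eq.trans ?_ (S.ccr_succ 0 χ (b j) _).symm
  rw [S.ccr_zero, map_smul]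

/-- The annihilation operator may contract with either member of a pair, which gives `a†(L χ)`
twice, or pass through the pair and act on `ψ`. -/
theorem an_pairCr_succ (hL : ∀ F : Finset ι, ∑ j ∈ F, ‖L (b j)‖ ^ 2 ≤ ℓ ^ 2)
    (hsymm : ∀ x y, ⟪x, L y⟫_ℂ = ⟪y, L x⟫_ℂ) (n : ℕ) (χ : 𝔥) (ψ : H (n + 1)) :
    S.an (n + 2) χ (S.pairCr b L (n + 1) ψ) =
      (2 : ℂ) • S.cr (n + 1) (L χ) ψ + S.pairCr b L n (S.an n χ ψ) := by
  refine ((S.an (n + 2) χ).hasSum (S.hasSum_pairCr hL (n + 1) ψ)).unique ?_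
  rw [two_smul]
  refine hasSum_of_eq (((S.hasSum_cr_left (b := b) (n + 1) χ ψ).add
    (S.hasSum_cr_right (b := b) hsymm (n + 1) χ ψ)).add (S.hasSum_pairCr hL n (S.an n χ ψ))) fun j => ?_
  refine Eq.trans ?_ (S.ccr_succ (n + 1) χ (b j) _).symm
  rw [S.ccr_succ, map_add, map_smul, ← add_assoc]
  rfl

/-! ### Squeezed vectors -/

variable (b L) in
/-- The components of the squeezed vector `exp(½ ∑ⱼ a†(bⱼ) a†(L bⱼ)) Ω`. -/
def squeezedFun : ∀ n, H n
  | 0 => S.vac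
  | 1 => 0
  -- With `P` the pair operator, the component at `n = 2k` is `(P / 2)ᵏ Ω / k!`. The next one
  -- therefore carries the factor `1 / (2 (k + 1)) = 1 / (n + 2)`.
  | n + 2 => ((n : ℂ) + 2)⁻¹ • S.pairCr b L n (squeezedFun n)

theorem squeezedFun_add_two (n : ℕ) :
    S.squeezedFun b L (n + 2) = ((n : ℂ) + 2)⁻¹ • S.pairCr b L n (S.squeezedFun b L n) := by
  rw [squeezedFun]

/-- In the step from `n + 2` to `n + 4` the commutator with the pair operator contributes `2` and
the induction hypothesis contributes `n + 2`. Their sum cancels the coefficient `(n + 4)⁻¹`. Odd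
components vanish. -/
theorem an_squeezedFun (hL : ∀ F : Finset ι, ∑ j ∈ F, ‖L (b j)‖ ^ 2 ≤ ℓ ^ 2)
    (hsymm : ∀ x y, ⟪x, L y⟫_ℂ = ⟪y, L x⟫_ℂ) (χ : 𝔥) :
    ∀ n, S.an (n + 1) χ (S.squeezedFun b L (n + 2)) = S.cr n (L χ) (S.squeezedFun b L n)
  | 0 => by
    rw [squeezedFun_add_two, map_smul, S.an_pairCr_zero hL hsymm, smul_smul]
    simp
  | 1 => by
    have h : S.pairCr b L 1 (0 : H 1) = 0 := by simp [pairCr]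
    rw [squeezedFun_add_two, squeezedFun, h, smul_zero, map_zero, map_zero]
  | n + 2 => by
    have ih := an_squeezedFun hL hsymm χ n
    have h2 : ((n : ℂ) + 2) ≠ 0 := by exact_mod_cast (n + 1).succ_ne_zero
    have h4 : ((n : ℂ) + 2 + 2) ≠ 0 := by exact_mod_cast (n + 3).succ_ne_zero
    have e1 : S.pairCr b L n (S.squeezedFun b L n) = ((n : ℂ) + 2) • S.squeezedFun b L (n + 2) := by
      rw [squeezedFun_add_two, smul_smul, mul_inv_cancel₀ h2, one_smul]
    rw [squeezedFun_add_two _ (n + 2), map_smul, S.an_pairCr_succ hL hsymm (n + 1) χ, ih, S.pairCr_cr hL, e1, map_smul, ← add_smul, smul_smul]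
    push_cast
    rw [show (2 : ℂ) + (n + 2) = n + 2 + 2 by ring, inv_mul_cancel₀ h4, one_smul]

variable {r : ℝ}

/-- Adding a pair multiplies the norm by at most `√((n + 2)(n + 1)) r² / (n + 2) ≤ r²`. This is why
the Hilbert–Schmidt norm of `L` is bounded by `r ^ 2`: the vector then decays geometrically for `r <
1`. -/
theorem norm_squeezedFun_le (hr : 0 ≤ r)
    (hL : ∀ F : Finset ι, ∑ j ∈ F, ‖L (b j)‖ ^ 2 ≤ (r ^ 2) ^ 2) :
    ∀ n, ‖S.squeezedFun b L n‖ ≤ r ^ n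
  | 0 => by simp [squeezedFun, S.norm_vac]
  | 1 => by simpa [squeezedFun] using hr
  | n + 2 => by
    have ih := norm_squeezedFun_le hr hL n
    have h := S.norm_pairCr_sq_le hL n (S.squeezedFun b L n)
    have h1 : ‖S.pairCr b L n (S.squeezedFun b L n)‖ ≤ (n + 2) * r ^ (n + 2) := by
      refine (sq_le_sq₀ (norm_nonneg _) (by positivity)).1 (h.trans ?_)
      calc ((n : ℝ) + 2) * (n + 1) * ‖S.squeezedFun b L n‖ ^ 2 * (r ^ 2) ^ 2
          ≤ (n + 2) * (n + 2) * (r ^ n) ^ 2 * (r ^ 2) ^ 2 := by gcongr; norm_num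
        _ = ((n + 2) * r ^ (n + 2)) ^ 2 := by ring
    rw [squeezedFun, norm_smul, norm_inv]
    have h3 : ‖(n : ℂ) + 2‖ = n + 2 := by
      have : (n : ℂ) + 2 = ((n + 2 : ℕ) : ℂ) := by push_cast; rfl
      rw [this, RCLike.norm_natCast]; push_cast; rfl
    rw [h3, inv_mul_le_iff₀ (by positivity)]
    exact h1

theorem summable_mul_geometric (hr : 0 ≤ r) (hr1 : r < 1) (c : ℝ) :
    Summable fun n : ℕ => (n + 1) * c * (r ^ n) ^ 2 := by
  have h : ‖r ^ 2‖ < 1 := by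
    rw [Real.norm_of_nonneg (by positivity)]; exact pow_lt_one₀ hr hr1 two_ne_zero
  have h1 := (summable_pow_mul_geometric_of_norm_lt_one 1 h).add
    (summable_geometric_of_norm_lt_one h)
  refine (h1.mul_left c).congr fun n => ?_
  rw [← pow_mul, ← pow_mul, mul_comm 2 n]
  ring

variable (b L) in
/-- The components of `a†(φ)` applied to the squeezed vector. -/
def crSqueezedFun (φ : 𝔥) : ∀ n, H n
  | 0 => 0
  | n + 1 => S.cr n φ (S.squeezedFun b L n)

theorem memℓp_squeezedFun (hr : 0 ≤ r) (hr1 : r < 1)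
    (hL : ∀ F : Finset ι, ∑ j ∈ F, ‖L (b j)‖ ^ 2 ≤ (r ^ 2) ^ 2) :
    Memℓp (S.squeezedFun b L) 2 := memℓp_two_of_summable_sq <| by
  refine Summable.of_nonneg_of_le (fun _ => by positivity) (fun n => ?_)
    (summable_mul_geometric hr hr1 1)
  have h := S.norm_squeezedFun_le hr hL n
  calc ‖S.squeezedFun b L n‖ ^ 2 ≤ 1 * (r ^ n) ^ 2 := by rw [one_mul]; gcongr
    _ ≤ _ := by
        gcongr
        linarith [(Nat.cast_nonneg n : (0 : ℝ) ≤ n)]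

theorem memℓp_crSqueezedFun (hr : 0 ≤ r) (hr1 : r < 1)
    (hL : ∀ F : Finset ι, ∑ j ∈ F, ‖L (b j)‖ ^ 2 ≤ (r ^ 2) ^ 2) (φ : 𝔥) :
    Memℓp (S.crSqueezedFun b L φ) 2 := memℓp_two_of_summable_sq <| by
  rw [← summable_nat_add_iff 1]
  refine Summable.of_nonneg_of_le (fun _ => by positivity) (fun n => ?_)
    (summable_mul_geometric hr hr1 (‖φ‖ ^ 2))
  have h := S.norm_squeezedFun_le hr hL n
  refine (S.norm_cr_sq_le n φ _).trans ?_
  gcongr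

/-- A squeezed vector: for every `χ` it is annihilated by `a(χ) - a†(L χ)`. -/
theorem exists_squeezed (b : HilbertBasis ι ℂ 𝔥) (hr : 0 ≤ r) (hr1 : r < 1)
    (hL : ∀ F : Finset ι, ∑ j ∈ F, ‖L (b j)‖ ^ 2 ≤ (r ^ 2) ^ 2)
    (hsymm : ∀ x y, ⟪x, L y⟫_ℂ = ⟪y, L x⟫_ℂ) :
    ∃ (Ψ : lp H 2) (c : 𝔥 →ₗ[ℂ] lp H 2), Ψ ≠ 0 ∧ (∀ φ, S.IsCr φ Ψ (c φ)) ∧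
      ∀ φ, S.IsAn φ Ψ (c (L φ)) := by
  refine ⟨⟨_, S.memℓp_squeezedFun hr hr1 hL⟩,
    { toFun := fun φ => ⟨_, S.memℓp_crSqueezedFun hr hr1 hL φ⟩
      map_add' := fun φ χ => lp.ext (funext fun n => ?_)
      map_smul' := fun c φ => lp.ext (funext fun n => ?_) }, fun h => ?_, fun φ => ⟨rfl, fun n => rfl⟩,
    fun φ n => ?_⟩
  · rw [lp.coeFn_add, Pi.add_apply]
    cases n with
    | zero => simp [crSqueezedFun]
    | succ n => simp [crSqueezedFun]
  · rw [RingHom.id_apply, lp.coeFn_smul, Pi.smul_apply]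
    cases n with
    | zero => simp [crSqueezedFun]
    | succ n => simp [crSqueezedFun]
  · have h0 : S.vac = 0 := congrArg (fun ψ : lp H 2 => ψ 0) h
    have := S.norm_vac
    rw [h0, norm_zero] at this
    exact zero_ne_one this
  · cases n with
    | zero => exact (map_zero (S.an 0 φ)).symm
    | succ n => exact (S.an_squeezedFun hL hsymm φ n).symm

end FockStructure

namespace FockStructure

variable {𝔥 : Type*} [NormedAddCommGroup 𝔥] [InnerProductSpace ℂ 𝔥]
variable {H : ℕ → Type*} [∀ n, NormedAddCommGroup (H n)] [∀ n, InnerProductSpace ℂ (H n)]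
variable [∀ n, CompleteSpace (H n)] (S : FockStructure 𝔥 H)

/-! ### Implementation of symplectic maps -/

theorem hasDerivAt_weylOp_of_isCr {φ : 𝔥} {ψ V Y : lp H 2} (hV : S.IsCr φ ψ V)
    (hY : S.IsAn φ ψ Y) :
    HasDerivAt (fun t : ℝ => S.weylOp ((t : ℂ) • φ) ψ) (Complex.I • (V + Y)) 0 :=
  S.hasDerivAt_weylOp fun χ => (S.isCr_crCoh φ χ).inner_add (S.isAn_coh φ χ) hV hY

/-- Differentiate at `t = 0` the Weyl relation `W(φ) W(tη) = e^{-2it Im⟪φ, η⟫} W(tη) W(φ)` in the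
expectation at `Ψ`. -/
theorem inner_weylOp_generator {φ η : 𝔥} {Ψ ξ : lp H 2}
    (h : HasDerivAt (fun t : ℝ => S.weylOp ((t : ℂ) • η) Ψ) (Complex.I • ξ) 0) :
    ⟪Ψ, S.weylOp φ ξ⟫_ℂ =
      -(2 * (⟪φ, η⟫_ℂ).im) * ⟪Ψ, S.weylOp φ Ψ⟫_ℂ + ⟪ξ, S.weylOp φ Ψ⟫_ℂ := by
  have h1 := (hasDerivAt_const (0 : ℝ) Ψ).inner ℂ (hasDerivAt_clm_apply (S.weylOp φ) h)
  have e : ∀ t : ℝ, ⟪Ψ, S.weylOp φ (S.weylOp ((t : ℂ) • η) Ψ)⟫_ℂ =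
      Complex.exp (t * (-(2 * Complex.I * (⟪φ, η⟫_ℂ).im))) *
        ⟪S.weylOp (((-t : ℝ) : ℂ) • η) Ψ, S.weylOp φ Ψ⟫_ℂ := by
    intro t
    rw [inner_weylOp_left, ← mul_apply_eq_comp, ← mul_apply_eq_comp, weylOp_mul, weylOp_mul,
      Complex.ofReal_neg, neg_smul, neg_neg, add_comm φ]
    simp only [smul_apply, inner_smul_left, inner_smul_right, Complex.conj_ofReal,
      Complex.im_ofReal_mul]
    rw [← mul_assoc, ← Complex.exp_add, ← inner_conj_symm η φ, Complex.conj_im]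
    congr 2
    push_cast
    ring
  have h2 : HasDerivAt (fun t : ℝ => S.weylOp (((-t : ℝ) : ℂ) • η) Ψ) (-(Complex.I • ξ)) 0 := by
    have h0 : HasDerivAt (fun t : ℝ => S.weylOp ((t : ℂ) • η) Ψ) (Complex.I • ξ) (-0) := by
      rwa [neg_zero]
    exact (h0.scomp 0 (hasDerivAt_neg 0)).congr_deriv (by rw [neg_smul, one_smul])
  have h3 : HasDerivAt (fun t : ℝ => Complex.exp (t * (-(2 * Complex.I * (⟪φ, η⟫_ℂ).im))))
      (-(2 * Complex.I * (⟪φ, η⟫_ℂ).im)) 0 := by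
    have := (((hasDerivAt_id ((0 : ℝ) : ℂ)).mul_const
      (-(2 * Complex.I * (⟪φ, η⟫_ℂ).im))).cexp).comp_ofReal
    simpa using this
  have h4 := h3.fun_mul (h2.inner ℂ (hasDerivAt_const (0 : ℝ) (S.weylOp φ Ψ)))
  simp only [e] at h1
  have h5 := h1.unique h4
  simp only [map_smul, inner_smul_right, inner_zero_left, inner_zero_right, add_zero, zero_add,
    Complex.ofReal_zero, zero_mul, Complex.exp_zero, one_mul, neg_zero, zero_smul, weylOp_zero,
    one_apply_eq_self, inner_neg_left, inner_smul_left, Complex.conj_I] at h5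
  have hI : Complex.I ≠ 0 := Complex.I_ne_zero
  apply mul_left_cancel₀ hI
  linear_combination h5

/-- A vector that is annihilated by the annihilation operators of a complex structure defines the
corresponding Gaussian state. -/
theorem inner_weylOp_gaussian {φ η : 𝔥} {Ψ ξ : lp H 2}
    (hφ : HasDerivAt (fun t : ℝ => S.weylOp ((t : ℂ) • φ) Ψ) (Complex.I • ξ) 0)
    (hη : HasDerivAt (fun t : ℝ => S.weylOp ((t : ℂ) • η) Ψ) (Complex.I • (Complex.I • ξ)) 0) :
    ⟪Ψ, S.weylOp φ Ψ⟫_ℂ = Complex.exp (-((⟪φ, η⟫_ℂ).im / 2 : ℝ)) * ⟪Ψ, Ψ⟫_ℂ := by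
  set κ := (⟪φ, η⟫_ℂ).im with hκ
  set F : ℝ → ℂ := fun t => ⟪Ψ, S.weylOp ((t : ℂ) • φ) Ψ⟫_ℂ with hF
  have hF' : ∀ t, HasDerivAt F (-(t * κ) * F t) t := by
    intro t
    have h1 := (hasDerivAt_const t Ψ).inner ℂ ((S.isUnitaryGroup_weylOp φ).hasDerivAt hφ t)
    refine h1.congr_deriv ?_
    -- For `φ` the commutator term is zero, so `ξ` may be moved from one side of the expectation to
    -- the other. For `η` the generator vector is `iξ`, and moving it flips the sign of `i`.
    -- Together they eliminate `ξ` and leave the Gaussian equation `F' = -tκ F`.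
    have a := S.inner_weylOp_generator (φ := (t : ℂ) • φ) hφ
    have b := S.inner_weylOp_generator (φ := (t : ℂ) • φ) hη
    rw [inner_smul_left, Complex.conj_ofReal, Complex.im_ofReal_mul, inner_self_im_zero] at a
    rw [inner_smul_left, Complex.conj_ofReal, Complex.im_ofReal_mul, ← hκ] at b
    simp only [map_smul, inner_smul_right, inner_smul_left, inner_zero_left, add_zero,
      Complex.conj_I] at b ⊢
    simp only [mul_zero, Complex.ofReal_zero, neg_zero, zero_mul, zero_add] at a
    push_cast at b
    linear_combination (1 / 2 : ℂ) * b + (Complex.I / 2) * a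
  have hG : ∀ t, HasDerivAt (fun t : ℝ => Complex.exp (t * t * κ / 2) * F t) 0 t := by
    intro t
    have h1 : HasDerivAt (fun t : ℝ => Complex.exp (t * t * κ / 2))
        (Complex.exp (t * t * κ / 2) * (t * κ)) t := by
      have a := hasDerivAt_id (t : ℂ)
      have := (((a.fun_mul a).mul_const (κ : ℂ)).div_const 2).cexp.comp_ofReal
      refine this.congr_deriv ?_
      simp only [id_eq]
      ring
    exact (h1.fun_mul (hF' t)).congr_deriv (by ring)
  have hc := is_const_of_deriv_eq_zero (fun t => (hG t).differentiableAt)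
    (fun t => (hG t).deriv) 1 0
  simp only [hF, Complex.ofReal_one, one_smul, Complex.ofReal_zero, zero_smul, weylOp_zero,
    one_apply_eq_self, mul_one, one_mul, zero_mul, zero_div, Complex.exp_zero] at hc
  rw [← hc, ← mul_assoc, ← Complex.exp_add]
  push_cast
  simp

theorem inner_coh_zero_weylOp (φ : 𝔥) :
    ⟪S.coh 0, S.weylOp φ (S.coh 0)⟫_ℂ = Complex.exp (-((‖φ‖ ^ 2 / 2 : ℝ))) := by
  rw [weylOp_coh, inner_smul_right, inner_coh, weylFactor, inner_self_eq_norm_sq_to_K]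
  simp [neg_div]

theorem total_weylOp_coh_zero : Total (Set.range fun φ => S.weylOp φ (S.coh 0)) := by
  intro y hy
  refine S.total_coh y ?_
  rintro _ ⟨χ, rfl⟩
  obtain ⟨c, φ, e⟩ := S.coh_eq_weylOp χ
  rw [e, inner_smul_left, hy _ ⟨φ, rfl⟩, mul_zero]

/-- `T` is implemented by a unitary operator on the Fock space. -/
def Implementable (T : 𝔥 → 𝔥) : Prop :=
  ∃ V ∈ unitary (lp H 2 →L[ℂ] lp H 2), ∀ u, V * S.weylOp u = S.weylOp (T u) * V

variable {S} in
theorem Implementable.comp {T T' : 𝔥 → 𝔥} (h : S.Implementable T) (h' : S.Implementable T') :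
    S.Implementable (T ∘ T') := by
  obtain ⟨V, hV, e⟩ := h
  obtain ⟨V', hV', e'⟩ := h'
  exact ⟨V * V', mul_mem hV hV', fun u => by
    rw [mul_assoc, e', ← mul_assoc, e, mul_assoc, Function.comp_apply]⟩

theorem implementable_id : S.Implementable id := ⟨1, one_mem _, fun u => by simp⟩

/-- A surjective symplectic map whose Gaussian state is a vector state is implementable. -/
theorem implementable_of_vector {T : 𝔥 → 𝔥} (hadd : ∀ u v, T (u + v) = T u + T v)
    (hsurj : Function.Surjective T) (hsymp : ∀ u v, (⟪T u, T v⟫_ℂ).im = (⟪u, v⟫_ℂ).im)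
    {Ψ : lp H 2} (hΨ : ∀ u, ⟪Ψ, S.weylOp (T u) Ψ⟫_ℂ = Complex.exp (-((‖u‖ ^ 2 / 2 : ℝ)))) :
    S.Implementable T := by
  have hneg : ∀ u, T (-u) = -T u := fun u => by
    have h0 : T 0 = 0 := by simpa using hadd 0 0
    have := hadd u (-u)
    rw [add_neg_cancel, h0] at this
    exact (neg_eq_of_add_eq_zero_right this.symm).symm
  have hgram : ∀ u v, ⟪S.weylOp (T u) Ψ, S.weylOp (T v) Ψ⟫_ℂ =
      ⟪S.weylOp u (S.coh 0), S.weylOp v (S.coh 0)⟫_ℂ := by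
    intro u v
    rw [inner_weylOp_left, inner_weylOp_left, ← mul_apply_eq_comp, ← mul_apply_eq_comp,
      weylOp_mul, weylOp_mul, ← hneg, ← hadd, hsymp, smul_apply, smul_apply, inner_smul_right,
      inner_smul_right, hΨ, inner_coh_zero_weylOp]
  obtain ⟨V, hV, hiso⟩ := exists_isometry_of_gram S.total_weylOp_coh_zero hgram
  have hInt : ∀ u, V * S.weylOp u = S.weylOp (T u) * V := by
    intro u
    refine S.total_weylOp_coh_zero.clm_ext ?_
    rintro _ ⟨v, rfl⟩
    simp only
    rw [mul_apply_eq_comp, mul_apply_eq_comp, hV, ← mul_apply_eq_comp (S.weylOp u),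
      ← mul_apply_eq_comp (S.weylOp (T u)), weylOp_mul, weylOp_mul, smul_apply, smul_apply,
      map_smul, hV, hadd, hsymp]
  have hstar : ∀ u, star V * S.weylOp (T u) = S.weylOp u * star V := by
    intro u
    have := congrArg star (hInt (-u))
    rwa [star_mul, star_mul, star_weylOp, star_weylOp, hneg, neg_neg, neg_neg, eq_comm] at this
  have h1 : star V * V = 1 := by
    ext1 x
    refine ext_inner_left ℂ fun y => ?_
    rw [mul_apply_eq_comp, ContinuousLinearMap.star_eq_adjoint,
      ContinuousLinearMap.adjoint_inner_right, hiso, one_apply_eq_self]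
  -- Surjectivity of `T` makes the range projection `V V*` commute with every Weyl operator, so it
  -- is a scalar. The relation `V* V = 1` forces this scalar multiple to be the identity.
  obtain ⟨z, hz⟩ := S.eq_smul_one_of_commute (C := V * star V) fun φ => by
    obtain ⟨u, rfl⟩ := hsurj φ
    rw [mul_assoc, hstar, ← mul_assoc, hInt, mul_assoc]
  refine ⟨V, Unitary.mem_iff.2 ⟨h1, ?_⟩, hInt⟩
  have h2 : z • V = V := by
    calc z • V = (V * star V) * V := by rw [hz, smul_mul_assoc, one_mul]
      _ = V := by rw [mul_assoc, h1, mul_one]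
  have h4 : z • star V * V = (1 : lp H 2 →L[ℂ] lp H 2) := by
    rw [smul_mul_assoc, ← mul_smul_comm, h2, h1]
  have h5 : z • (1 : lp H 2 →L[ℂ] lp H 2) = 1 := by
    rw [smul_mul_assoc, h1] at h4
    exact h4
  rw [hz, h5]

/-- Squeezing: a symplectic bijection `T` whose antilinear part is `-L` times its linear part,
where `L` is symmetric with Hilbert–Schmidt norm less than `1`, is implementable. -/
theorem implementable_of_symm {ι : Type*} (b : HilbertBasis ι ℂ 𝔥) {T : 𝔥 → 𝔥}
    (hadd : ∀ u v, T (u + v) = T u + T v)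
    (hsurj : Function.Surjective T) (hsymp : ∀ u v, (⟪T u, T v⟫_ℂ).im = (⟪u, v⟫_ℂ).im)
    {L : 𝔥 →L⋆[ℂ] 𝔥} {r : ℝ} (hr : 0 ≤ r) (hr1 : r < 1)
    (hL : ∀ F : Finset ι, ∑ j ∈ F, ‖L (b j)‖ ^ 2 ≤ (r ^ 2) ^ 2)
    (hsymm : ∀ x y, ⟪x, L y⟫_ℂ = ⟪y, L x⟫_ℂ)
    (hLT : ∀ u, L (T u - Complex.I • T (Complex.I • u)) = -(T u + Complex.I • T (Complex.I • u))) :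
    S.Implementable T := by
  obtain ⟨Ψ, c, hΨ, hc, ha⟩ := S.exists_squeezed b hr hr1 hL hsymm
  have hn : ⟪Ψ, Ψ⟫_ℂ ≠ 0 := inner_self_ne_zero.2 hΨ
  have key : ∀ u, ⟪Ψ, S.weylOp (T u) Ψ⟫_ℂ = Complex.exp (-((‖u‖ ^ 2 / 2 : ℝ))) * ⟪Ψ, Ψ⟫_ℂ := by
    intro u
    have h1 := S.hasDerivAt_weylOp_of_isCr (hc (T u)) (ha (T u))
    have h2 := S.hasDerivAt_weylOp_of_isCr (hc (T (Complex.I • u))) (ha (T (Complex.I • u)))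
    -- This is where `L` enters: `hLT` says that on `Ψ` the field of `T (i u)` is `i` times the
    -- field of `T u`. The Gaussian lemma then applies to the pair `T u`, `T (i u)`, with exponent
    -- `Im ⟪u, i u⟫ = ‖u‖²`.
    have e : c (T (Complex.I • u)) + c (L (T (Complex.I • u))) =
        Complex.I • (c (T u) + c (L (T u))) := by
      have h3 := congrArg (fun x => Complex.I • c x) (hLT u)
      simp only [map_sub, map_smulₛₗ, map_neg, map_add, smul_sub, smul_add, smul_neg,
        Complex.conj_I, RingHom.id_apply, smul_smul] at h3 ⊢
      simp only [mul_neg, Complex.I_mul_I, neg_neg, one_smul, neg_smul] at h3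
      rw [← sub_eq_zero] at h3 ⊢
      rw [← neg_eq_zero, ← h3]
      abel
    rw [e] at h2
    rw [S.inner_weylOp_gaussian h1 h2, hsymp, inner_smul_right, inner_self_eq_norm_sq_to_K]
    congr 3
    simp [← Complex.ofReal_pow]
  set n := ‖Ψ‖
  have hn0 : (n : ℂ) ≠ 0 := by simpa [n] using hΨ
  refine S.implementable_of_vector hadd hsurj hsymp (Ψ := (n : ℂ)⁻¹ • Ψ) fun u => ?_
  rw [map_smul, inner_smul_left, inner_smul_right, key, inner_self_eq_norm_sq_to_K, map_inv₀,
    Complex.conj_ofReal]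
  change (n : ℂ)⁻¹ * ((n : ℂ)⁻¹ * (_ * (n : ℂ) ^ 2)) = _
  field_simp

end FockStructure

/-! ### Linear and antilinear parts of real-linear symplectic operators -/

section Symplectic

variable {𝔥 : Type*} [NormedAddCommGroup 𝔥] [InnerProductSpace ℂ 𝔥]

/-- The complex-linear part of a real-linear operator. -/
def linPart (X : 𝔥 →L[ℝ] 𝔥) : 𝔥 →L[ℂ] 𝔥 :=
  LinearMap.mkContinuous
    { toFun := fun x => (2⁻¹ : ℂ) • (X x - Complex.I • X (Complex.I • x))
      map_add' := fun x y => by simp only [map_add, smul_add, smul_sub]; abel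
      map_smul' := fun c x => by
        have e : ∀ y, X (c • y) = (c.re : ℂ) • X y + (c.im : ℂ) • X (Complex.I • y) := fun y => by
          conv_lhs => rw [← Complex.re_add_im c, add_smul, map_add, mul_smul]
          rw [Complex.coe_smul, Complex.coe_smul, map_smul, map_smul, Complex.coe_smul,
            Complex.coe_smul]
        rw [smul_comm Complex.I c x, e x, e (Complex.I • x), RingHom.id_apply, smul_smul Complex.I
          Complex.I x, Complex.I_mul_I, neg_one_smul, map_neg]
        conv_rhs => rw [← Complex.re_add_im c]
        match_scalars
        · ring
        · linear_combination ((c.im : ℂ) / 2) * Complex.I_mul_I }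
    ‖X‖ fun x => by
      change ‖(2⁻¹ : ℂ) • (X x - Complex.I • X (Complex.I • x))‖ ≤ _
      rw [norm_smul]
      have h1 := X.le_opNorm x
      have h2 := X.le_opNorm (Complex.I • x)
      have h3 := norm_sub_le (X x) (Complex.I • X (Complex.I • x))
      simp only [norm_smul, Complex.norm_I, one_mul] at h2 h3
      simp only [norm_inv, Complex.norm_ofNat]
      linarith

/-- The antilinear part of a real-linear operator. -/
def antiPart (X : 𝔥 →L[ℝ] 𝔥) : 𝔥 →L⋆[ℂ] 𝔥 :=
  LinearMap.mkContinuous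
    { toFun := fun x => (2⁻¹ : ℂ) • (X x + Complex.I • X (Complex.I • x))
      map_add' := fun x y => by simp only [map_add, smul_add]; abel
      map_smul' := fun c x => by
        have e : ∀ y, X (c • y) = (c.re : ℂ) • X y + (c.im : ℂ) • X (Complex.I • y) := fun y => by
          conv_lhs => rw [← Complex.re_add_im c, add_smul, map_add, mul_smul]
          rw [Complex.coe_smul, Complex.coe_smul, map_smul, map_smul, Complex.coe_smul,
            Complex.coe_smul]
        have hc : (starRingEnd ℂ) c = c.re - c.im * Complex.I := by
          apply Complex.ext <;> simp
        rw [smul_comm Complex.I c x, e x, e (Complex.I • x), smul_smul Complex.I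
          Complex.I x, Complex.I_mul_I, neg_one_smul, map_neg, hc]
        match_scalars
        · ring
        · linear_combination ((c.im : ℂ) / 2) * Complex.I_mul_I }
    ‖X‖ fun x => by
      change ‖(2⁻¹ : ℂ) • (X x + Complex.I • X (Complex.I • x))‖ ≤ _
      rw [norm_smul]
      have h1 := X.le_opNorm x
      have h2 := X.le_opNorm (Complex.I • x)
      have h3 := norm_add_le (X x) (Complex.I • X (Complex.I • x))
      simp only [norm_smul, Complex.norm_I, one_mul] at h2 h3
      simp only [norm_inv, Complex.norm_ofNat]
      linarith

theorem linPart_apply (X : 𝔥 →L[ℝ] 𝔥) (x : 𝔥) :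
    linPart X x = (2⁻¹ : ℂ) • (X x - Complex.I • X (Complex.I • x)) := rfl

theorem antiPart_apply (X : 𝔥 →L[ℝ] 𝔥) (x : 𝔥) :
    antiPart X x = (2⁻¹ : ℂ) • (X x + Complex.I • X (Complex.I • x)) := rfl

theorem norm_linPart_le (X : 𝔥 →L[ℝ] 𝔥) : ‖linPart X‖ ≤ ‖X‖ :=
  LinearMap.mkContinuous_norm_le _ (norm_nonneg _) _

theorem linPart_add_antiPart (X : 𝔥 →L[ℝ] 𝔥) (x : 𝔥) : linPart X x + antiPart X x = X x := by
  rw [linPart_apply, antiPart_apply, ← smul_add]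
  have : X x - Complex.I • X (Complex.I • x) + (X x + Complex.I • X (Complex.I • x)) =
    (2 : ℂ) • X x := by rw [two_smul]; abel
  rw [this, smul_smul]; norm_num

theorem antiPart_mul (X Y : 𝔥 →L[ℝ] 𝔥) (x : 𝔥) :
    antiPart (X * Y) x = linPart X (antiPart Y x) + antiPart X (linPart Y x) := by
  have h1 := linPart_add_antiPart Y x
  have h2 := linPart_add_antiPart Y (Complex.I • x)
  rw [map_smul, map_smulₛₗ] at h2
  rw [antiPart_apply (X * Y), mul_apply_eq_comp, mul_apply_eq_comp, ← h1, ← h2, linPart_apply X,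
    antiPart_apply X, ← smul_add, Complex.conj_I, neg_smul]
  simp only [map_add, map_neg]
  module

/-- The mixed terms of a symplectic map are symmetric. -/
theorem inner_linPart_antiPart_comm {T : 𝔥 →L[ℝ] 𝔥}
    (hsymp : ∀ u v, (⟪T u, T v⟫_ℂ).im = (⟪u, v⟫_ℂ).im) (u v : 𝔥) :
    ⟪linPart T u, antiPart T v⟫_ℂ = ⟪linPart T v, antiPart T u⟫_ℂ := by
  have key : ∀ u v, (⟪linPart T u, antiPart T v⟫_ℂ).im = (⟪linPart T v, antiPart T u⟫_ℂ).im := by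
    intro u v
    have h1 := hsymp u v
    -- Multiplying both arguments by `i` preserves the pure terms and negates the mixed ones, so
    -- comparison with `h1` isolates the latter. Replacing only `u` by `i u` afterwards converts
    -- imaginary parts into real parts.
    have h2 := hsymp (Complex.I • u) (Complex.I • v)
    simp only [← linPart_add_antiPart T, map_smul, map_smulₛₗ, inner_add_left, inner_add_right,
      inner_smul_left, inner_smul_right, Complex.conj_I, Complex.add_im, neg_neg, map_neg] at h1 h2
    have h3 : ∀ x y, (⟪antiPart T x, linPart T y⟫_ℂ).im = -(⟪linPart T y, antiPart T x⟫_ℂ).im :=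
      fun x y => by rw [← inner_conj_symm, Complex.conj_im]
    simp only [Complex.mul_im, Complex.mul_re, Complex.I_re, Complex.I_im, Complex.neg_re,
      Complex.neg_im, h3, Complex.add_re, Complex.add_im] at h1 h2
    linarith
  refine Complex.ext ?_ (key u v)
  have h := key (Complex.I • u) v
  simp only [map_smul, map_smulₛₗ, inner_smul_left, inner_smul_right, Complex.conj_I,
    Complex.mul_im, Complex.I_re, Complex.I_im, Complex.neg_re, Complex.neg_im] at h
  linarith

variable [CompleteSpace 𝔥]

/-- A real-linear operator that is skew for the symplectic form exponentiates to symplectic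
maps. -/
theorem im_inner_exp {B : 𝔥 →L[ℝ] 𝔥} (hB : ∀ x y, (⟪B x, y⟫_ℂ).im = -(⟪x, B y⟫_ℂ).im) (u v : 𝔥) :
    (⟪NormedSpace.exp B u, NormedSpace.exp B v⟫_ℂ).im = (⟪u, v⟫_ℂ).im := by
  have hd : ∀ (w : 𝔥) (t : ℝ), HasDerivAt (fun t : ℝ => NormedSpace.exp (t • B) w)
      (B (NormedSpace.exp (t • B) w)) t := fun w t => by
    have h := (hasDerivAt_exp_smul_const' (𝕂 := ℝ) B t)
    have h' := h.clm_apply (hasDerivAt_const t w)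
    rw [map_zero, add_zero] at h'
    exact h'
  have hc : ∀ t : ℝ, HasDerivAt (fun t : ℝ => (⟪NormedSpace.exp (t • B) u,
      NormedSpace.exp (t • B) v⟫_ℂ).im) 0 t := fun t => by
    have h := ((hd u t).inner ℂ (hd v t))
    have h' := Complex.imCLM.hasFDerivAt.comp_hasDerivAt t h
    refine h'.congr_deriv ?_
    change (⟪_, _⟫_ℂ + ⟪_, _⟫_ℂ).im = 0
    rw [Complex.add_im, hB]
    ring
  have h1 := is_const_of_deriv_eq_zero (fun t => (hc t).differentiableAt) (fun t => (hc t).deriv) 1 0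
  simpa using h1

theorem surjective_exp (B : 𝔥 →L[ℝ] 𝔥) :
    Function.Surjective (NormedSpace.exp B : 𝔥 →L[ℝ] 𝔥) := fun y => by
  let _ : NormedAlgebra ℚ (𝔥 →L[ℝ] 𝔥) := NormedAlgebra.restrictScalars ℚ ℝ _
  refine ⟨(NormedSpace.exp (-B) : 𝔥 →L[ℝ] 𝔥) y, ?_⟩
  have h := NormedSpace.exp_add_of_commute (𝔸 := 𝔥 →L[ℝ] 𝔥) (Commute.neg_right (Commute.refl B))
  rw [add_neg_cancel, NormedSpace.exp_zero] at h
  rw [← mul_apply_eq_comp, ← h, one_apply_eq_self]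

end Symplectic

/-! ### Hilbert–Schmidt bounds for antilinear parts -/

section HilbertSchmidt

variable {𝔥 : Type*} [NormedAddCommGroup 𝔥]
variable {ι : Type*} {b : ι → 𝔥}

/-- The Hilbert–Schmidt norm of `Y` with respect to the family `b` is at most `c`. -/
def HSLe (b : ι → 𝔥) (Y : 𝔥 → 𝔥) (c : ℝ) : Prop :=
  ∀ F : Finset ι, ‖(WithLp.toLp 2 fun j : F => Y (b j) : PiLp 2 fun _ : F => 𝔥)‖ ≤ c

theorem norm_toLp_sq (F : Finset ι) (Y : 𝔥 → 𝔥) :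
    ‖(WithLp.toLp 2 fun j : F => Y (b j) : PiLp 2 fun _ : F => 𝔥)‖ ^ 2 =
      ∑ j ∈ F, ‖Y (b j)‖ ^ 2 := by
  rw [PiLp.norm_sq_eq_of_L2, ← Finset.sum_coe_sort F fun j => ‖Y (b j)‖ ^ 2]

theorem hsLe_iff {Y : 𝔥 → 𝔥} {c : ℝ} (hc : 0 ≤ c) :
    HSLe b Y c ↔ ∀ F : Finset ι, ∑ j ∈ F, ‖Y (b j)‖ ^ 2 ≤ c ^ 2 := by
  refine forall_congr' fun F => ?_
  rw [← norm_toLp_sq, sq_le_sq₀ (norm_nonneg _) hc]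

theorem HSLe.congr {Y Z : 𝔥 → 𝔥} {c : ℝ} (h : HSLe b Y c) (e : ∀ x, Z x = Y x) : HSLe b Z c := by
  rwa [funext e]

theorem HSLe.mono {Y : 𝔥 → 𝔥} {c d : ℝ} (h : HSLe b Y c) (hcd : c ≤ d) : HSLe b Y d :=
  fun F => (h F).trans hcd

theorem HSLe.add {Y Z : 𝔥 → 𝔥} {c d : ℝ} (hY : HSLe b Y c) (hZ : HSLe b Z d) :
    HSLe b (fun x => Y x + Z x) (c + d) := fun F =>
  (norm_add_le (WithLp.toLp 2 fun j : F => Y (b j) : PiLp 2 fun _ : F => 𝔥)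
    (WithLp.toLp 2 fun j : F => Z (b j))).trans (add_le_add (hY F) (hZ F))

theorem hsLe_zero : HSLe b (fun _ => (0 : 𝔥)) 0 := fun F => by
  change ‖(0 : PiLp 2 fun _ : F => 𝔥)‖ ≤ 0
  simp

theorem HSLe.sum {κ : Type*} {Y : κ → 𝔥 → 𝔥} {c : κ → ℝ} (h : ∀ n, HSLe b (Y n) (c n))
    (s : Finset κ) : HSLe b (fun x => ∑ n ∈ s, Y n x) (∑ n ∈ s, c n) := by
  classical
  induction s using Finset.induction_on with
  | empty => simpa using hsLe_zero
  | insert a s ha ih => simp only [Finset.sum_insert ha]; exact (h a).add ih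

theorem HSLe.comp_left {Y Z : 𝔥 → 𝔥} {c K : ℝ} (hc : 0 ≤ c) (hK : 0 ≤ K) (hY : HSLe b Y c)
    (hZ : ∀ x, ‖Z x‖ ≤ K * ‖Y x‖) : HSLe b Z (K * c) := by
  rw [hsLe_iff (by positivity)]
  rw [hsLe_iff hc] at hY
  intro F
  calc ∑ j ∈ F, ‖Z (b j)‖ ^ 2 ≤ ∑ j ∈ F, (K * ‖Y (b j)‖) ^ 2 := by gcongr with j; exact hZ _
    _ = K ^ 2 * ∑ j ∈ F, ‖Y (b j)‖ ^ 2 := by simp only [mul_pow, Finset.mul_sum]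
    _ ≤ K ^ 2 * c ^ 2 := by gcongr; exact hY F
    _ = _ := by ring

theorem HSLe.of_hasSum {Y : ℕ → 𝔥 → 𝔥} {Z : 𝔥 → 𝔥} {c : ℕ → ℝ} {C : ℝ}
    (h : ∀ n, HSLe b (Y n) (c n)) (hc : ∀ s : Finset ℕ, ∑ n ∈ s, c n ≤ C) (hC : 0 ≤ C)
    (hZ : ∀ x, HasSum (fun n => Y n x) (Z x)) : HSLe b Z C := by
  rw [hsLe_iff hC]
  intro F
  have hlim : Filter.Tendsto (fun s : Finset ℕ => ∑ j ∈ F, ‖∑ n ∈ s, Y n (b j)‖ ^ 2) Filter.atTop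
      (nhds (∑ j ∈ F, ‖Z (b j)‖ ^ 2)) :=
    tendsto_finsetSum _ fun j _ => ((hZ (b j)).norm.pow 2)
  refine le_of_tendsto' hlim fun s => ?_
  exact (hsLe_iff hC).1 ((HSLe.sum h s).mono (hc s)) F

variable [InnerProductSpace ℂ 𝔥] [CompleteSpace 𝔥]

/-- Expand `Y (A bⱼ)` in the basis: by symmetry its coefficients are `⟪bⱼ, A* Y bₖ⟫`. Exchanging the
two sums of nonnegative terms leaves `∑ ‖A* Y bₖ‖²`, and `‖A*‖ = ‖A‖`. -/
theorem HSLe.comp_right_of_symm (b : HilbertBasis ι ℂ 𝔥) {Y : 𝔥 → 𝔥} {β : ℝ} (hβ : 0 ≤ β)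
    (hY : HSLe b Y β) (hsymm : ∀ x y, ⟪x, Y y⟫_ℂ = ⟪y, Y x⟫_ℂ) (A : 𝔥 →L[ℂ] 𝔥) :
    HSLe b (fun x => Y (A x)) (‖A‖ * β) := by
  have hpars : ∀ x : 𝔥, ∑' k, ‖⟪b k, x⟫_ℂ‖ₑ ^ 2 = ‖x‖ₑ ^ 2 := fun x => by
    have h := b.hasSum_inner_mul_inner x x
    have h1 : HasSum (fun k => ‖⟪b k, x⟫_ℂ‖ ^ 2) (‖x‖ ^ 2) := by
      have h2 := Complex.reCLM.hasSum h
      have e : ((⟪x, x⟫_ℂ)).re = ‖x‖ ^ 2 := by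
        rw [inner_self_eq_norm_sq_to_K]; norm_cast
      change HasSum _ (⟪x, x⟫_ℂ).re at h2
      rw [e] at h2
      refine hasSum_of_eq h2 fun k => ?_
      change (⟪x, b k⟫_ℂ * ⟪b k, x⟫_ℂ).re = _
      rw [← inner_conj_symm x, mul_comm, Complex.mul_conj, Complex.normSq_eq_norm_sq]
      norm_cast
    have h3 := h1.tsum_eq ▸ ENNReal.ofReal_tsum_of_nonneg (fun k => by positivity) h1.summable
    simp only [ENNReal.ofReal_pow (norm_nonneg _), ofReal_norm] at h3
    exact h3.symm
  have hsum : ∑' k, ‖Y (b k)‖ₑ ^ 2 ≤ ENNReal.ofReal (β ^ 2) := by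
    rw [ENNReal.tsum_eq_iSup_sum]
    refine iSup_le fun F => ?_
    refine le_trans (le_of_eq ?_) (ENNReal.ofReal_le_ofReal ((hsLe_iff hβ).1 hY F))
    rw [ENNReal.ofReal_sum_of_nonneg fun _ _ => by positivity]
    simp only [ENNReal.ofReal_pow (norm_nonneg _), ofReal_norm]
  have hA : ∑' j, ‖Y (A (b j))‖ₑ ^ 2 ≤ ENNReal.ofReal ((‖A‖ * β) ^ 2) := by
    calc ∑' j, ‖Y (A (b j))‖ₑ ^ 2
        = ∑' j, ∑' k, ‖⟪b k, Y (A (b j))⟫_ℂ‖ₑ ^ 2 := by simp only [hpars]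
      _ = ∑' k, ∑' j, ‖⟪b j, ContinuousLinearMap.adjoint A (Y (b k))⟫_ℂ‖ₑ ^ 2 := by
          rw [ENNReal.tsum_comm]
          simp only [ContinuousLinearMap.adjoint_inner_right, hsymm (b _) (A _)]
      _ = ∑' k, ‖ContinuousLinearMap.adjoint A (Y (b k))‖ₑ ^ 2 := by simp only [hpars]
      _ ≤ ∑' k, ENNReal.ofReal (‖A‖ ^ 2) * ‖Y (b k)‖ₑ ^ 2 := by
          refine ENNReal.tsum_le_tsum fun k => ?_
          rw [← ofReal_norm, ← ofReal_norm, ← ENNReal.ofReal_pow (norm_nonneg _),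
            ← ENNReal.ofReal_pow (norm_nonneg _), ← ENNReal.ofReal_mul (by positivity), ← mul_pow]
          refine ENNReal.ofReal_le_ofReal ?_
          gcongr
          refine (ContinuousLinearMap.le_opNorm _ _).trans ?_
          rw [LinearIsometryEquiv.norm_map]
      _ ≤ ENNReal.ofReal (‖A‖ ^ 2) * ENNReal.ofReal (β ^ 2) := by
          rw [ENNReal.tsum_mul_left]; gcongr
      _ = _ := by rw [← ENNReal.ofReal_mul (by positivity), mul_pow]
  rw [hsLe_iff (by positivity)]
  intro F
  have h := (ENNReal.sum_le_tsum F).trans hA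
  simp only [← ofReal_norm, ← ENNReal.ofReal_pow (norm_nonneg _)] at h
  rw [← ENNReal.ofReal_sum_of_nonneg fun _ _ => by positivity] at h
  exact (ENNReal.ofReal_le_ofReal_iff (by positivity)).1 h

/-- Powers of a contraction whose antilinear part is symmetric and Hilbert–Schmidt. -/
theorem hsLe_antiPart_pow (b : HilbertBasis ι ℂ 𝔥) {B : 𝔥 →L[ℝ] 𝔥} {β : ℝ} (hβ : 0 ≤ β)
    (hB1 : ‖B‖ ≤ 1) (hB : HSLe b (antiPart B) β)
    (hsymm : ∀ x y, ⟪x, antiPart B y⟫_ℂ = ⟪y, antiPart B x⟫_ℂ) (n : ℕ) (A : 𝔥 →L[ℂ] 𝔥) :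
    HSLe b (fun x => antiPart (B ^ n) (A x)) (n * (‖A‖ * β)) := by
  induction n generalizing A with
  | zero =>
    refine (hsLe_zero.congr fun x => ?_).mono (by simp)
    simp only [pow_zero, antiPart_apply, one_apply_eq_self, smul_smul, Complex.I_mul_I]
    simp
  | succ n ih =>
    have h1 : HSLe b (fun x => linPart (B ^ n) (antiPart B (A x))) (1 * (‖A‖ * β)) :=
      (HSLe.comp_right_of_symm b hβ hB hsymm A).comp_left (by positivity) zero_le_one fun x => by
        refine (ContinuousLinearMap.le_opNorm _ _).trans ?_
        gcongr
        refine (norm_linPart_le _).trans ?_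
        have : ∀ k, ‖B ^ k‖ ≤ 1 := fun k => by
          induction k with
          | zero => exact ContinuousLinearMap.norm_id_le
          | succ k ihk =>
            rw [pow_succ]
            exact (norm_mul_le _ _).trans (mul_le_one₀ ihk (norm_nonneg _) hB1)
        exact this n
    -- The induction runs over all right factors `A` so that the linear part of the last `B` can be
    -- absorbed into `A`; it is a contraction.
    have h2 := ih (linPart B * A)
    have h3 : ‖linPart B * A‖ ≤ ‖A‖ := by
      refine (norm_mul_le _ _).trans (mul_le_of_le_one_left (norm_nonneg _) ?_)
      exact (norm_linPart_le B).trans hB1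
    refine ((h1.add h2).congr fun x => ?_).mono ?_
    · rw [pow_succ, antiPart_mul]; rfl
    · push_cast
      have : (n : ℝ) * (‖linPart B * A‖ * β) ≤ n * (‖A‖ * β) := by gcongr
      linarith

/-- The antilinear part of `Bⁿ` has Hilbert–Schmidt norm at most `n` times that of `B`, one term for
each position of the antilinear factor. The constant is `∑ n / n! = e`. -/
theorem hsLe_antiPart_exp (b : HilbertBasis ι ℂ 𝔥) {B : 𝔥 →L[ℝ] 𝔥} {β : ℝ} (hβ : 0 ≤ β)
    (hB1 : ‖B‖ ≤ 1) (hB : HSLe b (antiPart B) β)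
    (hsymm : ∀ x y, ⟪x, antiPart B y⟫_ℂ = ⟪y, antiPart B x⟫_ℂ) (A : 𝔥 →L[ℂ] 𝔥) :
    HSLe b (fun x => antiPart (NormedSpace.exp B) (A x)) (Real.exp 1 * (‖A‖ * β)) := by
  let _ : NormedAlgebra ℚ (𝔥 →L[ℝ] 𝔥) := NormedAlgebra.restrictScalars ℚ ℝ _
  have hexp : ∀ x, HasSum (fun n : ℕ => ((n.factorial : ℝ)⁻¹) • (B ^ n) x)
      ((NormedSpace.exp B : 𝔥 →L[ℝ] 𝔥) x) := fun x => by
    have h := NormedSpace.exp_series_hasSum_exp' (𝕂 := ℝ) B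
    exact h.mapL (ContinuousLinearMap.apply ℝ 𝔥 x)
  have hterm : ∀ n : ℕ, HSLe b
      (fun x => ((n.factorial : ℝ)⁻¹) • antiPart (B ^ n) (A x))
      ((n.factorial : ℝ)⁻¹ * (n * (‖A‖ * β))) := fun n =>
    (hsLe_antiPart_pow b hβ hB1 hB hsymm n A).comp_left (by positivity) (by positivity) fun x => by
      rw [norm_smul, Real.norm_of_nonneg (by positivity)]
  refine HSLe.of_hasSum hterm (fun s => ?_) (by positivity) fun x => ?_
  · have e : ∀ n : ℕ, (n.factorial : ℝ)⁻¹ * (n * (‖A‖ * β)) =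
        ((n.factorial : ℝ)⁻¹ * n) * (‖A‖ * β) := fun n => by ring
    simp only [e, ← Finset.sum_mul]
    gcongr
    have h1 : HasSum (fun n : ℕ => (n.factorial : ℝ)⁻¹ * n) (Real.exp 1) := by
      rw [← hasSum_nat_add_iff' 1]
      have h2 := NormedSpace.expSeries_div_hasSum_exp (𝔸 := ℝ) 1
      rw [← Real.exp_eq_exp_ℝ] at h2
      simp only [Finset.range_one, Finset.sum_singleton, Nat.cast_zero, mul_zero, sub_zero]
      refine hasSum_of_eq h2 fun n => ?_
      rw [Nat.factorial_succ, one_pow]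
      push_cast
      field_simp
    exact sum_le_hasSum s (fun n _ => by positivity) h1
  · have h := ((hexp (A x)).add ((hexp (Complex.I • A x)).const_smul Complex.I)).const_smul
      (2⁻¹ : ℂ)
    refine hasSum_of_eq h fun n => ?_
    rw [antiPart_apply, smul_comm ((n.factorial : ℝ)⁻¹) (2⁻¹ : ℂ), smul_add ((n.factorial : ℝ)⁻¹),
      smul_comm ((n.factorial : ℝ)⁻¹) Complex.I]

end HilbertSchmidt

/-! ### Implementation of symplectic exponentials -/

namespace FockStructure

variable {𝔥 : Type*} [NormedAddCommGroup 𝔥] [InnerProductSpace ℂ 𝔥] [CompleteSpace 𝔥]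
variable {H : ℕ → Type*} [∀ n, NormedAddCommGroup (H n)] [∀ n, InnerProductSpace ℂ (H n)]
variable [∀ n, CompleteSpace (H n)] (S : FockStructure 𝔥 H)

/-- Near the identity the linear part `T₊` is invertible by a Neumann series, with inverse `A` of
norm at most `2`. The candidate `L = -T₋ A` is symmetric because the mixed terms of a symplectic map
are, and its Hilbert–Schmidt norm is at most `1/4 = r²` for `r = 1/2`. -/
theorem implementable_exp_of_small {ι : Type*} (b : HilbertBasis ι ℂ 𝔥) {B : 𝔥 →L[ℝ] 𝔥}
    (hskew : ∀ x y, (⟪B x, y⟫_ℂ).im = -(⟪x, B y⟫_ℂ).im) {β : ℝ} (hβ : 0 ≤ β)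
    (hB : HSLe b (antiPart B) β)
    (hsymm : ∀ x y, ⟪x, antiPart B y⟫_ℂ = ⟪y, antiPart B x⟫_ℂ)
    (hB1 : ‖B‖ ≤ 1) (hexp : ‖NormedSpace.exp B - 1‖ ≤ 1 / 2) (hβ1 : Real.exp 1 * (2 * β) ≤ 1 / 4) :
    S.Implementable (NormedSpace.exp B : 𝔥 →L[ℝ] 𝔥) := by
  set T : 𝔥 →L[ℝ] 𝔥 := NormedSpace.exp B with hT
  have hsub : linPart T - 1 = linPart (T - 1) := by
    ext x
    simp only [sub_apply, linPart_apply, one_apply_eq_self]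
    match_scalars
    · ring
    · ring
    · linear_combination (-1 / 2 : ℂ) * Complex.I_mul_I
  have hn : ‖1 - linPart T‖ ≤ 1 / 2 := by
    rw [norm_sub_rev, hsub]
    exact (norm_linPart_le _).trans hexp
  let U : (𝔥 →L[ℂ] 𝔥)ˣ := Units.oneSub (1 - linPart T) (hn.trans_lt (by norm_num))
  have hU : (U : 𝔥 →L[ℂ] 𝔥) = linPart T := by simp [U]
  set A : 𝔥 →L[ℂ] 𝔥 := ((U⁻¹ : (𝔥 →L[ℂ] 𝔥)ˣ) : 𝔥 →L[ℂ] 𝔥) with hA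
  have hTA : ∀ x, linPart T (A x) = x := fun x => by
    rw [← hU, ← mul_apply_eq_comp, hA, Units.mul_inv, one_apply_eq_self]
  have hAT : ∀ x, A (linPart T x) = x := fun x => by
    rw [← hU, ← mul_apply_eq_comp, hA, Units.inv_mul, one_apply_eq_self]
  have hAn : ‖A‖ ≤ 2 := by
    refine ContinuousLinearMap.opNorm_le_bound _ (by norm_num) fun x => ?_
    have h1 := ContinuousLinearMap.le_of_opNorm_le _ hn (A x)
    rw [sub_apply, one_apply_eq_self, hTA] at h1
    have h2 := norm_sub_norm_le (A x) x
    linarith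
  let L : 𝔥 →L⋆[ℂ] 𝔥 := -((antiPart T).comp A)
  have hL : ∀ x, L x = -antiPart T (A x) := fun x => rfl
  refine S.implementable_of_symm b (fun u v => map_add T u v) (surjective_exp B)
    (im_inner_exp hskew) (L := L) (r := 1 / 2) (by norm_num) (by norm_num) ?_ ?_ ?_
  · intro F
    have h1 := hsLe_antiPart_exp b hβ hB1 hB hsymm A
    have h2 : HSLe b (fun x => antiPart T (A x)) (1 / 4) := h1.mono (by
      refine le_trans ?_ hβ1
      gcongr)
    have h3 := (hsLe_iff (by norm_num)).1 h2 F
    simp only [hL, norm_neg]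
    refine h3.trans (by norm_num)
  · intro x y
    have h := inner_linPart_antiPart_comm (im_inner_exp hskew) (A x) (A y)
    rw [← hT, hTA, hTA] at h
    rw [hL, hL, inner_neg_right, inner_neg_right, h]
  · intro u
    have e1 : T u - Complex.I • T (Complex.I • u) = (2 : ℂ) • linPart T u := by
      rw [linPart_apply, smul_smul]; norm_num
    have e2 : T u + Complex.I • T (Complex.I • u) = (2 : ℂ) • antiPart T u := by
      rw [antiPart_apply, smul_smul]; norm_num
    rw [e1, e2, hL, map_smul, hAT, map_smulₛₗ, Complex.conj_ofNat]

/-- Symplectic maps generated by an operator with symmetric Hilbert–Schmidt antilinear part are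
unitarily implementable on Fock space. -/
theorem implementable_exp {ι : Type*} (b : HilbertBasis ι ℂ 𝔥) {B : 𝔥 →L[ℝ] 𝔥}
    (hskew : ∀ x y, (⟪B x, y⟫_ℂ).im = -(⟪x, B y⟫_ℂ).im) {β : ℝ} (hβ : 0 ≤ β)
    (hB : HSLe b (antiPart B) β)
    (hsymm : ∀ x y, ⟪x, antiPart B y⟫_ℂ = ⟪y, antiPart B x⟫_ℂ) :
    S.Implementable (NormedSpace.exp B : 𝔥 →L[ℝ] 𝔥) := by
  let _ : NormedAlgebra ℚ (𝔥 →L[ℝ] 𝔥) := NormedAlgebra.restrictScalars ℚ ℝ _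
  -- The smallness conditions hold for `B / (N + 1)` once `N` is large. Implementability is stable
  -- under composition, so the `(N + 1)`-st power of the small exponential recovers `exp B`.
  have hlim : Filter.Tendsto (fun N : ℕ => ((N : ℝ) + 1)⁻¹) Filter.atTop (nhds 0) := by
    simpa using tendsto_one_div_add_atTop_nhds_zero_nat (𝕜 := ℝ)
  have hcont : Continuous fun s : ℝ => ‖NormedSpace.exp (s • B) - 1‖ :=
    ((NormedSpace.exp_continuous.comp (by fun_prop : Continuous fun s : ℝ => s • B)).sub
      continuous_const).norm
  have e1 : ∀ᶠ N : ℕ in Filter.atTop, ‖((N : ℝ) + 1)⁻¹ • B‖ < 1 := by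
    have h := ((by fun_prop : Continuous fun s : ℝ => ‖s • B‖).tendsto 0).comp hlim
    exact h.eventually_lt_const (by simp)
  have e2 : ∀ᶠ N : ℕ in Filter.atTop, ‖NormedSpace.exp (((N : ℝ) + 1)⁻¹ • B) - 1‖ < 1 / 2 := by
    have h := (hcont.tendsto 0).comp hlim
    exact h.eventually_lt_const (by simp)
  have e3 : ∀ᶠ N : ℕ in Filter.atTop, Real.exp 1 * (2 * (((N : ℝ) + 1)⁻¹ * β)) < 1 / 4 := by
    have h := ((by fun_prop : Continuous fun s : ℝ => Real.exp 1 * (2 * (s * β))).tendsto 0).comp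
      hlim
    exact h.eventually_lt_const (by simp)
  obtain ⟨N, h1, h2, h3⟩ := (e1.and (e2.and e3)).exists
  set s : ℝ := ((N : ℝ) + 1)⁻¹ with hs
  have hs0 : 0 ≤ s := by positivity
  have hanti : ∀ x, antiPart (s • B) x = (s : ℂ) • antiPart B x := fun x => by
    rw [antiPart_apply, antiPart_apply, smul_apply, smul_apply, Complex.coe_smul,
      smul_comm Complex.I s, ← smul_add, smul_comm]
  have hS : S.Implementable (NormedSpace.exp (s • B) : 𝔥 →L[ℝ] 𝔥) := by
    refine S.implementable_exp_of_small b (β := s * β) (fun x y => ?_) (by positivity) ?_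
      (fun x y => ?_) h1.le h2.le h3.le
    · rw [smul_apply, smul_apply, ← Complex.coe_smul, ← Complex.coe_smul, inner_smul_left,
        inner_smul_right, Complex.conj_ofReal, Complex.im_ofReal_mul, Complex.im_ofReal_mul, hskew,
        mul_neg]
    · refine hB.comp_left hβ hs0 fun x => ?_
      rw [hanti, norm_smul, Complex.norm_real, Real.norm_of_nonneg hs0]
    · rw [hanti, hanti, inner_smul_right, inner_smul_right, hsymm]
  have hpow : ∀ k : ℕ, S.Implementable ((NormedSpace.exp (s • B) : 𝔥 →L[ℝ] 𝔥) ^ k :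
      𝔥 →L[ℝ] 𝔥) := fun k => by
    induction k with
    | zero => exact S.implementable_id
    | succ k ih => rw [pow_succ]; exact ih.comp hS
  have := hpow (N + 1)
  rw [← NormedSpace.exp_nsmul, ← Nat.cast_smul_eq_nsmul ℝ, smul_smul, hs] at this
  rw [Nat.cast_add, Nat.cast_one, mul_inv_cancel₀ (by positivity), one_smul] at this
  exact this

end FockStructure

/-! ### The symmetric Fock space over `L²` -/

section Rectangles

variable {α β : Type*} [MeasurableSpace α] [MeasurableSpace β]

/-- Rectangles form a π-system that generates the product σ-algebra. The whole space is itself a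
rectangle, which settles complements. -/
theorem setIntegral_eq_zero_of_rectangles {μ : Measure (α × β)} {y : α × β → ℂ}
    (hy : Integrable y μ)
    (h : ∀ s t, MeasurableSet s → MeasurableSet t → ∫ z in s ×ˢ t, y z ∂μ = 0) {E : Set (α × β)}
    (hE : MeasurableSet E) : ∫ z in E, y z ∂μ = 0 := by
  refine MeasurableSpace.induction_on_inter
    (C := fun E _ => ∫ z in E, y z ∂μ = 0) generateFrom_prod.symm isPiSystem_prod (by simp) ?_ ?_ ?_
    E hE
  · rintro _ ⟨s, hs, t, ht, rfl⟩
    exact h s t hs ht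
  · intro t ht ih
    have h1 := integral_add_compl ht hy
    have h2 := h Set.univ Set.univ MeasurableSet.univ MeasurableSet.univ
    rw [Set.univ_prod_univ, setIntegral_univ] at h2
    rwa [ih, zero_add, h2] at h1
  · intro f hd hf ih
    rw [integral_iUnion hf hd hy.integrableOn]
    simp [ih]

/-- The spanning rectangles have finite measure, so a square integrable function is integrable on
each of them. The π-system argument is localized there. -/
theorem ae_eq_zero_of_rectangles {μ : Measure α} {ν : Measure β} [SigmaFinite μ] [SigmaFinite ν]
    {y : α × β → ℂ} (hy : MemLp y 2 (μ.prod ν))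
    (h : ∀ s t, MeasurableSet s → MeasurableSet t → μ s < ⊤ → ν t < ⊤ →
      ∫ z in s ×ˢ t, y z ∂(μ.prod ν) = 0) : y =ᵐ[μ.prod ν] 0 := by
  have hu : (⋃ k, spanningSets μ k ×ˢ spanningSets ν k) = Set.univ := by
    refine Set.eq_univ_of_forall fun z => Set.mem_iUnion.2 ?_
    refine ⟨max (spanningSetsIndex μ z.1) (spanningSetsIndex ν z.2), ?_, ?_⟩
    · exact monotone_spanningSets μ (le_max_left _ _) (mem_spanningSetsIndex μ z.1)
    · exact monotone_spanningSets ν (le_max_right _ _) (mem_spanningSetsIndex ν z.2)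
  rw [← Measure.restrict_univ (μ := μ.prod ν), ← hu, Filter.EventuallyEq, ae_restrict_iUnion_iff]
  intro k
  have hS := measurableSet_spanningSets μ k
  have hT := measurableSet_spanningSets ν k
  have hS' := measure_spanningSets_lt_top μ k
  have hT' := measure_spanningSets_lt_top ν k
  have hfin : (μ.prod ν) (spanningSets μ k ×ˢ spanningSets ν k) < ⊤ := by
    rw [Measure.prod_prod]; exact ENNReal.mul_lt_top hS' hT'
  have hInt : Integrable y ((μ.prod ν).restrict (spanningSets μ k ×ˢ spanningSets ν k)) := by
    have : Fact ((μ.prod ν) (spanningSets μ k ×ˢ spanningSets ν k) < ⊤) := ⟨hfin⟩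
    exact (hy.restrict _).integrable one_le_two
  refine hInt.ae_eq_zero_of_forall_setIntegral_eq_zero fun E hE _ => ?_
  refine setIntegral_eq_zero_of_rectangles hInt (fun s t hs ht => ?_) hE
  rw [Measure.restrict_restrict (hs.prod ht), Set.prod_inter_prod]
  exact h _ _ (hs.inter hS) (ht.inter hT) ((measure_mono Set.inter_subset_right).trans_lt hS')
    ((measure_mono Set.inter_subset_right).trans_lt hT')

end Rectangles

/-! ### Tensors, permutations and symmetrization -/

variable {D : ℕ} {m : ℝ} {n : ℕ}

theorem quasiMeasurePreserving_head (n : ℕ) :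
    Measure.QuasiMeasurePreserving (fun p : Fin (n + 1) → Momentum D => p 0)
      (Measure.pi fun _ : Fin (n + 1) => shellMeasure D m) (shellMeasure D m) :=
  Measure.quasiMeasurePreserving_fst.comp (measurePreserving_split n).quasiMeasurePreserving

theorem quasiMeasurePreserving_tail (n : ℕ) :
    Measure.QuasiMeasurePreserving (fun (p : Fin (n + 1) → Momentum D) (i : Fin n) => p i.succ)
      (Measure.pi fun _ : Fin (n + 1) => shellMeasure D m)
      (Measure.pi fun _ : Fin n => shellMeasure D m) :=
  Measure.quasiMeasurePreserving_snd.comp (measurePreserving_split n).quasiMeasurePreserving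

theorem coeFn_tensorLeft (φ : OneParticle D m) (ψ : NBody D m n) :
    tensorLeft φ ψ =ᵐ[Measure.pi fun _ : Fin (n + 1) => shellMeasure D m]
      fun p => φ (p 0) * ψ fun i => p i.succ :=
  MemLp.coeFn_toLp (memLp_tensorFun φ ψ)

theorem coeFn_permute (σ : Equiv.Perm (Fin n)) (ψ : NBody D m n) :
    permute σ ψ =ᵐ[Measure.pi fun _ : Fin n => shellMeasure D m] fun p => ψ fun i => p (σ i) :=
  Lp.coeFn_compMeasurePreserving ψ (measurePreserving_perm σ)

theorem permute_mul (σ τ : Equiv.Perm (Fin n)) (ψ : NBody D m n) :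
    permute (σ * τ) ψ = permute σ (permute τ ψ) := by
  refine Lp.ext ?_
  filter_upwards [coeFn_permute (σ * τ) ψ, coeFn_permute σ (permute τ ψ),
    (measurePreserving_perm (m := m) (D := D) σ).quasiMeasurePreserving.ae (coeFn_permute τ ψ)] with
    p h1 h2 h3
  rw [h1, h2, h3]
  rfl

theorem permute_one (ψ : NBody D m n) : permute 1 ψ = ψ :=
  Lp.ext (coeFn_permute 1 ψ)

theorem tensorLeft_add (φ φ' : OneParticle D m) (ψ : NBody D m n) :
    tensorLeft (φ + φ') ψ = tensorLeft φ ψ + tensorLeft φ' ψ := by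
  refine Lp.ext ?_
  filter_upwards [coeFn_tensorLeft (φ + φ') ψ, coeFn_tensorLeft φ ψ, coeFn_tensorLeft φ' ψ,
    Lp.coeFn_add (tensorLeft φ ψ) (tensorLeft φ' ψ),
    (quasiMeasurePreserving_head n).ae (Lp.coeFn_add φ φ')] with p h1 h2 h3 h4 h5
  rw [h1, h4, Pi.add_apply, h2, h3, h5, Pi.add_apply, add_mul]

theorem tensorLeft_smul (c : ℂ) (φ : OneParticle D m) (ψ : NBody D m n) :
    tensorLeft (c • φ) ψ = c • tensorLeft φ ψ := by
  refine Lp.ext ?_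
  filter_upwards [coeFn_tensorLeft (c • φ) ψ, coeFn_tensorLeft φ ψ,
    Lp.coeFn_smul c (tensorLeft φ ψ),
    (quasiMeasurePreserving_head n).ae (Lp.coeFn_smul c φ)] with p h1 h2 h3 h4
  rw [h1, h3, Pi.smul_apply, h2, h4, Pi.smul_apply, smul_eq_mul, smul_eq_mul, mul_assoc]

theorem norm_tensorLeft_le (φ : OneParticle D m) (ψ : NBody D m n) :
    ‖tensorLeft φ ψ‖ ≤ ‖φ‖ * ‖ψ‖ :=
  (tensorLeft φ).le_of_opNorm_le (LinearMap.mkContinuous_norm_le _ (norm_nonneg _) _) ψ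

/-- `decomposeFin.symm (0, σ)` is the permutation that fixes the first variable and acts by `σ` on
the others. -/
theorem tensorLeft_permute (φ : OneParticle D m) (σ : Equiv.Perm (Fin n)) (ψ : NBody D m n) :
    tensorLeft φ (permute σ ψ) =
      permute (Equiv.Perm.decomposeFin.symm (0, σ)) (tensorLeft φ ψ) := by
  refine Lp.ext ?_
  filter_upwards [coeFn_tensorLeft φ (permute σ ψ),
    coeFn_permute (Equiv.Perm.decomposeFin.symm (0, σ)) (tensorLeft φ ψ),
    (quasiMeasurePreserving_tail n).ae (coeFn_permute σ ψ),
    (measurePreserving_perm (m := m) (D := D)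
      (Equiv.Perm.decomposeFin.symm (0, σ))).quasiMeasurePreserving.ae (coeFn_tensorLeft φ ψ)] with
    p h1 h2 h3 h4
  rw [h1, h2, h3, h4]
  simp

theorem permute_swap_tensorLeft (φ χ : OneParticle D m) (ψ : NBody D m n) :
    permute (Equiv.swap 0 1) (tensorLeft φ (tensorLeft χ ψ)) = tensorLeft χ (tensorLeft φ ψ) := by
  refine Lp.ext ?_
  have hq := (measurePreserving_perm (m := m) (D := D)
    (Equiv.swap (0 : Fin (n + 2)) 1)).quasiMeasurePreserving
  filter_upwards [coeFn_permute (Equiv.swap 0 1) (tensorLeft φ (tensorLeft χ ψ)),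
    coeFn_tensorLeft χ (tensorLeft φ ψ),
    (quasiMeasurePreserving_tail (n + 1)).ae (coeFn_tensorLeft φ ψ),
    hq.ae (coeFn_tensorLeft φ (tensorLeft χ ψ)),
    hq.ae ((quasiMeasurePreserving_tail (n + 1)).ae (coeFn_tensorLeft χ ψ))] with p h1 h2 h3 h4 h5
  rw [h1, h2, h3, h4, h5]
  have e : ∀ i : Fin n, Equiv.swap (0 : Fin (n + 2)) 1 i.succ.succ = i.succ.succ := fun i =>
    Equiv.swap_apply_of_ne_of_ne (Fin.succ_ne_zero _) (by
      rw [← Fin.succ_zero_eq_one]; exact fun h => Fin.succ_ne_zero _ (Fin.succ_injective _ h))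
  simp only [e, Equiv.swap_apply_left, Fin.succ_zero_eq_one, Equiv.swap_apply_right]
  ring

theorem integral_split (F : Momentum D × (Fin n → Momentum D) → ℂ) :
    ∫ p : Fin (n + 1) → Momentum D, F (p 0, fun i => p i.succ)
      ∂(Measure.pi fun _ => shellMeasure D m) =
    ∫ z, F z ∂((shellMeasure D m).prod (Measure.pi fun _ => shellMeasure D m)) :=
  (measurePreserving_split n).integral_comp
    (MeasurableEquiv.piFinSuccAbove (fun _ : Fin (n + 1) => Momentum D) 0).measurableEmbedding F

theorem inner_tensorLeft (φ χ : OneParticle D m) (ψ ξ : NBody D m n) :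
    ⟪tensorLeft φ ψ, tensorLeft χ ξ⟫_ℂ = ⟪φ, χ⟫_ℂ * ⟪ψ, ξ⟫_ℂ := by
  rw [L2.inner_def, L2.inner_def, L2.inner_def, ← integral_prod_mul, ← integral_split]
  refine integral_congr_ae ?_
  filter_upwards [coeFn_tensorLeft φ ψ, coeFn_tensorLeft χ ξ] with p h1 h2
  rw [h1, h2]
  simp only [RCLike.inner_apply, map_mul]
  ring

/-- Vectors orthogonal to all elementary tensors vanish. -/
theorem eq_zero_of_inner_tensorLeft {y : NBody D m (n + 1)}
    (h : ∀ φ (ψ : NBody D m n), ⟪tensorLeft φ ψ, y⟫_ℂ = 0) : y = 0 := by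
  set e := MeasurableEquiv.piFinSuccAbove (fun _ : Fin (n + 1) => Momentum D) 0 with he
  have hmp : MeasurePreserving e (Measure.pi fun _ => shellMeasure D m)
      ((shellMeasure D m).prod (Measure.pi fun _ => shellMeasure D m)) := measurePreserving_split n
  have hy' : MemLp (fun z => y (e.symm z)) 2
      ((shellMeasure D m).prod (Measure.pi fun _ : Fin n => shellMeasure D m)) :=
    (Lp.memLp y).comp_measurePreserving hmp.symm
  have h0 := ae_eq_zero_of_rectangles hy' fun s t hs ht hs' ht' => ?_
  · refine Lp.ext ?_
    filter_upwards [hmp.quasiMeasurePreserving.ae h0,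
      Lp.coeFn_zero ℂ 2 (Measure.pi fun _ : Fin (n + 1) => shellMeasure D m)] with p h1 h2
    have h3 : y p = 0 := by simpa using h1
    exact h3.trans h2.symm
  · have h1 := h (indicatorConstLp 2 hs hs'.ne 1) (indicatorConstLp 2 ht ht'.ne 1)
    rw [L2.inner_def] at h1
    rw [← integral_indicator (hs.prod ht), ← hmp.integral_comp e.measurableEmbedding, ← h1]
    refine integral_congr_ae ?_
    filter_upwards [coeFn_tensorLeft (indicatorConstLp 2 hs hs'.ne 1 : OneParticle D m)
        (indicatorConstLp 2 ht ht'.ne 1 : NBody D m n),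
      (quasiMeasurePreserving_head n).ae (indicatorConstLp_coeFn (p := 2) (hs := hs)
        (hμs := hs'.ne) (c := (1 : ℂ))),
      (quasiMeasurePreserving_tail n).ae (indicatorConstLp_coeFn (p := 2) (hs := ht)
        (hμs := ht'.ne) (c := (1 : ℂ)))] with p h2 h3 h4
    rw [h2, h3, h4]
    have e0 : e p = (p 0, fun i => p i.succ) := rfl
    by_cases hp0 : p 0 ∈ s <;> by_cases hp1 : (fun i => p (Fin.succ i)) ∈ t
    all_goals simp [Set.indicator, e0, hp0, hp1]
    rw [← e0, e.symm_apply_apply]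

theorem decomposeFin_symm_eq (k : Fin (n + 1)) (σ : Equiv.Perm (Fin n)) :
    Equiv.Perm.decomposeFin.symm (k, σ) =
      Equiv.swap 0 k * Equiv.Perm.decomposeFin.symm (0, σ) := by
  ext i
  refine Fin.cases ?_ (fun j => ?_) i <;> simp

/-- Permutations of the last `n` variables are absorbed by the symmetry of `ψ`, so only the coset of
`σ`, that is the value `σ 0`, matters. -/
theorem permute_tensorLeft_eq_swap (χ : OneParticle D m) {ψ : NBody D m n}
    (hψ : ψ ∈ nParticle D m n) (σ : Equiv.Perm (Fin (n + 1))) :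
    permute σ (tensorLeft χ ψ) = permute (Equiv.swap 0 (σ 0)) (tensorLeft χ ψ) := by
  obtain ⟨⟨k, τ⟩, rfl⟩ := Equiv.Perm.decomposeFin.symm.surjective σ
  rw [Equiv.Perm.decomposeFin_symm_apply_zero, decomposeFin_symm_eq, permute_mul,
    ← tensorLeft_permute, hψ τ]

/-- The transpositions `(0 k)` represent the cosets of the stabilizer of `0`, and multiplication by
`σ` only permutes the cosets. -/
theorem sum_swap_tensorLeft_mem (χ : OneParticle D m) {ψ : NBody D m n}
    (hψ : ψ ∈ nParticle D m n) :
    ∑ k, permute (Equiv.swap 0 k) (tensorLeft χ ψ) ∈ nParticle D m (n + 1) := by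
  intro σ
  rw [map_sum]
  conv_rhs => rw [← Equiv.sum_comp σ]
  refine Finset.sum_congr rfl fun k _ => ?_
  rw [← permute_mul, permute_tensorLeft_eq_swap χ hψ]
  simp

theorem inner_permute_of_mem (σ : Equiv.Perm (Fin n)) (x : NBody D m n) {ξ : NBody D m n}
    (hξ : ξ ∈ nParticle D m n) : ⟪ξ, permute σ x⟫_ℂ = ⟪ξ, x⟫_ℂ := by
  conv_lhs => rw [← hξ σ]
  exact (permute σ).inner_map_map ξ x

/-- The projection onto the symmetric functions. -/
abbrev symProj (D : ℕ) (m : ℝ) (n : ℕ) : NBody D m n →L[ℂ] nParticle D m n :=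
  (nParticle D m n).orthogonalProjectionOnto

theorem inner_symProj (ξ : nParticle D m n) (x : NBody D m n) :
    ⟪ξ, symProj D m n x⟫_ℂ = ⟪(ξ : NBody D m n), x⟫_ℂ :=
  Submodule.inner_orthogonalProjectionOnto_eq_of_mem_left ξ x

theorem symProj_permute (σ : Equiv.Perm (Fin n)) (x : NBody D m n) :
    symProj D m n (permute σ x) = symProj D m n x :=
  ext_inner_left ℂ fun ξ => by rw [inner_symProj, inner_symProj, inner_permute_of_mem σ x ξ.2]

/-- The sum over transpositions is fixed by the projection, while each of its `n + 1` terms has the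
same projection as `χ ⊗ ψ`. -/
theorem coe_symProj_tensorLeft (χ : OneParticle D m) {ψ : NBody D m n}
    (hψ : ψ ∈ nParticle D m n) :
    ((n + 1 : ℕ) : ℂ) • (symProj D m (n + 1) (tensorLeft χ ψ) : NBody D m (n + 1)) =
      ∑ k, permute (Equiv.swap 0 k) (tensorLeft χ ψ) := by
  have h := congrArg (fun x : nParticle D m (n + 1) => (x : NBody D m (n + 1)))
    (Submodule.orthogonalProjectionOnto_mem_subspace_eq_self
      (⟨_, sum_swap_tensorLeft_mem χ hψ⟩ : nParticle D m (n + 1)))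
  simp only at h
  rw [← h, map_sum]
  simp only [symProj_permute, Finset.sum_const, Finset.card_univ, Fintype.card_fin]
  rw [← Nat.cast_smul_eq_nsmul ℂ]
  rfl

/-- Contraction of the first variable with `φ`. -/
abbrev contractLeft (φ : OneParticle D m) : NBody D m (n + 1) →L[ℂ] NBody D m n :=
  ContinuousLinearMap.adjoint (tensorLeft φ)

theorem contractLeft_tensorLeft (φ χ : OneParticle D m) (ψ : NBody D m n) :
    contractLeft φ (tensorLeft χ ψ) = ⟪φ, χ⟫_ℂ • ψ :=
  ext_inner_left ℂ fun ξ => by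
    rw [ContinuousLinearMap.adjoint_inner_right, inner_tensorLeft, inner_smul_right]

theorem contractLeft_permute (φ : OneParticle D m) (σ : Equiv.Perm (Fin n))
    (x : NBody D m (n + 1)) :
    contractLeft φ (permute (Equiv.Perm.decomposeFin.symm (0, σ)) x) =
      permute σ (contractLeft φ x) :=
  ext_inner_left ℂ fun ξ => by
    have h : permute σ (permute σ⁻¹ ξ) = ξ := by rw [← permute_mul, mul_inv_cancel, permute_one]
    rw [ContinuousLinearMap.adjoint_inner_right]
    conv_lhs => rw [← h, tensorLeft_permute, (permute _).inner_map_map]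
    conv_rhs => rw [← h, (permute _).inner_map_map]
    rw [ContinuousLinearMap.adjoint_inner_right]

theorem contractLeft_mem (φ : OneParticle D m) {x : NBody D m (n + 1)}
    (hx : x ∈ nParticle D m (n + 1)) : contractLeft φ x ∈ nParticle D m n := fun σ => by
  rw [← contractLeft_permute, hx]

/-- Both sides are bounded operators of `ψ`, so it suffices to compare them on elementary tensors.
-/
theorem contractLeft_swap_tensorLeft (φ χ : OneParticle D m) (ψ : NBody D m (n + 1)) :
    contractLeft φ (permute (Equiv.swap 0 1) (tensorLeft χ ψ)) =
      tensorLeft χ (contractLeft φ ψ) := by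
  have htot : Total (Set.range fun z : OneParticle D m × NBody D m n => tensorLeft z.1 z.2) :=
    fun y hy => eq_zero_of_inner_tensorLeft fun φ ψ => hy _ ⟨(φ, ψ), rfl⟩
  have e : (contractLeft φ ∘L (permute (Equiv.swap 0 1)).toContinuousLinearMap ∘L tensorLeft χ :
      NBody D m (n + 1) →L[ℂ] NBody D m (n + 1)) = tensorLeft χ ∘L contractLeft φ := by
    refine htot.clm_ext ?_
    rintro _ ⟨⟨η, ξ⟩, rfl⟩
    change contractLeft φ (permute (Equiv.swap 0 1) (tensorLeft χ (tensorLeft η ξ))) =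
      tensorLeft χ (contractLeft φ (tensorLeft η ξ))
    rw [permute_swap_tensorLeft, contractLeft_tensorLeft, contractLeft_tensorLeft, map_smul]
  exact congrArg (fun T : NBody D m (n + 1) →L[ℂ] NBody D m (n + 1) => T ψ) e

/-! ### The canonical commutation relations -/

theorem creation_apply (φ : OneParticle D m) (ψ : nParticle D m n) :
    creation n φ ψ = (Real.sqrt (n + 1) : ℂ) • symProj D m (n + 1) (tensorLeft φ ψ) := rfl

/-- Contraction of the first variable preserves symmetry in the remaining ones, so the adjoint of
`a†(φ)` needs no further projection. -/
theorem coe_annihilation (φ : OneParticle D m) (x : nParticle D m (n + 1)) :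
    ((annihilation n φ x : nParticle D m n) : NBody D m n) =
      (Real.sqrt (n + 1) : ℂ) • contractLeft φ (x : NBody D m (n + 1)) := by
  have h : annihilation n φ x = (Real.sqrt (n + 1) : ℂ) •
      (⟨contractLeft φ x, contractLeft_mem φ x.2⟩ : nParticle D m n) := by
    refine ext_inner_right ℂ fun ξ => ?_
    rw [annihilation, ContinuousLinearMap.adjoint_inner_left, creation_apply]
    refine (inner_smul_right (𝕜 := ℂ) x (symProj D m (n + 1) (tensorLeft φ ξ)) _).trans ?_
    refine Eq.trans ?_ (inner_smul_left (𝕜 := ℂ) (E := nParticle D m n) _ ξ _).symm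
    rw [inner_symProj, Complex.conj_ofReal, Submodule.coe_inner,
      ContinuousLinearMap.adjoint_inner_left]
  rw [h]
  rfl

theorem sqrt_mul_sqrt_succ (n : ℕ) :
    (Real.sqrt (n + 1) : ℂ) * (Real.sqrt (n + 1) : ℂ) = ((n + 1 : ℕ) : ℂ) := by
  rw [← Complex.ofReal_mul, Real.mul_self_sqrt (by positivity)]
  push_cast
  rfl

theorem coe_annihilation_creation (φ χ : OneParticle D m) (ψ : nParticle D m n) :
    ((annihilation n φ (creation n χ ψ) : nParticle D m n) : NBody D m n) =
      ∑ k, contractLeft φ (permute (Equiv.swap 0 k) (tensorLeft χ (ψ : NBody D m n))) := by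
  rw [← map_sum, ← coe_symProj_tensorLeft χ ψ.2, map_smul, coe_annihilation, creation_apply,
    Submodule.coe_smul, map_smul, smul_smul, sqrt_mul_sqrt_succ]

theorem coe_creation_annihilation (φ χ : OneParticle D m) (ψ : nParticle D m (n + 1)) :
    ((creation n χ (annihilation n φ ψ) : nParticle D m (n + 1)) : NBody D m (n + 1)) =
      ∑ k, permute (Equiv.swap 0 k)
        (tensorLeft χ (contractLeft φ (ψ : NBody D m (n + 1)))) := by
  rw [← coe_symProj_tensorLeft χ (contractLeft_mem φ ψ.2), creation_apply, coe_annihilation,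
    Submodule.coe_smul, map_smul, map_smul, Submodule.coe_smul, smul_smul, sqrt_mul_sqrt_succ]

theorem annihilation_creation_zero (φ χ : OneParticle D m) (ψ : nParticle D m 0) :
    annihilation 0 φ (creation 0 χ ψ) = ⟪φ, χ⟫_ℂ • ψ := by
  refine Subtype.ext ?_
  rw [coe_annihilation_creation, Fin.sum_univ_one, Equiv.swap_self, ← Equiv.Perm.one_def,
    permute_one, contractLeft_tensorLeft]
  rfl

/-- Conjugation of `(0 1)` by the involution that fixes `0` and exchanges `1` with `j + 1`. It
reduces every exchange term to the transposition of the first two variables. -/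
theorem swap_zero_succ (j : Fin (n + 1)) :
    Equiv.swap 0 j.succ = Equiv.Perm.decomposeFin.symm (0, Equiv.swap 0 j) * Equiv.swap 0 1 *
      Equiv.Perm.decomposeFin.symm (0, Equiv.swap 0 j) := by
  have h : (Equiv.Perm.decomposeFin.symm (0, Equiv.swap 0 j))⁻¹ =
      Equiv.Perm.decomposeFin.symm (0, Equiv.swap (0 : Fin (n + 1)) j) := by
    rw [inv_eq_iff_mul_eq_one]
    ext i
    refine Fin.cases ?_ (fun k => ?_) i <;> simp
  have h2 := Equiv.mul_swap_eq_swap_mul (Equiv.Perm.decomposeFin.symm (0, Equiv.swap 0 j)) 0 1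
  rw [h2, mul_assoc, mul_eq_one_iff_eq_inv.2 h.symm, mul_one]
  simp

/-- In the sum over transpositions the term `k = 0` contracts `φ` with `χ`. In each term `k = j + 1`
the contraction hits `ψ` instead, and these terms are the symmetrization of `χ ⊗ a(φ) ψ`. -/
theorem annihilation_creation_succ (φ χ : OneParticle D m) (ψ : nParticle D m (n + 1)) :
    annihilation (n + 1) φ (creation (n + 1) χ ψ) =
      ⟪φ, χ⟫_ℂ • ψ + creation n χ (annihilation n φ ψ) := by
  refine Subtype.ext ?_
  rw [coe_annihilation_creation, Submodule.coe_add, coe_creation_annihilation, Fin.sum_univ_succ,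
    Equiv.swap_self, ← Equiv.Perm.one_def, permute_one, contractLeft_tensorLeft]
  congr 1
  refine Finset.sum_congr rfl fun j _ => ?_
  rw [swap_zero_succ, permute_mul, permute_mul, ← tensorLeft_permute, ψ.2, contractLeft_permute,
    contractLeft_swap_tensorLeft]

theorem symProj_tensorLeft_symProj (φ : OneParticle D m) (x : NBody D m n) :
    symProj D m (n + 1) (tensorLeft φ (symProj D m n x : NBody D m n)) =
      symProj D m (n + 1) (tensorLeft φ x) :=
  ext_inner_left ℂ fun ξ => by
    rw [inner_symProj, inner_symProj, ← ContinuousLinearMap.adjoint_inner_left,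
      ← ContinuousLinearMap.adjoint_inner_left]
    exact inner_symProj ⟨_, contractLeft_mem φ ξ.2⟩ x

theorem creation_comm (φ χ : OneParticle D m) (ψ : nParticle D m n) :
    creation (n + 1) φ (creation n χ ψ) = creation (n + 1) χ (creation n φ ψ) := by
  simp only [creation_apply, map_smul, symProj_tensorLeft_symProj]
  rw [← permute_swap_tensorLeft φ χ, symProj_permute]

/-- The creation operators on the Fock space over `L²`. -/
def fockStructure (D : ℕ) (m : ℝ) :
    FockStructure (OneParticle D m) (fun n => nParticle D m n) where
  cr n :=
    { toFun := creation n
      map_add' := fun φ χ => by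
        ext1 ψ
        rw [add_apply, creation_apply, tensorLeft_add, map_add, smul_add]
        rfl
      map_smul' := fun c φ => by
        ext1 ψ
        rw [RingHom.id_apply, smul_apply, creation_apply, tensorLeft_smul, map_smul, smul_comm]
        rfl }
  vac := ⟨memLp_vacuum.toLp _, fun σ => by
    obtain rfl : σ = 1 := Subsingleton.elim _ _
    rfl⟩
  norm_vac := by
    change ‖memLp_vacuum.toLp _‖ = 1
    rw [Lp.norm_toLp, Measure.pi_of_empty, eLpNorm_const _ two_ne_zero (by simp)]
    simp
  norm_cr_le n φ ψ := by
    change ‖creation n φ ψ‖ ≤ _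
    rw [creation_apply, norm_smul, Complex.norm_real, Real.norm_of_nonneg (Real.sqrt_nonneg _),
      mul_assoc]
    gcongr
    exact (Submodule.norm_orthogonalProjectionOnto_apply_le _ _).trans (norm_tensorLeft_le φ _)
  cr_comm n φ χ ψ := creation_comm φ χ ψ
  ccr_zero φ χ ψ := annihilation_creation_zero φ χ ψ
  ccr_succ n φ χ ψ := annihilation_creation_succ φ χ ψ
  zero_eq ψ := by
    -- The configuration space of no particles is a single point; the coefficient is the value
    -- there.
    refine ⟨(ψ : NBody D m 0) default, Subtype.ext (Lp.ext ?_)⟩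
    have h1 := Lp.coeFn_smul ((ψ : NBody D m 0) default) (memLp_vacuum (D := D) (m := m)).toLp
    filter_upwards [Lp.coeFn_smul ((ψ : NBody D m 0) default) (memLp_vacuum.toLp _),
      MemLp.coeFn_toLp (memLp_vacuum (D := D) (m := m))] with p h1 h2
    refine Eq.trans ?_ h1.symm
    rw [Pi.smul_apply, h2, smul_eq_mul, mul_one, Subsingleton.elim p default]
  eq_zero n ψ h := by
    refine Subtype.ext (eq_zero_of_inner_tensorLeft fun φ χ => ?_)
    have h1 : annihilation n φ ψ = 0 := h φ
    have h2 := coe_annihilation φ ψ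
    rw [h1] at h2
    have h3 : (Real.sqrt (n + 1) : ℂ) ≠ 0 := by
      exact_mod_cast (Real.sqrt_pos.2 (by positivity)).ne'
    have h4 : contractLeft φ (ψ : NBody D m (n + 1)) = 0 :=
      (smul_eq_zero.1 h2.symm).resolve_left h3
    rw [← ContinuousLinearMap.adjoint_inner_right, h4, inner_zero_right]

theorem fockStructure_coh_zero : (fockStructure D m).coh 0 = vacuum D m := by
  refine lp.ext (funext fun n => ?_)
  rw [FockStructure.coh_apply, vacuum, lp.single_apply]
  cases n with
  | zero => rw [Pi.single_eq_same, Nat.factorial_zero, Nat.cast_one, inv_one, one_smul]; rfl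
  | succ n =>
    rw [Pi.single_eq_of_ne (Nat.succ_ne_zero n), FockStructure.pow, map_zero]
    exact smul_zero _

theorem isField_field (hm : 0 < m) (f : TestFun D) :
    (fockStructure D m).IsField (onShell hm f) (field hm f) := by
  intro ψ χ
  rw [LinearPMap.mem_graph_iff]
  constructor
  · rintro ⟨y, rfl, rfl⟩
    exact ⟨y.2, rfl, fun n => rfl⟩
  · rintro ⟨hfin, h0, hs⟩
    refine ⟨⟨ψ, hfin⟩, rfl, lp.ext (funext fun n => ?_)⟩
    cases n with
    | zero => exact h0.symm
    | succ n => exact (hs n).symm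

theorem isExpI_field (hm : 0 < m) (f : TestFun D) :
    IsExpI (field hm f).closure ((fockStructure D m).weylOp (onShell hm f)) :=
  (isField_field hm f).isExpI

/-- `weyl` is a choice among the exponentials of the closed field. Existence makes the choice
nontrivial, and uniqueness of the group identifies it. -/
theorem weyl_eq_weylOp (hm : 0 < m) (f : TestFun D) :
    weyl hm f = (fockStructure D m).weylOp (onShell hm f) := by
  have h : ∃ W, IsExpI (field hm f).closure W := ⟨_, isExpI_field hm f⟩
  rw [weyl, dif_pos h]
  exact (isField_field hm f).eq_weylOp h.choose_spec

/-! ### Series in the Schwartz space -/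

/-- A series in the Schwartz space converges if all its seminorms are summable. -/
theorem summable_of_seminorm {E F : Type*} [NormedAddCommGroup E] [NormedSpace ℝ E]
    [NormedAddCommGroup F] [NormedSpace ℝ F] [CompleteSpace F] {u : ℕ → 𝓢(E, F)}
    (h : ∀ k l, Summable fun n => SchwartzMap.seminorm ℝ k l (u n)) : Summable u := by
  have hv : ∀ l : ℕ, (l : ℕ∞) ≤ ⊤ → Summable fun n => SchwartzMap.seminorm ℝ 0 l (u n) :=
    fun l _ => h 0 l
  have hb : ∀ (l n : ℕ) (x : E), (l : ℕ∞) ≤ ⊤ →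
      ‖iteratedFDeriv ℝ l (u n) x‖ ≤ SchwartzMap.seminorm ℝ 0 l (u n) := fun l n x _ =>
    norm_iteratedFDeriv_le_seminorm ℝ (u n) l x
  have hs : ∀ n, ContDiff ℝ ((⊤ : ℕ∞) : WithTop ℕ∞) (u n) := fun n => (u n).smooth ⊤
  have hd := fun l : ℕ => iteratedFDeriv_tsum hs hv hb (k := l) le_top
  have hsum : ∀ l x, Summable fun n => iteratedFDeriv ℝ l (u n) x := fun l x =>
    (h 0 l).of_norm_bounded fun n => hb l n x le_top
  have hdecay : ∀ (k l : ℕ) (F : Finset ℕ) (x : E),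
      ‖x‖ ^ k * ‖∑' n : {n // n ∉ F}, iteratedFDeriv ℝ l (u n) x‖ ≤
        ∑' n : {n // n ∉ F}, SchwartzMap.seminorm ℝ k l (u n) := fun k l F x => by
    have h1 : Summable fun n : {n // n ∉ F} => ‖iteratedFDeriv ℝ l (u n) x‖ :=
      Summable.of_nonneg_of_le (fun _ => norm_nonneg _) (fun n => hb l n x le_top)
        ((h 0 l).subtype _)
    calc ‖x‖ ^ k * ‖∑' n : {n // n ∉ F}, iteratedFDeriv ℝ l (u n) x‖
        ≤ ‖x‖ ^ k * ∑' n : {n // n ∉ F}, ‖iteratedFDeriv ℝ l (u n) x‖ := by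
          gcongr; exact norm_tsum_le_tsum_norm h1
      _ = ∑' n : {n // n ∉ F}, ‖x‖ ^ k * ‖iteratedFDeriv ℝ l (u n) x‖ := tsum_mul_left.symm
      _ ≤ _ := (h1.mul_left _).tsum_le_tsum (fun n => le_seminorm ℝ k l (u n) x)
          ((h k l).subtype _)
  let s : 𝓢(E, F) :=
    { toFun := fun x => ∑' n, u n x
      smooth' := contDiff_tsum hs hv hb
      decay' := fun k l => ⟨∑' n, SchwartzMap.seminorm ℝ k l (u n), fun x => by
        rw [hd l]
        have h1 : Summable fun n => ‖iteratedFDeriv ℝ l (u n) x‖ :=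
          Summable.of_nonneg_of_le (fun _ => norm_nonneg _) (fun n => hb l n x le_top) (h 0 l)
        calc ‖x‖ ^ k * ‖∑' n, iteratedFDeriv ℝ l (u n) x‖
            ≤ ‖x‖ ^ k * ∑' n, ‖iteratedFDeriv ℝ l (u n) x‖ := by
              gcongr; exact norm_tsum_le_tsum_norm h1
          _ = ∑' n, ‖x‖ ^ k * ‖iteratedFDeriv ℝ l (u n) x‖ := tsum_mul_left.symm
          _ ≤ _ := (h1.mul_left _).tsum_le_tsum (fun n => le_seminorm ℝ k l (u n) x) (h k l)⟩ }
  refine ⟨s, ?_⟩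
  rw [HasSum, SummationFilter.unconditional_filter]
  refine ((schwartz_withSeminorms ℝ E F).tendsto_nhds _ s).2 fun ⟨k, l⟩ ε hε => ?_
  -- After a finite set `A` is removed, the derivatives of the remainder are the sums over the
  -- complement of `A`. The seminorm of the remainder is therefore at most the tail of the summable
  -- series of seminorms.
  have htail := tendsto_tsum_compl_atTop_zero fun n => SchwartzMap.seminorm ℝ k l (u n)
  filter_upwards [htail.eventually_lt_const hε] with A hA
  refine lt_of_le_of_lt ?_ hA
  change SchwartzMap.seminorm ℝ k l _ ≤ _
  rw [← map_neg_eq_map, neg_sub]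
  refine seminorm_le_bound ℝ k l _ (tsum_nonneg fun _ => apply_nonneg _ _) fun x => ?_
  refine le_trans (le_of_eq ?_) (hdecay k l A x)
  congr 2
  have e1 : ((s - ∑ n ∈ A, u n : 𝓢(E, F)) : E → F) = (s : E → F) - fun x => ∑ n ∈ A, u n x := by
    ext y; simp
  rw [e1, iteratedFDeriv_sub_apply (s.smooth l).contDiffAt
    (ContDiff.sum fun n _ => (u n).smooth l).contDiffAt,
    iteratedFDeriv_fun_sum_apply fun n _ => ((u n).smooth l).contDiffAt]
  change iteratedFDeriv ℝ l (fun x => ∑' n, u n x) x - _ = _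
  rw [hd l]
  beta_reduce
  rw [← (hsum l x).sum_add_tsum_subtype_compl A, add_sub_cancel_left]

/-! ### Estimates on the mass shell -/

/-- An integrable weight on momentum space. -/
def decayWeight (p : Momentum D) : ℝ := ((1 + ‖p‖) ^ (D + 1))⁻¹

theorem decayWeight_pos (p : Momentum D) : 0 < decayWeight p := by
  unfold decayWeight; positivity

theorem decayWeight_neg (p : Momentum D) : decayWeight (-p) = decayWeight p := by
  simp [decayWeight]

theorem integrable_decayWeight : Integrable (decayWeight : Momentum D → ℝ) := by
  have h1 : Integrable (fun p : Momentum D => (1 + ‖p‖) ^ (-((D : ℝ) + 1))) volume :=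
    integrable_one_add_norm (by simp)
  refine h1.congr (Filter.Eventually.of_forall fun p => ?_)
  have hp : 0 < 1 + ‖p‖ := by positivity
  simp only [decayWeight]
  rw [Real.rpow_neg hp.le]; norm_cast

theorem integrable_shell_of_volume (hm : 0 < m) {F : Type*} [NormedAddCommGroup F]
    {u : Momentum D → F} (hu : Integrable u) : Integrable u (shellMeasure D m) :=
  Integrable.mono_measure (hu.smul_measure ENNReal.ofReal_ne_top) (shellMeasure_le hm)

theorem integral_shell_le (hm : 0 < m) {u : Momentum D → ℝ} (hu : Integrable u)
    (h0 : ∀ p, 0 ≤ u p) :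
    ∫ p, u p ∂(shellMeasure D m) ≤ 1 / (2 * m * (2 * Real.pi) ^ D) * ∫ p, u p := by
  have h1 : 0 ≤ 1 / (2 * m * (2 * Real.pi) ^ D) := by
    have := Real.pi_pos; positivity
  have h2 := integral_mono_measure (shellMeasure_le hm) (Filter.Eventually.of_forall h0)
    (hu.smul_measure ENNReal.ofReal_ne_top)
  rwa [integral_smul_measure, ENNReal.toReal_ofReal h1, smul_eq_mul] at h2

/-- A bound for the mass of the translates of `decayWeight`. -/
def decayMass (D : ℕ) (m : ℝ) : ℝ :=
  1 / (2 * m * (2 * Real.pi) ^ D) * ∫ p : Momentum D, decayWeight p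

theorem decayMass_nonneg (hm : 0 < m) : 0 ≤ decayMass D m := by
  have := Real.pi_pos
  have h : 0 ≤ ∫ p : Momentum D, decayWeight p := integral_nonneg fun p => (decayWeight_pos p).le
  unfold decayMass
  positivity

theorem integrable_decayWeight_sub (hm : 0 < m) (p : Momentum D) :
    Integrable (fun q => decayWeight (p - q)) (shellMeasure D m) :=
  integrable_shell_of_volume hm (integrable_decayWeight.comp_sub_left p)

theorem integral_decayWeight_sub_le (hm : 0 < m) (p : Momentum D) :
    ∫ q, decayWeight (p - q) ∂(shellMeasure D m) ≤ decayMass D m := by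
  refine (integral_shell_le hm (integrable_decayWeight.comp_sub_left p)
    fun q => (decayWeight_pos _).le).trans (le_of_eq ?_)
  rw [decayMass, integral_sub_left_eq_self]

theorem integrable_decayWeight_add (hm : 0 < m) (p : Momentum D) :
    Integrable (fun q => decayWeight (p + q)) (shellMeasure D m) :=
  integrable_shell_of_volume hm (integrable_decayWeight.comp_add_left p)

theorem integral_decayWeight_add_le (hm : 0 < m) (p : Momentum D) :
    ∫ q, decayWeight (p + q) ∂(shellMeasure D m) ≤ decayMass D m := by
  refine (integral_shell_le hm (integrable_decayWeight.comp_add_left p)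
    fun q => (decayWeight_pos _).le).trans (le_of_eq ?_)
  rw [decayMass, integral_add_left_eq_self]

theorem norm_shell_sq (s : ℝ) (p : Momentum D) :
    ‖shell m s p‖ ^ 2 = s ^ 2 * (m ^ 2 + ‖p‖ ^ 2) + ‖p‖ ^ 2 := by
  rw [EuclideanSpace.norm_sq_eq, EuclideanSpace.norm_sq_eq, Fin.sum_univ_succ]
  have h : energy m p ^ 2 = m ^ 2 + ‖p‖ ^ 2 := Real.sq_sqrt (by positivity)
  rw [EuclideanSpace.norm_sq_eq] at h
  simp only [shell, Fin.cons_zero, Fin.cons_succ, Real.norm_eq_abs, sq_abs, mul_pow] at h ⊢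
  rw [h]

theorem norm_shell_le (hm : 0 < m) {s : ℝ} (hs : s ^ 2 = 1) (p : Momentum D) :
    ‖shell m s p‖ ≤ (m + 2) * (1 + ‖p‖) := by
  refine (sq_le_sq₀ (norm_nonneg _) (by positivity)).1 ?_
  rw [norm_shell_sq, hs]
  have := norm_nonneg p
  nlinarith [mul_nonneg hm.le this, mul_nonneg (mul_nonneg hm.le this) this, mul_nonneg hm.le hm.le,
    mul_nonneg (mul_nonneg hm.le hm.le) this]

theorem norm_mft_shell_neg (g : TestFun D) (p : Momentum D) :
    ‖mft g (shell m (-1) p)‖ = ‖mft g (shell m 1 (-p))‖ := by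
  have h : shell m (-1) p = -shell m 1 (-p) := by rw [neg_shell, neg_neg]
  rw [h, ← conj_mft, RCLike.norm_conj]

/-! ### Derivatives of waves -/

/-- The superposition of the plane waves on a mass shell with amplitudes `g̃`. -/
def shellWave (m s : ℝ) (g : TestFun D) (x : Spacetime D) : ℂ :=
  ∫ p, mft g (shell m s p) * Complex.exp (Complex.I * (mink (shell m s p) x : ℂ))
    ∂(shellMeasure D m)

theorem shellWave_eq_fourierIntegral (s : ℝ) (g : TestFun D) :
    shellWave m s g = VectorFourier.fourierIntegral Real.fourierChar
      ((shellMeasure D m).map (shell m s)) (minkBilin D).toLinearMap₁₂ (mft g) := by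
  have hmeas : Measurable (shell m s : Momentum D → Spacetime D) := (continuous_shell s).measurable
  ext x
  rw [shellWave, VectorFourier.fourierIntegral, integral_map hmeas.aemeasurable]
  · congr 1
    ext p
    rw [Circle.smul_def, Real.fourierChar_apply, smul_eq_mul, mul_comm]
    congr 2
    change _ = ((2 * Real.pi * -(minkBilin D (shell m s p) x) : ℝ) : ℂ) * Complex.I
    rw [minkBilin_apply]
    push_cast
    have : (Real.pi : ℂ) ≠ 0 := by exact_mod_cast Real.pi_ne_zero
    field_simp
  · refine Continuous.aestronglyMeasurable ?_
    have h1 : Continuous fun v : Spacetime D => Real.fourierChar (-(minkBilin D v x)) :=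
      Real.continuous_fourierChar.comp (by fun_prop)
    exact (continuous_subtype_val.comp h1).mul (continuous_mft g)

/-- Each derivative brings down one power of the momentum. The weight consists of `l` powers to
absorb these and `D + 1` more to leave an integrable function. -/
theorem norm_iteratedFDeriv_shellWave_le (hm : 0 < m) {s : ℝ} (hs : s ^ 2 = 1) (l : ℕ) :
    ∃ C, 0 ≤ C ∧ ∀ (g : TestFun D) (c : ℝ),
      (∀ p, (1 + ‖p‖) ^ (l + (D + 1)) * ‖mft g (shell m s p)‖ ≤ c) →
      ∀ x, ‖iteratedFDeriv ℝ l (shellWave m s g) x‖ ≤ C * c := by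
  refine ⟨(2 * Real.pi * ‖minkBilin D‖) ^ l * ((m + 2) ^ l *
    ∫ p : Momentum D, decayWeight p ∂(shellMeasure D m)), ?_, fun g c hc x => ?_⟩
  · have := Real.pi_pos
    have : 0 ≤ ∫ p : Momentum D, decayWeight p ∂(shellMeasure D m) :=
      integral_nonneg fun p => (decayWeight_pos p).le
    positivity
  have hmeas : Measurable (shell m s : Momentum D → Spacetime D) := (continuous_shell s).measurable
  have hasm : ∀ n : ℕ, AEStronglyMeasurable (fun k : Spacetime D => ‖k‖ ^ n * ‖mft g k‖)
      ((shellMeasure D m).map (shell m s)) := fun n =>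
    ((continuous_norm.pow n).mul (continuous_mft g).norm).aestronglyMeasurable
  have hInt : ∀ n : ℕ, Integrable (fun k => ‖k‖ ^ n * ‖mft g k‖)
      ((shellMeasure D m).map (shell m s)) := fun n => by
    rw [integrable_map_measure (hasm n) hmeas.aemeasurable]
    exact integrable_pow_mft_shell hm s g n
  rw [shellWave_eq_fourierIntegral, VectorFourier.iteratedFDeriv_fourierIntegral (N := ⊤) _
    (fun n _ => hInt n) (continuous_mft g).aestronglyMeasurable (by exact_mod_cast le_top)]
  refine (VectorFourier.norm_fourierIntegral_le_integral_norm _ _ _ _ _).trans ?_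
  calc ∫ k, ‖VectorFourier.fourierPowSMulRight (minkBilin D) (mft g) k l‖
        ∂((shellMeasure D m).map (shell m s))
      ≤ ∫ k, (2 * Real.pi * ‖minkBilin D‖) ^ l * (‖k‖ ^ l * ‖mft g k‖)
        ∂((shellMeasure D m).map (shell m s)) := by
        refine integral_mono_of_nonneg (Filter.Eventually.of_forall fun k => norm_nonneg _)
          ((hInt l).const_mul _) (Filter.Eventually.of_forall fun k => ?_)
        refine (VectorFourier.norm_fourierPowSMulRight_le _ _ _ _).trans (le_of_eq ?_)
        ring
    _ = (2 * Real.pi * ‖minkBilin D‖) ^ l *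
        ∫ p, ‖shell m s p‖ ^ l * ‖mft g (shell m s p)‖ ∂(shellMeasure D m) := by
        rw [integral_const_mul, integral_map hmeas.aemeasurable (hasm l)]
    _ ≤ (2 * Real.pi * ‖minkBilin D‖) ^ l *
        ∫ p : Momentum D, (m + 2) ^ l * c * decayWeight p ∂(shellMeasure D m) := by
        have := Real.pi_pos
        refine mul_le_mul_of_nonneg_left ?_ (by positivity)
        refine integral_mono_of_nonneg (Filter.Eventually.of_forall fun k => by positivity)
          ((integrable_shell_of_volume hm integrable_decayWeight).const_mul _)
          (Filter.Eventually.of_forall fun p => ?_)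
        change ‖shell m s p‖ ^ l * ‖mft g (shell m s p)‖ ≤ (m + 2) ^ l * c * decayWeight p
        have h1 := hc p
        have h2 := pow_le_pow_left₀ (norm_nonneg _) (norm_shell_le hm hs p) l
        rw [mul_pow] at h2
        rw [decayWeight, ← div_eq_mul_inv, le_div_iff₀ (by positivity)]
        rw [pow_add] at h1
        calc ‖shell m s p‖ ^ l * ‖mft g (shell m s p)‖ * (1 + ‖p‖) ^ (D + 1)
            ≤ (m + 2) ^ l * (1 + ‖p‖) ^ l * ‖mft g (shell m s p)‖ * (1 + ‖p‖) ^ (D + 1) := by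
              gcongr
          _ = (m + 2) ^ l * ((1 + ‖p‖) ^ l * (1 + ‖p‖) ^ (D + 1) * ‖mft g (shell m s p)‖) := by ring
          _ ≤ _ := by gcongr
    _ = _ := by rw [integral_const_mul]; ring

theorem contDiff_shellWave (hm : 0 < m) (s : ℝ) (g : TestFun D) (n : ℕ) :
    ContDiff ℝ n (shellWave m s g) :=
  (hasTemperateGrowth_shellWave hm s g).1.of_le (by exact_mod_cast le_top)

theorem norm_iteratedFDeriv_re_pauliJordanConv_le (hm : 0 < m) (l : ℕ) :
    ∃ C, 0 ≤ C ∧ ∀ (g : TestFun D) (c : ℝ),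
      (∀ p, (1 + ‖p‖) ^ (l + (D + 1)) * ‖mft g (shell m 1 p)‖ ≤ c) →
      ∀ x, ‖iteratedFDeriv ℝ l (fun x => (pauliJordanConv m g x).re) x‖ ≤ C * c := by
  obtain ⟨C₁, hC₁, h₁⟩ := norm_iteratedFDeriv_shellWave_le (D := D) hm (s := 1) (by norm_num) l
  obtain ⟨C₂, hC₂, h₂⟩ := norm_iteratedFDeriv_shellWave_le (D := D) hm (s := -1) (by norm_num) l
  refine ⟨C₁ + C₂, by positivity, fun g c hc x => ?_⟩
  have hc' : ∀ p, (1 + ‖p‖) ^ (l + (D + 1)) * ‖mft g (shell m (-1) p)‖ ≤ c := fun p => by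
    rw [norm_mft_shell_neg, ← norm_neg p]; exact hc (-p)
  let T : ℂ →L[ℝ] ℝ := Complex.reCLM ∘L ((-Complex.I) • (1 : ℂ →L[ℝ] ℂ))
  have e : (fun x => (pauliJordanConv m g x).re) = T ∘ (shellWave m 1 g - shellWave m (-1) g) := by
    ext y
    rw [pauliJordanConv_eq hm]
    rfl
  have hT : ‖T‖ ≤ 1 := by
    refine (ContinuousLinearMap.opNorm_comp_le _ _).trans ?_
    rw [Complex.reCLM_norm, one_mul, norm_smul, norm_neg, Complex.norm_I, one_mul]
    exact ContinuousLinearMap.norm_id_le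
  have hd := (contDiff_shellWave hm 1 g l).sub (contDiff_shellWave hm (-1) g l)
  rw [e]
  refine (T.norm_iteratedFDeriv_comp_left hd.contDiffAt le_rfl).trans ?_
  change ‖T‖ * ‖iteratedFDeriv ℝ l (shellWave m 1 g - shellWave m (-1) g) x‖ ≤ _
  rw [iteratedFDeriv_sub_apply (contDiff_shellWave hm 1 g l).contDiffAt
    (contDiff_shellWave hm (-1) g l).contDiffAt]
  refine (mul_le_of_le_one_left (norm_nonneg _) hT).trans ((norm_sub_le _ _).trans ?_)
  rw [add_mul]
  exact add_le_add (h₁ g c hc x) (h₂ g c hc' x)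

/-- In the product `h · (Δ ∗ g)` the spatial decay comes from `h` alone, while the derivatives of `Δ
∗ g` are bounded uniformly in `x`. Hence only the values of `g̃` on the shell enter, and no Schwartz
seminorm of `g`. -/
theorem seminorm_squeezeGen_le (hm : 0 < m) (h : TestFun D) (k l : ℕ) :
    ∃ C, 0 ≤ C ∧ ∀ (g : TestFun D) (c : ℝ),
      (∀ p, (1 + ‖p‖) ^ (l + (D + 1)) * ‖mft g (shell m 1 p)‖ ≤ c) →
      SchwartzMap.seminorm ℝ k l (squeezeGen m h g) ≤ C * c := by
  choose C hC hD using fun i => norm_iteratedFDeriv_re_pauliJordanConv_le (D := D) hm i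
  refine ⟨∑ i ∈ Finset.range (l + 1), l.choose i * C i *
    SchwartzMap.seminorm ℝ k (l - i) h, ?_, fun g c hc => ?_⟩
  · exact Finset.sum_nonneg fun i _ => mul_nonneg (mul_nonneg (by positivity) (hC i))
      (apply_nonneg _ _)
  have hc0 : 0 ≤ c := le_trans (by positivity) (hc 0)
  refine seminorm_le_bound ℝ k l _ (mul_nonneg (Finset.sum_nonneg fun i _ =>
    mul_nonneg (mul_nonneg (by positivity) (hC i)) (apply_nonneg _ _)) hc0) fun x => ?_
  have hg := hasTemperateGrowth_re_pauliJordanConv hm g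
  have e : (squeezeGen m h g : Spacetime D → ℝ) =
      fun x => (pauliJordanConv m g x).re * h x := by
    ext y
    rw [squeezeGen, SchwartzMap.smulLeftCLM_apply_apply hg, smul_eq_mul]
  rw [e]
  have h1 := norm_iteratedFDeriv_mul_le (hg.1.of_le (m := (l : WithTop ℕ∞))
    (by exact_mod_cast le_top)) (h.smooth l) x (le_refl (l : WithTop ℕ∞))
  calc _ ≤ ‖x‖ ^ k * ∑ i ∈ Finset.range (l + 1), (l.choose i : ℝ) *
        ‖iteratedFDeriv ℝ i (fun x => (pauliJordanConv m g x).re) x‖ *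
          ‖iteratedFDeriv ℝ (l - i) h x‖ := by gcongr
    _ = ∑ i ∈ Finset.range (l + 1), (l.choose i : ℝ) *
        ‖iteratedFDeriv ℝ i (fun x => (pauliJordanConv m g x).re) x‖ *
          (‖x‖ ^ k * ‖iteratedFDeriv ℝ (l - i) h x‖) := by
        rw [Finset.mul_sum]; refine Finset.sum_congr rfl fun i _ => by ring
    _ ≤ ∑ i ∈ Finset.range (l + 1), (l.choose i : ℝ) * (C i * c) *
          SchwartzMap.seminorm ℝ k (l - i) h := by
        refine Finset.sum_le_sum fun i hi => ?_
        have hil : i ≤ l := Nat.lt_succ_iff.1 (Finset.mem_range.1 hi)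
        have h2 := hD i g c (fun p => le_trans (by
          gcongr
          linarith [norm_nonneg p]) (hc p)) x
        have h3 := le_seminorm ℝ k (l - i) h x
        have h4 := mul_nonneg (hC i) hc0
        gcongr
    _ = _ := by rw [Finset.sum_mul]; refine Finset.sum_congr rfl fun i _ => by ring

/-! ### The generator in momentum space -/

theorem mink_sub_left (k l x : Spacetime D) : mink (k - l) x = mink k x - mink l x := by
  simp only [mink, PiLp.sub_apply, sub_mul, Finset.sum_sub_distrib]; ring

theorem continuous_mink : Continuous fun z : Spacetime D × Spacetime D => mink z.1 z.2 := by
  unfold mink; fun_prop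

theorem norm_exp_I_mink (k x : Spacetime D) : ‖Complex.exp (Complex.I * (mink k x : ℂ))‖ = 1 := by
  rw [mul_comm, Complex.norm_exp_ofReal_mul_I]

theorem integrable_toComplex (h : TestFun D) : Integrable fun x => (h x : ℂ) :=
  h.integrable.ofReal

/-- The Fourier transform of the product of a test function with a superposition of waves. -/
theorem integral_mul_shellWave (hm : 0 < m) (s : ℝ) (h g : TestFun D) (k : Spacetime D) :
    Integrable (fun p => mft g (shell m s p) * mft h (k - shell m s p)) (shellMeasure D m) ∧
    Integrable (fun x => (h x : ℂ) * shellWave m s g x *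
      Complex.exp (-(Complex.I * (mink k x : ℂ)))) ∧
    ∫ x, (h x : ℂ) * shellWave m s g x * Complex.exp (-(Complex.I * (mink k x : ℂ))) =
      ∫ p, mft g (shell m s p) * mft h (k - shell m s p) ∂(shellMeasure D m) := by
  have hg : Integrable (fun p => mft g (shell m s p)) (shellMeasure D m) := by
    have h0 := integrable_pow_mft_shell hm s g 0
    refine h0.mono' ((continuous_mft g).comp (continuous_shell s)).aestronglyMeasurable
      (Filter.Eventually.of_forall fun p => by simp)
  let G : Spacetime D × Momentum D → ℂ := fun z => (h z.1 : ℂ) * mft g (shell m s z.2) *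
    (Complex.exp (Complex.I * (mink (shell m s z.2) z.1 : ℂ)) *
      Complex.exp (-(Complex.I * (mink k z.1 : ℂ))))
  have hG : Integrable G (volume.prod (shellMeasure D m)) := by
    refine ((integrable_toComplex h).mul_prod hg).mul_bdd (c := 1) ?_ ?_
    · refine Continuous.aestronglyMeasurable ?_
      have h1 : Continuous fun z : Spacetime D × Momentum D => mink (shell m s z.2) z.1 :=
        continuous_mink.comp (((continuous_shell s).comp continuous_snd).prodMk continuous_fst)
      have h2 : Continuous fun z : Spacetime D × Momentum D => mink k z.1 :=
        continuous_mink.comp (continuous_const.prodMk continuous_fst)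
      fun_prop
    · refine Filter.Eventually.of_forall fun z => ?_
      rw [norm_mul, norm_exp_I_mink, one_mul, ← mul_neg, ← Complex.ofReal_neg, mul_comm,
        Complex.norm_exp_ofReal_mul_I]
  have e1 : ∀ x, ∫ p, G (x, p) ∂(shellMeasure D m) = (h x : ℂ) * shellWave m s g x *
      Complex.exp (-(Complex.I * (mink k x : ℂ))) := fun x => by
    rw [shellWave, ← integral_const_mul, ← integral_mul_const]
    congr 1; ext p; simp only [G]; ring
  have e2 : ∀ p, ∫ x, G (x, p) = mft g (shell m s p) * mft h (k - shell m s p) := fun p => by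
    rw [mft.eq_def h, ← integral_const_mul]
    congr 1; ext x
    simp only [G]
    rw [← Complex.exp_add, mink_sub_left]
    push_cast
    have : Complex.I * (mink (shell m s p) x : ℂ) + -(Complex.I * (mink k x : ℂ)) =
      -(Complex.I * ((mink k x : ℂ) - (mink (shell m s p) x : ℂ))) := by ring
    rw [this]; ring
  refine ⟨?_, ?_, ?_⟩
  · simpa only [e2] using hG.integral_prod_right
  · simpa only [e1] using hG.integral_prod_left
  · simp only [← e1, ← e2]
    exact integral_integral_swap (f := fun x p => G (x, p)) hG

/-- The kernel of the complex-linear part of the generator. -/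
def minusKernel (m : ℝ) (h : TestFun D) (p q : Momentum D) : ℂ :=
  -Complex.I * mft h (shell m 1 p - shell m 1 q)

/-- The kernel of the antilinear part of the generator. -/
def plusKernel (m : ℝ) (h : TestFun D) (p q : Momentum D) : ℂ :=
  Complex.I * mft h (shell m 1 p + shell m 1 q)

/-- Multiplication by `h` becomes convolution with `h̃`. On the lower shell the substitution `q ↦
-q` turns the difference of momenta into a sum, and reality of `g` turns `g̃` into its conjugate.
The lower shell is thus the source of the antilinear part. -/
theorem mft_squeezeGen (hm : 0 < m) (h g : TestFun D) (p : Momentum D) :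
    mft (squeezeGen m h g) (shell m 1 p) =
      ∫ q, (minusKernel m h p q * mft g (shell m 1 q) +
        plusKernel m h p q * (starRingEnd ℂ) (mft g (shell m 1 q))) ∂(shellMeasure D m) := by
  obtain ⟨i1, j1, e1⟩ := integral_mul_shellWave hm 1 h g (shell m 1 p)
  obtain ⟨i2, j2, e2⟩ := integral_mul_shellWave hm (-1) h g (shell m 1 p)
  have e3 : ∀ q : Momentum D, mft g (shell m (-1) (-q)) * mft h (shell m 1 p - shell m (-1) (-q)) =
      (starRingEnd ℂ) (mft g (shell m 1 q)) * mft h (shell m 1 p + shell m 1 q) := fun q => by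
    rw [← neg_shell, sub_neg_eq_add, conj_mft]
  have e4 := integral_neg_eq_self (μ := shellMeasure D m)
    fun q => mft g (shell m (-1) q) * mft h (shell m 1 p - shell m (-1) q)
  have i3 := i2.comp_neg
  simp only [e3] at e4 i3
  have e5 : mft (squeezeGen m h g) (shell m 1 p) = -Complex.I *
      ((∫ x, (h x : ℂ) * shellWave m 1 g x *
        Complex.exp (-(Complex.I * (mink (shell m 1 p) x : ℂ)))) -
      ∫ x, (h x : ℂ) * shellWave m (-1) g x *
        Complex.exp (-(Complex.I * (mink (shell m 1 p) x : ℂ)))) := by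
    rw [mft, ← integral_sub j1 j2, ← integral_const_mul]
    congr 1; ext x
    rw [squeezeGen_apply hm, pauliJordanConv_eq hm]
    simp only [shellWave]
    ring
  rw [e5, e1, e2, ← e4, ← integral_sub i1 i3, ← integral_const_mul]
  congr 1; ext q
  simp only [minusKernel, plusKernel]
  ring

theorem sub_shell_apply_le (p q : Momentum D) : ‖p - q‖ ≤ ‖shell m 1 p - shell m 1 q‖ := by
  rw [EuclideanSpace.norm_eq, EuclideanSpace.norm_eq]
  apply Real.sqrt_le_sqrt
  simp only [shell, Fin.sum_univ_succ, PiLp.sub_apply, Fin.cons_zero, Fin.cons_succ]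
  have := sq_nonneg ‖1 * energy m p - 1 * energy m q‖
  linarith

theorem add_shell_apply_le (p q : Momentum D) : ‖p + q‖ ≤ ‖shell m 1 p + shell m 1 q‖ := by
  rw [EuclideanSpace.norm_eq, EuclideanSpace.norm_eq]
  apply Real.sqrt_le_sqrt
  simp only [shell, Fin.sum_univ_succ, PiLp.add_apply, Fin.cons_zero, Fin.cons_succ]
  have := sq_nonneg ‖1 * energy m p + 1 * energy m q‖
  linarith

theorem norm_le_energy (p : Momentum D) : ‖p‖ ≤ energy m p :=
  Real.le_sqrt_of_sq_le (by nlinarith [sq_nonneg m])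

/-- Momenta on the same shell cannot compensate each other. -/
theorem norm_add_norm_le (p q : Momentum D) :
    ‖p‖ + ‖q‖ ≤ ‖shell m 1 p + shell m 1 q‖ := by
  have h1 := PiLp.norm_apply_le (shell m 1 p + shell m 1 q) 0
  have h2 := norm_le_energy (m := m) p
  have h3 := norm_le_energy (m := m) q
  have h4 : (shell m 1 p + shell m 1 q) 0 = energy m p + energy m q := by simp [shell]
  rw [h4] at h1
  exact (add_le_add h2 h3).trans ((le_abs_self _).trans h1)

/-- The first two bounds serve the weighted estimates and the Schur test. The third holds because
the norm of the sum of two upper-shell momenta dominates `‖p‖` and `‖q‖` separately; it makes the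
antilinear kernel square integrable. -/
theorem exists_kernel_bound (h : TestFun D) (M : ℕ) : ∃ C, 0 ≤ C ∧
    (∀ p q, (1 + ‖p - q‖) ^ M * ‖minusKernel m h p q‖ ≤ C * decayWeight (p - q)) ∧
    (∀ p q, (1 + ‖p + q‖) ^ M * ‖plusKernel m h p q‖ ≤ C * decayWeight (p + q)) ∧
    ∀ p q, ‖plusKernel m h p q‖ ≤ C * (decayWeight p * decayWeight q) := by
  obtain ⟨C₁, hC₁, h₁⟩ := mft_decay h (M + (D + 1))
  obtain ⟨C₂, hC₂, h₂⟩ := mft_decay h ((D + 1) + (D + 1))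
  have hn1 : ∀ p q, ‖minusKernel m h p q‖ = ‖mft h (shell m 1 p - shell m 1 q)‖ := fun p q => by
    simp [minusKernel]
  have hn2 : ∀ p q, ‖plusKernel m h p q‖ = ‖mft h (shell m 1 p + shell m 1 q)‖ := fun p q => by
    simp [plusKernel]
  refine ⟨max C₁ C₂, le_max_of_le_left hC₁, fun p q => ?_, fun p q => ?_, fun p q => ?_⟩
  · rw [hn1, decayWeight, ← div_eq_mul_inv, le_div_iff₀ (by positivity), mul_right_comm, ← pow_add]
    refine le_trans ?_ ((h₁ (shell m 1 p - shell m 1 q)).trans (le_max_left _ _))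
    have := sub_shell_apply_le (m := m) p q
    gcongr
  · rw [hn2, decayWeight, ← div_eq_mul_inv, le_div_iff₀ (by positivity), mul_right_comm, ← pow_add]
    refine le_trans ?_ ((h₁ (shell m 1 p + shell m 1 q)).trans (le_max_left _ _))
    have := add_shell_apply_le (m := m) p q
    gcongr
  · rw [hn2, decayWeight, decayWeight, ← mul_inv, ← div_eq_mul_inv, le_div_iff₀ (by positivity),
      mul_comm]
    refine le_trans ?_ ((h₂ (shell m 1 p + shell m 1 q)).trans (le_max_right _ _))
    have := norm_add_norm_le (m := m) p q
    have := norm_nonneg p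
    have := norm_nonneg q
    have k1 : ‖p‖ ≤ ‖shell m 1 p + shell m 1 q‖ := by linarith
    have k2 : ‖q‖ ≤ ‖shell m 1 p + shell m 1 q‖ := by linarith
    rw [pow_add (1 + ‖shell m 1 p + shell m 1 q‖) (D + 1) (D + 1)]
    gcongr

/-- Weighted bounds on the mass shell propagate under the generator. -/
theorem weighted_squeezeGen_le (hm : 0 < m) (h : TestFun D) (M : ℕ) :
    ∃ K, 0 ≤ K ∧ ∀ (g : TestFun D) (c : ℝ),
      (∀ p, (1 + ‖p‖) ^ M * ‖mft g (shell m 1 p)‖ ≤ c) →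
      ∀ p, (1 + ‖p‖) ^ M * ‖mft (squeezeGen m h g) (shell m 1 p)‖ ≤ K * c := by
  obtain ⟨C, hC, h1, h2, -⟩ := exists_kernel_bound (m := m) h M
  have hJ := decayMass_nonneg (D := D) hm
  refine ⟨2 * C * decayMass D m, by positivity, fun g c hc p => ?_⟩
  have hc0 : 0 ≤ c := le_trans (by positivity) (hc 0)
  -- Peetre's inequality moves the weight in `p` to the kernel and to the argument `q`.
  have hpq : ∀ q : Momentum D, 1 + ‖p‖ ≤ (1 + ‖p - q‖) * (1 + ‖q‖) := fun q => by
    have h3 : ‖p‖ ≤ ‖p - q‖ + ‖q‖ := by simpa using norm_add_le (p - q) q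
    nlinarith [norm_nonneg (p - q), norm_nonneg q, mul_nonneg (norm_nonneg (p - q)) (norm_nonneg q)]
  have hpq' : ∀ q : Momentum D, 1 + ‖p‖ ≤ (1 + ‖p + q‖) * (1 + ‖q‖) := fun q => by
    simpa using hpq (-q)
  rw [mft_squeezeGen hm, ← Real.norm_of_nonneg (by positivity : 0 ≤ (1 + ‖p‖) ^ M),
    ← norm_smul, ← integral_smul]
  have hb : ∀ q, ‖(1 + ‖p‖) ^ M • (minusKernel m h p q * mft g (shell m 1 q) +
      plusKernel m h p q * (starRingEnd ℂ) (mft g (shell m 1 q)))‖ ≤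
      C * c * (decayWeight (p - q) + decayWeight (p + q)) := fun q => by
    rw [norm_smul, Real.norm_of_nonneg (by positivity)]
    have hg := hc q
    have k1 := h1 p q
    have k2 := h2 p q
    have w1 := pow_le_pow_left₀ (by positivity) (hpq q) M
    have w2 := pow_le_pow_left₀ (by positivity) (hpq' q) M
    rw [mul_pow] at w1 w2
    have d1 := (decayWeight_pos (p - q)).le
    have d2 := (decayWeight_pos (p + q)).le
    calc (1 + ‖p‖) ^ M * ‖minusKernel m h p q * mft g (shell m 1 q) +
          plusKernel m h p q * (starRingEnd ℂ) (mft g (shell m 1 q))‖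
        ≤ (1 + ‖p‖) ^ M * (‖minusKernel m h p q‖ * ‖mft g (shell m 1 q)‖ +
          ‖plusKernel m h p q‖ * ‖mft g (shell m 1 q)‖) := by
          gcongr
          refine (norm_add_le _ _).trans (le_of_eq ?_)
          rw [norm_mul, norm_mul, RCLike.norm_conj]
      _ = (1 + ‖p‖) ^ M * (‖minusKernel m h p q‖ * ‖mft g (shell m 1 q)‖) +
          (1 + ‖p‖) ^ M * (‖plusKernel m h p q‖ * ‖mft g (shell m 1 q)‖) := by ring
      _ ≤ ((1 + ‖p - q‖) ^ M * (1 + ‖q‖) ^ M) *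
            (‖minusKernel m h p q‖ * ‖mft g (shell m 1 q)‖) +
          ((1 + ‖p + q‖) ^ M * (1 + ‖q‖) ^ M) *
            (‖plusKernel m h p q‖ * ‖mft g (shell m 1 q)‖) := by gcongr
      _ = ((1 + ‖p - q‖) ^ M * ‖minusKernel m h p q‖) * ((1 + ‖q‖) ^ M * ‖mft g (shell m 1 q)‖) +
          ((1 + ‖p + q‖) ^ M * ‖plusKernel m h p q‖) *
            ((1 + ‖q‖) ^ M * ‖mft g (shell m 1 q)‖) := by ring
      _ ≤ (C * decayWeight (p - q)) * c + (C * decayWeight (p + q)) * c := by gcongr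
      _ = _ := by ring
  refine (norm_integral_le_of_norm_le (((integrable_decayWeight_sub hm p).add
    (integrable_decayWeight_add hm p)).const_mul (C * c))
    (Filter.Eventually.of_forall hb)).trans ?_
  rw [integral_const_mul, integral_add' (integrable_decayWeight_sub hm p)
    (integrable_decayWeight_add hm p)]
  have k1 := integral_decayWeight_sub_le hm p
  have k2 := integral_decayWeight_add_le hm p
  have : 0 ≤ C * c := by positivity
  nlinarith

theorem weighted_iterate_squeezeGen_le (hm : 0 < m) (h : TestFun D) (M : ℕ) (g : TestFun D) :
    ∃ K c, 0 ≤ K ∧ 0 ≤ c ∧ ∀ n p,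
      (1 + ‖p‖) ^ M * ‖mft ((squeezeGen m h)^[n] g) (shell m 1 p)‖ ≤ K ^ n * c := by
  obtain ⟨K, hK, hKn⟩ := weighted_squeezeGen_le hm h M
  obtain ⟨c, hc, hcn⟩ := mft_decay g M
  refine ⟨K, c, hK, hc, fun n => ?_⟩
  induction n with
  | zero =>
    intro p
    rw [pow_zero, one_mul]
    refine le_trans ?_ (hcn (shell m 1 p))
    have := norm_le_norm_shell (m := m) 1 p
    simp only [Function.iterate_zero, id]
    gcongr
  | succ n ih =>
    intro p
    rw [Function.iterate_succ_apply', pow_succ', mul_assoc]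
    exact hKn _ _ ih p

/-- The exponential series of the generator converges in the Schwartz space. -/
theorem summable_squeezeTerm (hm : 0 < m) (h g : TestFun D) : Summable (squeezeTerm m h g) := by
  refine summable_of_seminorm fun k l => ?_
  obtain ⟨K, c, hK, hc, hb⟩ := weighted_iterate_squeezeGen_le hm h (l + (D + 1)) g
  obtain ⟨C, hC, hs⟩ := seminorm_squeezeGen_le hm h k l
  -- Seminorms are controlled only after one application of the generator, so the term `n + 1` is
  -- estimated by the `n`-th iterate on the shell, and the term `0` is dropped.
  rw [← summable_nat_add_iff 1]
  refine Summable.of_nonneg_of_le (fun n => apply_nonneg _ _) (fun n => ?_)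
    ((Real.summable_pow_div_factorial K).mul_left (C * c))
  rw [squeezeTerm, map_smul_eq_mul, Real.norm_of_nonneg (by positivity),
    Function.iterate_succ_apply']
  have h1 := hs _ _ (hb n)
  calc ((n + 1).factorial : ℝ)⁻¹ *
        SchwartzMap.seminorm ℝ k l (squeezeGen m h ((squeezeGen m h)^[n] g))
      ≤ (n.factorial : ℝ)⁻¹ * (C * (K ^ n * c)) := by
        gcongr
        exact Nat.le_succ n
    _ = _ := by ring

/-! ### Real-linear operators and their exponentials -/

/-- The bounded real-linear operators on a complex Hilbert space. -/
abbrev RealOperator (E : Type*) [NormedAddCommGroup E] [InnerProductSpace ℂ E] : Type _ :=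
  E →L[ℝ] E

section Exp

variable {E : Type*} [NormedAddCommGroup E] [InnerProductSpace ℂ E]

/-- The exponential of a bounded real-linear operator. -/
def expOperator (B : RealOperator E) : RealOperator E := NormedSpace.exp B

/-- For a symplectically skew operator the antilinear part is symmetric. -/
theorem inner_antiPart_comm {B : RealOperator E}
    (hB : ∀ x y, (⟪B x, y⟫_ℂ).im = -(⟪x, B y⟫_ℂ).im) (x y : E) :
    ⟪x, antiPart B y⟫_ℂ = ⟪y, antiPart B x⟫_ℂ := by
  have key : ∀ x y, (⟪x, antiPart B y⟫_ℂ).im = (⟪y, antiPart B x⟫_ℂ).im := by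
    intro x y
    have h1 := hB x y
    have h2 := hB (Complex.I • x) (Complex.I • y)
    simp only [← linPart_add_antiPart B, map_smul, map_smulₛₗ, inner_add_left, inner_add_right,
      inner_smul_left, inner_smul_right, Complex.conj_I, Complex.add_im, neg_neg, map_neg] at h1 h2
    have h3 : (⟪antiPart B x, y⟫_ℂ).im = -(⟪y, antiPart B x⟫_ℂ).im := by
      rw [← inner_conj_symm, Complex.conj_im]
    simp only [Complex.mul_im, Complex.mul_re, Complex.I_re, Complex.I_im, Complex.neg_re,
      Complex.neg_im, Complex.add_re, Complex.add_im, h3] at h1 h2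
    linarith
  refine Complex.ext ?_ (key x y)
  have h := key (Complex.I • x) y
  simp only [map_smulₛₗ, inner_smul_left, inner_smul_right, Complex.conj_I,
    Complex.mul_im, Complex.I_re, Complex.I_im, Complex.neg_re, Complex.neg_im] at h
  linarith

variable [CompleteSpace E]

theorem hasSum_expOperator (B : RealOperator E) (x : E) :
    HasSum (fun n : ℕ => (((n.factorial : ℝ)⁻¹ : ℝ) : ℂ) • B^[n] x) (expOperator B x) := by
  let _ : NormedAlgebra ℚ (E →L[ℝ] E) := NormedAlgebra.restrictScalars ℚ ℝ _
  have h := (NormedSpace.exp_series_hasSum_exp' (𝕂 := ℝ) B).mapL (ContinuousLinearMap.apply ℝ E x)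
  have e : ∀ n, (B ^ n) x = B^[n] x := fun n => by
    induction n with
    | zero => rfl
    | succ n ih => rw [pow_succ', mul_apply_eq_comp, ih, Function.iterate_succ_apply']
  refine hasSum_of_eq h fun n => ?_
  rw [Complex.coe_smul, ← e]
  rfl

theorem denseRange_comp_expOperator (B : RealOperator E) {α : Type*} {r : α → E}
    (hr : DenseRange r) : DenseRange fun a => expOperator B (r a) :=
  (surjective_exp B).denseRange.comp hr (expOperator B).continuous

theorem FockStructure.implementable_expOperator {H : ℕ → Type*} [∀ n, NormedAddCommGroup (H n)]
    [∀ n, InnerProductSpace ℂ (H n)] [∀ n, CompleteSpace (H n)] (S : FockStructure E H)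
    {ι : Type*} (b : HilbertBasis ι ℂ E) {B : RealOperator E}
    (hskew : ∀ x y, (⟪B x, y⟫_ℂ).im = -(⟪x, B y⟫_ℂ).im) {β : ℝ} (hβ : 0 ≤ β)
    (hB : HSLe b (antiPart B) β) : S.Implementable (expOperator B) :=
  S.implementable_exp b hskew hβ hB (inner_antiPart_comm hskew)

theorem im_inner_expOperator {B : RealOperator E}
    (hB : ∀ x y, (⟪B x, y⟫_ℂ).im = -(⟪x, B y⟫_ℂ).im) (u v : E) :
    (⟪expOperator B u, expOperator B v⟫_ℂ).im = (⟪u, v⟫_ℂ).im :=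
  im_inner_exp hB u v

end Exp

/-! ### Real-linear integral operators -/

section Kernel

variable {α : Type*} [MeasurableSpace α] {μ : Measure α}

/-- Cauchy–Schwarz for the factorization `k u = k^{1/2} · (k^{1/2} u)`. -/
theorem sq_lintegral_mul_le {k u : α → ℝ≥0∞} (hk : Measurable k) (hu : Measurable u) :
    (∫⁻ q, k q * u q ∂μ) ^ 2 ≤ (∫⁻ q, k q ∂μ) * ∫⁻ q, k q * u q ^ 2 ∂μ := by
  have h := ENNReal.lintegral_mul_norm_pow_le (μ := μ) (p := 1 / 2) (q := 1 / 2) hk.aemeasurable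
    (hk.mul (hu.pow_const 2)).aemeasurable (by norm_num) (by norm_num) (by norm_num)
  have e : ∀ q, k q ^ (1 / 2 : ℝ) * ((k * fun q => u q ^ 2) q) ^ (1 / 2 : ℝ) = k q * u q :=
    fun q => by
    rw [Pi.mul_apply, ENNReal.mul_rpow_of_nonneg _ _ (by norm_num), ← mul_assoc,
      ← ENNReal.rpow_add_of_nonneg _ _ (by norm_num) (by norm_num), ← ENNReal.rpow_natCast,
      ← ENNReal.rpow_mul]
    norm_num
  simp only [e] at h
  calc (∫⁻ q, k q * u q ∂μ) ^ 2
      ≤ ((∫⁻ q, k q ∂μ) ^ (1 / 2 : ℝ) * (∫⁻ q, k q * u q ^ 2 ∂μ) ^ (1 / 2 : ℝ)) ^ 2 := by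
        gcongr; exact h
    _ = _ := by
        rw [mul_pow, ← ENNReal.rpow_natCast, ← ENNReal.rpow_mul, ← ENNReal.rpow_natCast,
          ← ENNReal.rpow_mul]
        norm_num

/-- The Schur test. -/
theorem lintegral_sq_lintegral_mul_le [SFinite μ] {k : α → α → ℝ≥0∞}
    (hk : Measurable (Function.uncurry k)) {u : α → ℝ≥0∞} (hu : Measurable u) {κ : ℝ≥0∞}
    (h₁ : ∀ p, ∫⁻ q, k p q ∂μ ≤ κ) (h₂ : ∀ q, ∫⁻ p, k p q ∂μ ≤ κ) :
    ∫⁻ p, (∫⁻ q, k p q * u q ∂μ) ^ 2 ∂μ ≤ κ ^ 2 * ∫⁻ q, u q ^ 2 ∂μ := by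
  calc ∫⁻ p, (∫⁻ q, k p q * u q ∂μ) ^ 2 ∂μ
      ≤ ∫⁻ p, κ * ∫⁻ q, k p q * u q ^ 2 ∂μ ∂μ := by
        refine lintegral_mono fun p => ?_
        refine (sq_lintegral_mul_le (hk.of_uncurry_left (x := p)) hu).trans ?_
        gcongr
        exact h₁ p
    _ = κ * ∫⁻ p, ∫⁻ q, k p q * u q ^ 2 ∂μ ∂μ := by
        refine lintegral_const_mul _ ?_
        exact (hk.mul ((hu.comp measurable_snd).pow_const 2)).lintegral_prod_right'
    _ = κ * ∫⁻ q, ∫⁻ p, k p q * u q ^ 2 ∂μ ∂μ := by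
        rw [lintegral_lintegral_swap]
        exact (hk.mul ((hu.comp measurable_snd).pow_const 2)).aemeasurable
    _ ≤ κ * ∫⁻ q, κ * u q ^ 2 ∂μ := by
        gcongr with q
        rw [lintegral_mul_const _ (hk.of_uncurry_right (y := q))]
        gcongr
        exact h₂ q
    _ = _ := by rw [lintegral_const_mul _ (hu.pow_const 2), ← mul_assoc, sq]

theorem norm_sq_eq_integral (f : Lp ℂ 2 μ) : ‖f‖ ^ 2 = ∫ x, ‖f x‖ ^ 2 ∂μ := by
  have h : ⟪f, f⟫_ℂ = ((∫ x, ‖f x‖ ^ 2 ∂μ : ℝ) : ℂ) := by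
    rw [L2.inner_def]
    refine Eq.trans ?_ integral_ofReal
    congr 1; ext x
    rw [inner_self_eq_norm_sq_to_K]
    push_cast
    rfl
  rw [inner_self_eq_norm_sq_to_K] at h
  exact Complex.ofReal_injective ((Complex.ofReal_pow _ _).trans h)

theorem integrable_sq_norm_coe (f : Lp ℂ 2 μ) : Integrable (fun x => ‖f x‖ ^ 2) μ :=
  (memLp_two_iff_integrable_sq_norm (Lp.aestronglyMeasurable f)).1 (Lp.memLp f)

/-- Kernels `k`, `l` of an operator `χ ↦ ∫ k(p, q) χ(q) + l(p, q) conj χ(q)` on `L²` that pass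
the Schur test. -/
structure SchurKernel (μ : Measure α) (k l : α → α → ℂ) (κ : ℝ) : Prop where
  stronglyMeasurable_left : StronglyMeasurable (Function.uncurry k)
  stronglyMeasurable_right : StronglyMeasurable (Function.uncurry l)
  memLp_left : ∀ p, MemLp (k p) 2 μ
  memLp_right : ∀ p, MemLp (l p) 2 μ
  nonneg : 0 ≤ κ
  row : ∀ p, ∫⁻ q, (‖k p q‖ₑ + ‖l p q‖ₑ) ∂μ ≤ ENNReal.ofReal κ
  column : ∀ q, ∫⁻ p, (‖k p q‖ₑ + ‖l p q‖ₑ) ∂μ ≤ ENNReal.ofReal κ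

variable {k l : α → α → ℂ} {κ : ℝ}

/-- The function `p ↦ ∫ k(p, q) χ(q) + l(p, q) conj χ(q)`. -/
def kernelFun (μ : Measure α) (k l : α → α → ℂ) (χ : α → ℂ) (p : α) : ℂ :=
  ∫ q, (k p q * χ q + l p q * (starRingEnd ℂ) (χ q)) ∂μ

theorem kernelFun_congr {χ ξ : α → ℂ} (h : χ =ᵐ[μ] ξ) : kernelFun μ k l χ = kernelFun μ k l ξ := by
  ext p
  refine integral_congr_ae ?_
  filter_upwards [h] with q hq
  rw [hq]

theorem memLp_conj {χ : α → ℂ} (h : MemLp χ 2 μ) :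
    MemLp (fun q => (starRingEnd ℂ) (χ q)) 2 μ := h.star

namespace SchurKernel

theorem integrable_left (hK : SchurKernel μ k l κ) {χ : α → ℂ} (hχ : MemLp χ 2 μ) (p : α) :
    Integrable (fun q => k p q * χ q) μ :=
  (hK.memLp_left p).integrable_mul hχ

theorem integrable_right (hK : SchurKernel μ k l κ) {χ : α → ℂ} (hχ : MemLp χ 2 μ) (p : α) :
    Integrable (fun q => l p q * (starRingEnd ℂ) (χ q)) μ :=
  (hK.memLp_right p).integrable_mul (memLp_conj hχ)

theorem kernelFun_eq (hK : SchurKernel μ k l κ) {χ : α → ℂ} (hχ : MemLp χ 2 μ) (p : α) :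
    kernelFun μ k l χ p = ∫ q, k p q * χ q ∂μ + ∫ q, l p q * (starRingEnd ℂ) (χ q) ∂μ :=
  integral_add (hK.integrable_left hχ p) (hK.integrable_right hχ p)

theorem eLpNorm_kernelFun_le [SFinite μ] (hK : SchurKernel μ k l κ) (χ : Lp ℂ 2 μ) :
    eLpNorm (kernelFun μ k l χ) 2 μ ≤ ENNReal.ofReal κ * eLpNorm χ 2 μ := by
  have hk : Measurable (Function.uncurry fun p q => ‖k p q‖ₑ + ‖l p q‖ₑ) :=
    hK.stronglyMeasurable_left.measurable.enorm.add hK.stronglyMeasurable_right.measurable.enorm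
  have hu : Measurable fun q => ‖χ q‖ₑ := (Lp.stronglyMeasurable χ).measurable.enorm
  have h := lintegral_sq_lintegral_mul_le hk hu hK.row hK.column
  have h1 : ∫⁻ p, ‖kernelFun μ k l χ p‖ₑ ^ 2 ∂μ ≤
      ENNReal.ofReal κ ^ 2 * ∫⁻ q, ‖χ q‖ₑ ^ 2 ∂μ := by
    refine le_trans (lintegral_mono fun p => ?_) h
    gcongr
    refine (enorm_integral_le_lintegral_enorm _).trans (lintegral_mono fun q => ?_)
    refine (enorm_add_le _ _).trans (le_of_eq ?_)
    rw [enorm_mul, enorm_mul, add_mul]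
    congr 2
    rw [← ofReal_norm, ← ofReal_norm, RCLike.norm_conj]
  rw [eLpNorm_eq_lintegral_rpow_enorm_toReal two_ne_zero ENNReal.ofNat_ne_top,
    eLpNorm_eq_lintegral_rpow_enorm_toReal two_ne_zero ENNReal.ofNat_ne_top]
  simp only [ENNReal.toReal_ofNat, ENNReal.rpow_ofNat]
  calc (∫⁻ p, ‖kernelFun μ k l χ p‖ₑ ^ 2 ∂μ) ^ (1 / 2 : ℝ)
      ≤ (ENNReal.ofReal κ ^ 2 * ∫⁻ q, ‖χ q‖ₑ ^ 2 ∂μ) ^ (1 / 2 : ℝ) := by gcongr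
    _ = _ := by
        rw [ENNReal.mul_rpow_of_nonneg _ _ (by norm_num), ← ENNReal.rpow_natCast,
          ← ENNReal.rpow_mul]
        norm_num

theorem memLp_kernelFun [SFinite μ] (hK : SchurKernel μ k l κ) (χ : Lp ℂ 2 μ) :
    MemLp (kernelFun μ k l χ) 2 μ := by
  refine ⟨?_, (hK.eLpNorm_kernelFun_le χ).trans_lt
    (ENNReal.mul_lt_top ENNReal.ofReal_lt_top (Lp.eLpNorm_lt_top χ))⟩
  have hχ := (Lp.stronglyMeasurable χ).comp_measurable
    (measurable_snd : Measurable (Prod.snd : α × α → α))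
  have h1 : StronglyMeasurable fun z : α × α => k z.1 z.2 * χ z.2 +
      l z.1 z.2 * (starRingEnd ℂ) (χ z.2) :=
    (hK.stronglyMeasurable_left.mul hχ).add
      (hK.stronglyMeasurable_right.mul (Complex.continuous_conj.comp_stronglyMeasurable hχ))
  exact h1.integral_prod_right'.aestronglyMeasurable

/-- The operator with the given kernels. -/
def toCLM [SFinite μ] (hK : SchurKernel μ k l κ) : RealOperator (Lp ℂ 2 μ) :=
  LinearMap.mkContinuous
    { toFun := fun χ => (hK.memLp_kernelFun χ).toLp _
      map_add' := fun χ ξ => by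
        rw [← MemLp.toLp_add]
        refine MemLp.toLp_congr _ _ (Filter.Eventually.of_forall fun p => ?_)
        rw [kernelFun_congr (Lp.coeFn_add χ ξ), Pi.add_apply,
          hK.kernelFun_eq ((Lp.memLp χ).add (Lp.memLp ξ)), hK.kernelFun_eq (Lp.memLp χ),
          hK.kernelFun_eq (Lp.memLp ξ)]
        simp only [Pi.add_apply, map_add, mul_add]
        rw [integral_add (hK.integrable_left (Lp.memLp χ) p) (hK.integrable_left (Lp.memLp ξ) p),
          integral_add (hK.integrable_right (Lp.memLp χ) p) (hK.integrable_right (Lp.memLp ξ) p)]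
        ring
      map_smul' := fun c χ => by
        rw [RingHom.id_apply, ← Complex.coe_smul, ← Complex.coe_smul, ← MemLp.toLp_const_smul]
        refine MemLp.toLp_congr _ _ (Filter.Eventually.of_forall fun p => ?_)
        rw [kernelFun_congr (Lp.coeFn_smul (c : ℂ) χ), Pi.smul_apply, kernelFun, kernelFun,
          ← integral_smul]
        congr 1; ext q
        simp only [Pi.smul_apply, smul_eq_mul, map_mul, Complex.conj_ofReal]
        ring }
    κ fun χ => by
      change ‖(hK.memLp_kernelFun χ).toLp _‖ ≤ _
      rw [Lp.norm_toLp, Lp.norm_def]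
      refine (ENNReal.toReal_mono (ENNReal.mul_lt_top ENNReal.ofReal_lt_top
        (Lp.eLpNorm_lt_top χ)).ne (hK.eLpNorm_kernelFun_le χ)).trans (le_of_eq ?_)
      rw [ENNReal.toReal_mul, ENNReal.toReal_ofReal hK.nonneg]

theorem coeFn_toCLM [SFinite μ] (hK : SchurKernel μ k l κ) (χ : Lp ℂ 2 μ) :
    hK.toCLM χ =ᵐ[μ] kernelFun μ k l χ :=
  MemLp.coeFn_toLp (hK.memLp_kernelFun χ)

/-- The combination defining `antiPart` cancels the kernel `k` and leaves the integral against `l`.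
Writing its value at `p` as an inner product with the row `l p` prepares Bessel's inequality. -/
theorem coeFn_antiPart [SFinite μ] (hK : SchurKernel μ k l κ) (χ : Lp ℂ 2 μ) :
    antiPart hK.toCLM χ =ᵐ[μ] fun p => ⟪χ, (hK.memLp_right p).toLp _⟫_ℂ := by
  have e := antiPart_apply hK.toCLM χ
  rw [e]
  filter_upwards [hK.coeFn_toCLM χ, hK.coeFn_toCLM (Complex.I • χ),
    Lp.coeFn_smul (2⁻¹ : ℂ) (hK.toCLM χ + Complex.I • hK.toCLM (Complex.I • χ)),
    Lp.coeFn_add (hK.toCLM χ) (Complex.I • hK.toCLM (Complex.I • χ)),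
    Lp.coeFn_smul Complex.I (hK.toCLM (Complex.I • χ))] with p h1 h2 h3 h4 h5
  rw [h3, Pi.smul_apply, h4, Pi.add_apply, h5, Pi.smul_apply, h1, h2,
    kernelFun_congr (Lp.coeFn_smul Complex.I χ), hK.kernelFun_eq (Lp.memLp χ),
    hK.kernelFun_eq ((Lp.memLp χ).const_smul Complex.I)]
  have e1 : ∀ q, k p q * (Complex.I • (χ : α → ℂ)) q = Complex.I * (k p q * χ q) := fun q => by
    rw [Pi.smul_apply, smul_eq_mul]; ring
  have e2 : ∀ q, l p q * (starRingEnd ℂ) ((Complex.I • (χ : α → ℂ)) q) =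
      -Complex.I * (l p q * (starRingEnd ℂ) (χ q)) := fun q => by
    rw [Pi.smul_apply, smul_eq_mul, map_mul, Complex.conj_I]; ring
  simp only [e1, e2]
  rw [integral_const_mul, integral_const_mul, L2.inner_def]
  have e3 : ∫ q, ⟪χ q, (hK.memLp_right p).toLp _ q⟫_ℂ ∂μ =
      ∫ q, l p q * (starRingEnd ℂ) (χ q) ∂μ := by
    refine integral_congr_ae ?_
    filter_upwards [MemLp.coeFn_toLp (hK.memLp_right p)] with q hq
    rw [hq, RCLike.inner_apply]
  rw [e3, smul_eq_mul, smul_eq_mul]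
  linear_combination (1 / 2 : ℂ) * (∫ q, k p q * χ q ∂μ - ∫ q, l p q * (starRingEnd ℂ) (χ q) ∂μ) *
    Complex.I_mul_I

theorem hsLe_antiPart [SFinite μ] (hK : SchurKernel μ k l κ) {ι : Type*} {b : ι → Lp ℂ 2 μ}
    (hb : Orthonormal ℂ b) {ρ : α → ℝ} (hρ : Integrable ρ μ)
    (h : ∀ p, ‖(hK.memLp_right p).toLp _‖ ^ 2 ≤ ρ p) :
    HSLe b (antiPart hK.toCLM) (Real.sqrt (∫ p, ρ p ∂μ)) := by
  have hρ0 : 0 ≤ ∫ p, ρ p ∂μ := integral_nonneg fun p => (by positivity : (0:ℝ) ≤ _).trans (h p)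
  rw [hsLe_iff (Real.sqrt_nonneg _)]
  intro F
  rw [Real.sq_sqrt hρ0]
  simp only [norm_sq_eq_integral (antiPart hK.toCLM _)]
  rw [← integral_finsetSum _ fun j _ => integrable_sq_norm_coe _]
  refine integral_mono_ae (integrable_finsetSum _ fun j _ => integrable_sq_norm_coe _) hρ ?_
  have hall : ∀ᵐ p ∂μ, ∀ j ∈ F, antiPart hK.toCLM (b j) p =
      ⟪b j, (hK.memLp_right p).toLp _⟫_ℂ :=
    (Filter.eventually_all_finset F).2 fun j _ => hK.coeFn_antiPart (b j)
  filter_upwards [hall] with p hp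
  calc ∑ j ∈ F, ‖antiPart hK.toCLM (b j) p‖ ^ 2
      = ∑ j ∈ F, ‖⟪b j, (hK.memLp_right p).toLp _⟫_ℂ‖ ^ 2 :=
        Finset.sum_congr rfl fun j hj => by rw [hp j hj]
    _ ≤ ‖(hK.memLp_right p).toLp _‖ ^ 2 := hb.sum_inner_products_le _
    _ ≤ ρ p := h p

end SchurKernel

end Kernel

/-! ### The generator on the one-particle space -/

theorem continuous_minusKernel (h : TestFun D) :
    Continuous (Function.uncurry (minusKernel m h)) := by
  have h1 := continuous_mft h
  have h2 := continuous_shell (D := D) (m := m) 1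
  unfold minusKernel Function.uncurry
  fun_prop

theorem continuous_plusKernel (h : TestFun D) :
    Continuous (Function.uncurry (plusKernel m h)) := by
  have h1 := continuous_mft h
  have h2 := continuous_shell (D := D) (m := m) 1
  unfold plusKernel Function.uncurry
  fun_prop

theorem decayWeight_le_one (p : Momentum D) : decayWeight p ≤ 1 :=
  inv_le_one_of_one_le₀ (one_le_pow₀ (by linarith [norm_nonneg p]))

theorem memLp_of_norm_le {u : Momentum D → ℂ} {v : Momentum D → ℝ} {C : ℝ} (hu : Continuous u)
    (hv : Integrable v (shellMeasure D m)) (hv0 : ∀ q, 0 ≤ v q) (hv1 : ∀ q, v q ≤ 1)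
    (h : ∀ q, ‖u q‖ ≤ C * v q) : MemLp u 2 (shellMeasure D m) := by
  refine (memLp_two_iff_integrable_sq_norm hu.aestronglyMeasurable).2 ?_
  refine (hv.const_mul (C ^ 2)).mono' (hu.norm.pow 2).aestronglyMeasurable
    (Filter.Eventually.of_forall fun q => ?_)
  rw [Real.norm_of_nonneg (by positivity)]
  calc ‖u q‖ ^ 2 ≤ (C * v q) ^ 2 := by gcongr; exact h q
    _ = C ^ 2 * (v q * v q) := by ring
    _ ≤ C ^ 2 * (v q * 1) := by gcongr; exacts [hv0 q, hv1 q]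
    _ = _ := by ring

/-- Both kernels are dominated by translates of one integrable weight. The dominating function is
symmetric in `p` and `q`, so rows and columns obey the same bound. -/
theorem schurKernel (hm : 0 < m) (h : TestFun D) :
    ∃ κ, SchurKernel (shellMeasure D m) (minusKernel m h) (plusKernel m h) κ := by
  obtain ⟨C, hC, h1, h2, -⟩ := exists_kernel_bound (m := m) h 0
  simp only [pow_zero, one_mul] at h1 h2
  have hJ := decayMass_nonneg (D := D) hm
  have hrow : ∀ p : Momentum D, ∫⁻ q, ENNReal.ofReal (C * (decayWeight (p - q) +
      decayWeight (p + q))) ∂(shellMeasure D m) ≤ ENNReal.ofReal (2 * C * decayMass D m) :=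
    fun p => by
    have i := (integrable_decayWeight_sub hm p).add (integrable_decayWeight_add hm p)
    have i' : Integrable (fun q => C * (decayWeight (p - q) + decayWeight (p + q)))
      (shellMeasure D m) := i.const_mul C
    rw [← ofReal_integral_eq_lintegral_ofReal i' (Filter.Eventually.of_forall fun q =>
      mul_nonneg hC (add_pos (decayWeight_pos _) (decayWeight_pos _)).le)]
    refine ENNReal.ofReal_le_ofReal ?_
    rw [integral_const_mul, integral_add (integrable_decayWeight_sub hm p)
      (integrable_decayWeight_add hm p)]
    have k1 := integral_decayWeight_sub_le hm p
    have k2 := integral_decayWeight_add_le hm p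
    nlinarith
  have hb : ∀ p q : Momentum D, ‖minusKernel m h p q‖ₑ + ‖plusKernel m h p q‖ₑ ≤
      ENNReal.ofReal (C * (decayWeight (p - q) + decayWeight (p + q))) := fun p q => by
    rw [← ofReal_norm, ← ofReal_norm, ← ENNReal.ofReal_add (norm_nonneg _) (norm_nonneg _), mul_add]
    exact ENNReal.ofReal_le_ofReal (add_le_add (h1 p q) (h2 p q))
  have h3 := continuous_mft h
  have h4 := continuous_shell (D := D) (m := m) 1
  have hcminus : ∀ p, Continuous (minusKernel m h p) := fun p => by
    change Continuous fun q => -Complex.I * mft h (shell m 1 p - shell m 1 q)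
    fun_prop
  have hcplus : ∀ p, Continuous (plusKernel m h p) := fun p => by
    change Continuous fun q => Complex.I * mft h (shell m 1 p + shell m 1 q)
    fun_prop
  refine ⟨2 * C * decayMass D m, (continuous_minusKernel h).stronglyMeasurable,
    (continuous_plusKernel h).stronglyMeasurable, fun p => ?_, fun p => ?_, by positivity,
    fun p => ?_, fun q => ?_⟩
  · exact memLp_of_norm_le (v := fun q => decayWeight (p - q)) (hcminus p)
      (integrable_decayWeight_sub hm p) (fun q => (decayWeight_pos _).le)
      (fun q => decayWeight_le_one _) (h1 p)
  · exact memLp_of_norm_le (v := fun q => decayWeight (p + q)) (hcplus p)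
      (integrable_decayWeight_add hm p) (fun q => (decayWeight_pos _).le)
      (fun q => decayWeight_le_one _) (h2 p)
  · exact (lintegral_mono fun q => hb p q).trans (hrow p)
  · refine (lintegral_mono fun p => (hb p q).trans (le_of_eq ?_)).trans (hrow q)
    rw [← decayWeight_neg (p - q), neg_sub, add_comm p q]

theorem exists_hsLe (hm : 0 < m) (h : TestFun D) {κ : ℝ}
    (hK : SchurKernel (shellMeasure D m) (minusKernel m h) (plusKernel m h) κ) {ι : Type*}
    {b : ι → OneParticle D m} (hb : Orthonormal ℂ b) :
    ∃ β, 0 ≤ β ∧ HSLe b (antiPart hK.toCLM) β := by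
  obtain ⟨C, hC, -, -, h3⟩ := exists_kernel_bound (m := m) h 0
  have hw := integrable_shell_of_volume hm (integrable_decayWeight (D := D))
  set W := ∫ q : Momentum D, decayWeight q ∂(shellMeasure D m) with hW
  have hW0 : 0 ≤ W := integral_nonneg fun q => (decayWeight_pos q).le
  refine ⟨_, Real.sqrt_nonneg _, hK.hsLe_antiPart hb (hw.const_mul (C ^ 2 * W)) fun p => ?_⟩
  rw [norm_sq_eq_integral]
  have e : ∫ q, ‖(hK.memLp_right p).toLp _ q‖ ^ 2 ∂(shellMeasure D m) =
      ∫ q, ‖plusKernel m h p q‖ ^ 2 ∂(shellMeasure D m) := by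
    refine integral_congr_ae ?_
    filter_upwards [MemLp.coeFn_toLp (hK.memLp_right p)] with q hq
    rw [hq]
  rw [e]
  calc ∫ q, ‖plusKernel m h p q‖ ^ 2 ∂(shellMeasure D m)
      ≤ ∫ q, C ^ 2 * decayWeight p * decayWeight q ∂(shellMeasure D m) := by
        refine integral_mono_of_nonneg (Filter.Eventually.of_forall fun q => by positivity)
          (hw.const_mul _) (Filter.Eventually.of_forall fun q => ?_)
        have hp := (decayWeight_pos p).le
        have hq := (decayWeight_pos q).le
        calc ‖plusKernel m h p q‖ ^ 2 ≤ (C * (decayWeight p * decayWeight q)) ^ 2 := by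
              gcongr; exact h3 p q
          _ = C ^ 2 * ((decayWeight p * decayWeight p) * (decayWeight q * decayWeight q)) := by ring
          _ ≤ C ^ 2 * ((decayWeight p * 1) * (decayWeight q * 1)) := by
              gcongr <;> exact decayWeight_le_one _
          _ = _ := by ring
    _ = _ := by rw [integral_const_mul, ← hW]; ring

/-! ### The one-particle vectors of test functions -/

theorem coeFn_onShell (hm : 0 < m) (f : TestFun D) :
    onShell hm f =ᵐ[shellMeasure D m] fun p => mft f (shell m 1 p) :=
  MemLp.coeFn_toLp (memLp_mft_shell hm 1 f)

theorem mft_add (f g : TestFun D) (k : Spacetime D) : mft (f + g) k = mft f k + mft g k := by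
  have h : toComplex (f + g) = toComplex f + toComplex g := map_add _ _ _
  rw [mft_eq_fourier, mft_eq_fourier, mft_eq_fourier, h, FourierTransform.fourier_add]
  rfl

theorem mft_smul (c : ℝ) (f : TestFun D) (k : Spacetime D) : mft (c • f) k = c * mft f k := by
  rw [mft, mft, ← integral_const_mul]
  congr 1; ext x
  rw [smul_apply, smul_eq_mul]
  push_cast
  ring

theorem onShell_add (hm : 0 < m) (f g : TestFun D) :
    onShell hm (f + g) = onShell hm f + onShell hm g := by
  refine Lp.ext ?_
  filter_upwards [coeFn_onShell hm (f + g), coeFn_onShell hm f, coeFn_onShell hm g,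
    Lp.coeFn_add (onShell hm f) (onShell hm g)] with p h1 h2 h3 h4
  rw [h1, h4, Pi.add_apply, h2, h3, mft_add]

theorem onShell_smul (hm : 0 < m) (c : ℝ) (f : TestFun D) :
    onShell hm (c • f) = (c : ℂ) • onShell hm f := by
  refine Lp.ext ?_
  filter_upwards [coeFn_onShell hm (c • f), coeFn_onShell hm f,
    Lp.coeFn_smul (c : ℂ) (onShell hm f)] with p h1 h2 h3
  rw [h1, h3, Pi.smul_apply, h2, mft_smul, smul_eq_mul]

theorem onShell_sum (hm : 0 < m) {ι : Type*} (s : Finset ι) (f : ι → TestFun D) :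
    onShell hm (∑ i ∈ s, f i) = ∑ i ∈ s, onShell hm (f i) := by
  classical
  induction s using Finset.induction_on with
  | empty => simpa using onShell_smul hm 0 (0 : TestFun D)
  | insert a s ha ih => rw [Finset.sum_insert ha, Finset.sum_insert ha, onShell_add, ih]

theorem continuous_mft_left (k : Spacetime D) : Continuous fun f : TestFun D => mft f k := by
  simp only [mft_eq_fourier]
  have h1 : Continuous fun f : TestFun D => toComplex f :=
    (SchwartzMap.postcompCLM (𝕜 := ℝ) Complex.ofRealCLM).continuous
  have h2 : Continuous fun f : 𝓢(Spacetime D, ℂ) => 𝓕 f :=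
    (FourierTransform.fourierCLM ℂ 𝓢(Spacetime D, ℂ)).continuous
  have h3 : Continuous fun f : 𝓢(Spacetime D, ℂ) => f ((2 * Real.pi)⁻¹ • timeReflect k) :=
    (BoundedContinuousFunction.evalCLM ℝ ((2 * Real.pi)⁻¹ • timeReflect k)).continuous.comp
      (SchwartzMap.toBoundedContinuousFunctionCLM ℝ (Spacetime D) ℂ).continuous
  exact h3.comp (h2.comp h1)

/-- Limits in the Schwartz space and in the one-particle space agree. -/
theorem onShell_eq_of_tendsto (hm : 0 < m) {u : ℕ → TestFun D} {f : TestFun D}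
    {χ : OneParticle D m} (hu : Filter.Tendsto u Filter.atTop (nhds f))
    (hχ : Filter.Tendsto (fun n => onShell hm (u n)) Filter.atTop (nhds χ)) :
    onShell hm f = χ := by
  -- Convergence in `L²` gives convergence almost everywhere along a subsequence, and Schwartz
  -- convergence gives it at every momentum. The two limits must agree.
  obtain ⟨ns, hns, hae⟩ := (tendstoInMeasure_of_tendsto_Lp hχ).exists_seq_tendsto_ae
  refine Lp.ext ?_
  filter_upwards [hae, coeFn_onShell hm f,
    ae_all_iff.2 fun n => coeFn_onShell hm (u n)] with p h1 h2 h3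
  rw [h2]
  simp only [h3] at h1
  exact tendsto_nhds_unique (((continuous_mft_left (shell m 1 p)).tendsto f).comp
    (hu.comp hns.tendsto_atTop)) h1

theorem onShell_squeezeGen (hm : 0 < m) {h : TestFun D} {κ : ℝ}
    (hK : SchurKernel (shellMeasure D m) (minusKernel m h) (plusKernel m h) κ) (f : TestFun D) :
    onShell hm (squeezeGen m h f) = hK.toCLM (onShell hm f) := by
  refine Lp.ext ?_
  filter_upwards [coeFn_onShell hm (squeezeGen m h f), hK.coeFn_toCLM (onShell hm f)] with p h1 h2
  rw [h1, h2, kernelFun_congr (coeFn_onShell hm f), mft_squeezeGen hm]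
  rfl

theorem onShell_iterate (hm : 0 < m) {h : TestFun D} {κ : ℝ}
    (hK : SchurKernel (shellMeasure D m) (minusKernel m h) (plusKernel m h) κ) (f : TestFun D)
    (n : ℕ) : onShell hm ((squeezeGen m h)^[n] f) = hK.toCLM^[n] (onShell hm f) := by
  induction n with
  | zero => rfl
  | succ n ih =>
    rw [Function.iterate_succ_apply', onShell_squeezeGen hm hK, ih, Function.iterate_succ_apply']

/-- On one-particle vectors `T_h` acts by the exponential of a bounded operator. -/
theorem onShell_squeeze (hm : 0 < m) {h : TestFun D} {κ : ℝ}
    (hK : SchurKernel (shellMeasure D m) (minusKernel m h) (plusKernel m h) κ) (f : TestFun D) :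
    onShell hm (squeeze m h f) = expOperator hK.toCLM (onShell hm f) := by
  refine onShell_eq_of_tendsto hm (summable_squeezeTerm hm h f).hasSum.tendsto_sum_nat
    ((hasSum_expOperator hK.toCLM (onShell hm f)).tendsto_sum_nat.congr fun n => ?_)
  rw [onShell_sum]
  refine Finset.sum_congr rfl fun i _ => ?_
  rw [squeezeTerm, onShell_smul, onShell_iterate hm hK]

theorem inner_onShell (hm : 0 < m) (f g : TestFun D) :
    ⟪onShell hm f, onShell hm g⟫_ℂ = twoPoint m f g := by
  rw [L2.inner_def, twoPoint]
  refine integral_congr_ae ?_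
  filter_upwards [coeFn_onShell hm f, coeFn_onShell hm g] with p h1 h2
  rw [h1, h2, RCLike.inner_apply, conj_mft, neg_shell, mul_comm]

/-- The product formula at momentum `0`: the upper shell yields `ω₂(f, g)`, the lower shell its
conjugate, and `-i` times their difference is `2 Im ω₂(f, g)`. -/
theorem integral_mul_pauliJordanConv (hm : 0 < m) (f g : TestFun D) :
    ∫ x, (f x : ℂ) * pauliJordanConv m g x = ((2 * (twoPoint m f g).im : ℝ) : ℂ) := by
  obtain ⟨i1, j1, e1⟩ := integral_mul_shellWave hm 1 f g 0
  obtain ⟨i2, j2, e2⟩ := integral_mul_shellWave hm (-1) f g 0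
  have hz : ∀ x : Spacetime D, Complex.exp (-(Complex.I * (mink (0 : Spacetime D) x : ℂ))) = 1 :=
    fun x => by simp [mink]
  simp only [hz, mul_one, zero_sub] at j1 e1 j2 e2
  have e3 : ∫ p, mft g (shell m 1 p) * mft f (-shell m 1 p) ∂(shellMeasure D m) =
      twoPoint m f g := by
    rw [twoPoint]
    congr 1; ext p
    rw [neg_shell, mul_comm]
  have e4 : ∫ p, mft g (shell m (-1) p) * mft f (-shell m (-1) p) ∂(shellMeasure D m) =
      (starRingEnd ℂ) (twoPoint m f g) := by
    rw [twoPoint, ← integral_conj, ← integral_neg_eq_self (μ := shellMeasure D m)]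
    congr 1; ext p
    rw [map_mul, conj_mft, conj_mft, neg_shell, neg_shell, mul_comm]
  have e5 : ∀ x, (f x : ℂ) * pauliJordanConv m g x = -Complex.I *
      ((f x : ℂ) * shellWave m 1 g x - (f x : ℂ) * shellWave m (-1) g x) := fun x => by
    rw [pauliJordanConv_eq hm, shellWave, shellWave]; ring
  simp only [e5]
  rw [integral_const_mul, integral_sub j1 j2, e1, e2, e3, e4]
  apply Complex.ext
  · simp; ring
  · simp

/-- Both sides equal `∫ h (Δ ∗ f)(Δ ∗ g)`. This symmetry of multiplication by `h` is what makes the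
generator infinitesimally symplectic. -/
theorem commutatorFun_squeezeGen (hm : 0 < m) (h f g : TestFun D) :
    commutatorFun m (squeezeGen m h f) g = commutatorFun m (squeezeGen m h g) f := by
  have h1 := integral_mul_pauliJordanConv hm (squeezeGen m h f) g
  have h2 := integral_mul_pauliJordanConv hm (squeezeGen m h g) f
  simp only [squeezeGen_apply hm] at h1 h2
  have h3 : ∫ x, (h x : ℂ) * pauliJordanConv m f x * pauliJordanConv m g x =
      ∫ x, (h x : ℂ) * pauliJordanConv m g x * pauliJordanConv m f x := by
    congr 1; ext x; ring
  rw [h1, h2] at h3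
  exact_mod_cast h3

theorem im_inner_squeezeGen (hm : 0 < m) (h f g : TestFun D) :
    (⟪onShell hm (squeezeGen m h f), onShell hm g⟫_ℂ).im =
      -(⟪onShell hm f, onShell hm (squeezeGen m h g)⟫_ℂ).im := by
  have h1 := commutatorFun_squeezeGen hm h f g
  rw [commutatorFun, commutatorFun, ← inner_onShell hm, ← inner_onShell hm,
    ← inner_conj_symm (onShell hm (squeezeGen m h g)), Complex.conj_im] at h1
  linarith

/-! ### Density of the one-particle vectors of test functions -/

theorem integral_exp_mink (g : 𝓢(Spacetime D, ℂ)) (k : Spacetime D) :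
    ∫ x, g x * Complex.exp (-(Complex.I * (mink k x : ℂ))) =
      (𝓕 g) ((2 * Real.pi)⁻¹ • timeReflect k) := by
  rw [SchwartzMap.fourier_coe, Real.fourier_eq']
  congr 1
  ext x
  rw [inner_smul_right, inner_timeReflect, smul_eq_mul, mul_comm]
  congr 1
  congr 1
  push_cast
  field_simp

theorem integrable_exp_mink (g : 𝓢(Spacetime D, ℂ)) (k : Spacetime D) :
    Integrable fun x => g x * Complex.exp (-(Complex.I * (mink k x : ℂ))) := by
  refine g.integrable.mul_bdd (c := 1) ?_ (Filter.Eventually.of_forall fun x => ?_)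
  · refine Continuous.aestronglyMeasurable ?_
    unfold mink
    fun_prop
  · rw [← mul_neg, ← Complex.ofReal_neg, mul_comm, Complex.norm_exp_ofReal_mul_I]

/-- Twice the real part of a complex Schwartz function. -/
theorem exists_testFun_of_schwartz (Φ : 𝓢(Spacetime D, ℂ)) : ∃ f : TestFun D, ∀ k, mft f k =
    Φ ((2 * Real.pi)⁻¹ • timeReflect k) +
      (starRingEnd ℂ) (Φ ((2 * Real.pi)⁻¹ • timeReflect (-k))) := by
  set g : 𝓢(Spacetime D, ℂ) := 𝓕⁻ Φ with hg
  have hΦ : 𝓕 g = Φ := FourierTransform.fourier_fourierInv_eq Φ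
  refine ⟨(2 : ℝ) • SchwartzMap.postcompCLM (𝕜 := ℝ) Complex.reCLM g, fun k => ?_⟩
  rw [mft, ← hΦ, ← integral_exp_mink, ← integral_exp_mink, ← integral_conj, ← integral_add
    (integrable_exp_mink g k)]
  · congr 1; ext x
    have e1 : mink (-k) x = -mink k x := by
      have := mink_sub_left 0 k x
      rw [zero_sub] at this
      rw [this]; simp [mink]
    rw [smul_apply, SchwartzMap.postcompCLM_apply, map_mul, ← Complex.exp_conj, e1]
    simp only [map_mul, Complex.conj_I, Complex.conj_ofReal, Complex.ofReal_neg, neg_mul,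
      mul_neg, neg_neg, smul_eq_mul, Complex.reCLM_apply]
    rw [← add_mul, Complex.add_conj]
  · exact Complex.conjCLE.toContinuousLinearMap.integrable_comp (integrable_exp_mink g (-k))

/-- A real test function has conjugate values on the two shells, so `v` is first extended to
spacetime momenta with a cutoff in the energy. The cutoff is `1` at the energies in the support of
`v` and `0` at negative energies, so that adding the reflected conjugate does not alter the upper
shell. -/
theorem exists_testFun_of_smooth (hm : 0 < m) {v : Momentum D → ℂ} (hc : HasCompactSupport v)
    (hv : ContDiff ℝ ∞ v) : ∃ f : TestFun D, ∀ p, mft f (shell m 1 p) = v p := by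
  obtain ⟨E₀, hE₀⟩ := hc.isCompact.bddAbove_image (continuous_energy (D := D) (m := m)).continuousOn
  set E := max E₀ m with hE
  have hmE : m ≤ E := le_max_right _ _
  have hEv : ∀ p, v p ≠ 0 → energy m p ≤ E := fun p hp =>
    (hE₀ ⟨p, subset_tsupport v hp, rfl⟩).trans (le_max_left _ _)
  -- The bump around `E` is `1` down to energy `m / 2` and vanishes below `m / 4`. Since `E ≥ m`,
  -- both radii are positive.
  let ρ : ContDiffBump E := ⟨E - m / 2, E - m / 4, by linarith, by linarith⟩
  have hρ1 : ∀ x, m ≤ x → x ≤ E → ρ x = 1 := fun x h1 h2 => by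
    refine ρ.one_of_mem_closedBall ?_
    rw [Metric.mem_closedBall, Real.dist_eq, abs_of_nonpos (by linarith)]
    change -(x - E) ≤ E - m / 2
    linarith
  have hρ0 : ∀ x, x ≤ 0 → ρ x = 0 := fun x h1 => by
    refine ρ.zero_of_le_dist ?_
    rw [Real.dist_eq, abs_of_nonpos (by linarith)]
    change E - m / 4 ≤ -(x - E)
    linarith
  have hρ2 : ∀ x, ρ x ≠ 0 → |x| ≤ 2 * E := fun x hx => by
    have h1 : ¬ρ.rOut ≤ dist x E := fun h => hx (ρ.zero_of_le_dist h)
    rw [not_le, Real.dist_eq, abs_lt] at h1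
    change -(E - m / 4) < x - E ∧ x - E < E - m / 4 at h1
    rw [abs_le]
    constructor <;> linarith
  -- `T` and `X` undo the time reflection and the factor `(2π)⁻¹` that relate `mft` to the standard
  -- Fourier transform.
  let T : Spacetime D → ℝ := fun y => -(2 * Real.pi) * y 0
  let X : Spacetime D → Momentum D := fun y => WithLp.toLp 2 fun i => (2 * Real.pi) * y i.succ
  have hT : ContDiff ℝ ∞ T := by
    simp only [T]; fun_prop
  have hX : ContDiff ℝ ∞ X := by
    simp only [X]
    refine contDiff_euclidean.2 fun i => ?_
    simp only
    fun_prop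
  let Φ : Spacetime D → ℂ := fun y => (ρ (T y) : ℂ) * v (X y)
  have hΦ : ContDiff ℝ ∞ Φ :=
    (Complex.ofRealCLM.contDiff.comp (ρ.contDiff.comp hT)).mul (hv.comp hX)
  have hcpt : HasCompactSupport Φ := by
    obtain ⟨r, hr⟩ := hc.isCompact.isBounded.exists_norm_le
    refine HasCompactSupport.of_support_subset_isCompact
      (isCompact_closedBall (0 : Spacetime D) (2 * E + r)) fun y hy => ?_
    have h1 : ρ (T y) ≠ 0 := fun h => hy (by simp [Φ, h])
    have h2 : v (X y) ≠ 0 := fun h => hy (by simp [Φ, h])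
    have h3 := hρ2 _ h1
    have h4 := hr _ (subset_tsupport v h2)
    have h5 : (2 * Real.pi) ^ 2 * ‖y‖ ^ 2 = T y ^ 2 + ‖X y‖ ^ 2 := by
      rw [EuclideanSpace.norm_sq_eq, EuclideanSpace.norm_sq_eq, Fin.sum_univ_succ, mul_add,
        Finset.mul_sum]
      simp only [T, X, Real.norm_eq_abs, sq_abs, mul_pow, neg_sq]
    have hpi := Real.pi_gt_three
    have h6 : ‖y‖ ^ 2 ≤ (2 * E + r) ^ 2 := by
      have h7 : T y ^ 2 ≤ (2 * E) ^ 2 := sq_le_sq' (abs_le.1 h3).1 (abs_le.1 h3).2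
      have h8 : ‖X y‖ ^ 2 ≤ r ^ 2 := by gcongr
      have h9 : 0 ≤ r := (norm_nonneg _).trans h4
      have h10 : 1 * ‖y‖ ^ 2 ≤ (2 * Real.pi) ^ 2 * ‖y‖ ^ 2 := by
        gcongr; nlinarith
      nlinarith [mul_nonneg (hm.le.trans hmE) h9]
    rw [mem_closedBall_zero_iff]
    exact le_of_sq_le_sq h6 (by have := (norm_nonneg _).trans h4; linarith)
  obtain ⟨f, hf⟩ := exists_testFun_of_schwartz (hcpt.toSchwartzMap hΦ)
  have hpi : (2 * Real.pi) ≠ 0 := by have := Real.pi_pos; positivity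
  have hTs : ∀ p : Momentum D, T ((2 * Real.pi)⁻¹ • timeReflect (shell m 1 p)) = energy m p :=
    fun p => by simp [T, timeReflect, shell]; field_simp
  have hTn : ∀ p : Momentum D, T ((2 * Real.pi)⁻¹ • timeReflect (-shell m 1 p)) = -energy m p :=
    fun p => by simp [T, timeReflect, shell]; field_simp
  have hXs : ∀ p : Momentum D, X ((2 * Real.pi)⁻¹ • timeReflect (shell m 1 p)) = p :=
    fun p => by ext i; simp [X, timeReflect, shell]; field_simp
  refine ⟨f, fun p => ?_⟩
  have hpos : 0 ≤ energy m p := Real.sqrt_nonneg _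
  rw [hf]
  change (ρ (T _) : ℂ) * v (X _) + (starRingEnd ℂ) ((ρ (T _) : ℂ) * v (X _)) = v p
  rw [hTs, hTn, hXs, hρ0 _ (neg_nonpos.2 hpos)]
  by_cases hp : v p = 0
  · simp [hp]
  · rw [hρ1 _ (le_energy p) (hEv p hp)]; simp

theorem denseRange_onShell (hm : 0 < m) :
    DenseRange (onShell hm : TestFun D → OneParticle D m) := by
  have : IsFiniteMeasureOnCompacts (shellMeasure D m) := ⟨fun K hK => by
    refine (shellMeasure_le hm K).trans_lt ?_
    rw [Measure.smul_apply, smul_eq_mul]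
    exact ENNReal.mul_lt_top ENNReal.ofReal_lt_top hK.measure_lt_top⟩
  refine (Lp.dense_hasCompactSupport_contDiff (F := ℂ) (μ := shellMeasure D m)
    (p := 2) (by simp)).mono ?_
  rintro χ ⟨v, hχ, hc, hv⟩
  obtain ⟨f, hf⟩ := exists_testFun_of_smooth hm hc hv
  refine ⟨f, Lp.ext ?_⟩
  filter_upwards [hχ, coeFn_onShell hm f] with p h1 h2
  rw [h1, h2, hf]

theorem im_inner_toCLM (hm : 0 < m) {h : TestFun D} {κ : ℝ}
    (hK : SchurKernel (shellMeasure D m) (minusKernel m h) (plusKernel m h) κ)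
    (x y : OneParticle D m) : (⟪hK.toCLM x, y⟫_ℂ).im = -(⟪x, hK.toCLM y⟫_ℂ).im := by
  have hc := hK.toCLM.continuous
  have hcl : IsClosed {z : OneParticle D m × OneParticle D m |
      (⟪hK.toCLM z.1, z.2⟫_ℂ).im = -(⟪z.1, hK.toCLM z.2⟫_ℂ).im} :=
    isClosed_eq (Complex.continuous_im.comp ((hc.comp continuous_fst).inner continuous_snd))
      (Complex.continuous_im.comp (continuous_fst.inner (hc.comp continuous_snd))).neg
  refine (denseRange_onShell hm).induction_on₂ hcl (fun f g => ?_) x y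
  rw [← onShell_squeezeGen hm hK, ← onShell_squeezeGen hm hK]
  exact im_inner_squeezeGen hm h f g

/-- The action of `T_h` on one-particle vectors is implemented by a unitary on Fock space. -/
theorem exists_unitary_squeeze (hm : 0 < m) (h : TestFun D) :
    ∃ (T : RealOperator (OneParticle D m)) (V : Fock D m →L[ℂ] Fock D m),
      (∀ f, onShell hm (squeeze m h f) = T (onShell hm f)) ∧
      (DenseRange fun f : TestFun D => T (onShell hm f)) ∧
      (∀ x y, (⟪T x, T y⟫_ℂ).im = (⟪x, y⟫_ℂ).im) ∧
      V ∈ unitary (Fock D m →L[ℂ] Fock D m) ∧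
      ∀ u, V * (fockStructure D m).weylOp u = (fockStructure D m).weylOp (T u) * V := by
  obtain ⟨κ, hK⟩ := schurKernel hm h
  obtain ⟨w, b, -⟩ := exists_hilbertBasis ℂ (OneParticle D m)
  obtain ⟨β, hβ, hB⟩ := exists_hsLe hm h hK b.orthonormal
  obtain ⟨V, hV, hVW⟩ := (fockStructure D m).implementable_expOperator b (im_inner_toCLM hm hK)
    hβ hB
  exact ⟨expOperator hK.toCLM, V, onShell_squeeze hm hK,
    denseRange_comp_expOperator _ (denseRange_onShell hm), im_inner_expOperator
    (im_inner_toCLM hm hK), hV, hVW⟩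

namespace FockStructure

variable {𝔥 : Type*} [NormedAddCommGroup 𝔥] [InnerProductSpace ℂ 𝔥]
variable {H : ℕ → Type*} [∀ n, NormedAddCommGroup (H n)] [∀ n, InnerProductSpace ℂ (H n)]
variable [∀ n, CompleteSpace (H n)] (S : FockStructure 𝔥 H)
variable {ι : Type*} {r : ι → 𝔥}

/-! ### The algebra generated by a dense set of Weyl operators -/

theorem eq_smul_one_of_commute_dense (hr : DenseRange r) {C : lp H 2 →L[ℂ] lp H 2}
    (hC : ∀ a, C * S.weylOp (r a) = S.weylOp (r a) * C) : ∃ z : ℂ, C = z • 1 := by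
  refine S.eq_smul_one_of_commute fun φ => ContinuousLinearMap.ext fun ψ => ?_
  refine hr.induction_on (p := fun φ => (C * S.weylOp φ) ψ = (S.weylOp φ * C) ψ) φ
    (isClosed_eq (C.continuous.comp (S.continuous_weylOp ψ)) (S.continuous_weylOp (C ψ)))
    fun a => by rw [hC]

/-- The commutant consists of scalars, and every operator commutes with scalars. -/
theorem doubleCommutant_weylOp (hr : DenseRange r) :
    doubleCommutant (Set.range fun a => S.weylOp (r a)) = ⊤ := by
  rw [eq_top_iff]
  intro x _
  rw [doubleCommutant, StarSubalgebra.mem_centralizer_iff]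
  intro C hC
  rw [SetLike.mem_coe, StarSubalgebra.mem_centralizer_iff] at hC
  obtain ⟨z, rfl⟩ := S.eq_smul_one_of_commute_dense hr fun a => ((hC _ ⟨a, rfl⟩).1).symm
  simp

theorem inner_coh_zero_self : ⟪S.coh 0, S.coh 0⟫_ℂ = 1 := by
  have h := S.inner_coh_zero_weylOp 0
  rw [weylOp_zero, one_apply_eq_self] at h
  simpa using h

/-- A vector with the vacuum expectation values of the Weyl operators is a multiple of the
vacuum. -/
theorem eq_smul_coh_zero {ψ : lp H 2}
    (h : ∀ φ, ⟪ψ, S.weylOp φ ψ⟫_ℂ = ⟪S.coh 0, S.weylOp φ (S.coh 0)⟫_ℂ) :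
    ∃ z : ℂ, ψ = z • S.coh 0 := by
  have hgram : ∀ u v, ⟪S.weylOp u ψ, S.weylOp v ψ⟫_ℂ =
      ⟪S.weylOp u (S.coh 0), S.weylOp v (S.coh 0)⟫_ℂ := by
    intro u v
    rw [inner_weylOp_left, inner_weylOp_left, ← mul_apply_eq_comp, ← mul_apply_eq_comp,
      weylOp_mul, smul_apply, smul_apply, inner_smul_right, inner_smul_right, h]
  obtain ⟨V, hV, -⟩ := exists_isometry_of_gram S.total_weylOp_coh_zero hgram
  obtain ⟨z, rfl⟩ := S.eq_smul_one_of_commute (C := V) fun u => by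
    refine S.total_weylOp_coh_zero.clm_ext ?_
    rintro _ ⟨v, rfl⟩
    simp only
    rw [mul_apply_eq_comp, mul_apply_eq_comp, hV, ← mul_apply_eq_comp (S.weylOp u),
      ← mul_apply_eq_comp (S.weylOp u), weylOp_mul, smul_apply, smul_apply, map_smul, hV]
  refine ⟨z, ?_⟩
  have := hV 0
  rw [weylOp_zero, one_apply_eq_self, one_apply_eq_self, smul_apply, one_apply_eq_self] at this
  exact this.symm

theorem total_weylOp_coh_zero_dense (hr : DenseRange r) :
    Total (Set.range fun a => S.weylOp (r a) (S.coh 0)) := by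
  intro y hy
  refine S.total_weylOp_coh_zero y ?_
  rintro _ ⟨φ, rfl⟩
  exact hr.induction_on (p := fun φ => ⟪S.weylOp φ (S.coh 0), y⟫_ℂ = 0) φ
    (isClosed_eq ((S.continuous_weylOp _).inner continuous_const) continuous_const)
    fun a => hy _ ⟨a, rfl⟩

theorem inner_coh_zero_weylOp_mul (x y : 𝔥) :
    ⟪S.coh 0, (S.weylOp x * S.weylOp y) (S.coh 0)⟫_ℂ =
      Complex.exp (-((‖x‖ ^ 2 / 2 + ‖y‖ ^ 2 / 2 : ℝ) + ⟪x, y⟫_ℂ)) := by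
  rw [weylOp_mul, smul_apply, inner_smul_right, inner_coh_zero_weylOp, ← Complex.exp_add,
    norm_add_sq (𝕜 := ℂ)]
  congr 1
  conv_rhs => rw [← Complex.re_add_im ⟪x, y⟫_ℂ]
  push_cast
  simp only [RCLike.re_to_complex]
  ring

theorem inner_coh_zero_weylOp_smul_mul (x y : 𝔥) (s t : ℝ) :
    ⟪S.coh 0, (S.weylOp ((s : ℂ) • x) * S.weylOp ((t : ℂ) • y)) (S.coh 0)⟫_ℂ =
      Complex.exp (-((s ^ 2 * (‖x‖ ^ 2 / 2) + t ^ 2 * (‖y‖ ^ 2 / 2) : ℝ) + s * t * ⟪x, y⟫_ℂ)) := by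
  rw [inner_coh_zero_weylOp_mul, inner_smul_left, inner_smul_right, norm_smul, norm_smul,
    Complex.conj_ofReal, Complex.norm_real, Complex.norm_real, mul_pow, mul_pow,
    Real.norm_eq_abs, Real.norm_eq_abs, sq_abs, sq_abs]
  congr 1
  push_cast
  ring

/-- A `*`-automorphism of all bounded operators that fixes a dense set of Weyl operators is
trivial. No continuity is assumed. -/
theorem starAlgEquiv_apply_eq_self (hr : DenseRange r)
    (γ : (lp H 2 →L[ℂ] lp H 2) ≃⋆ₐ[ℂ] (lp H 2 →L[ℂ] lp H 2))
    (hγ : ∀ a, γ (S.weylOp (r a)) = S.weylOp (r a)) (A : lp H 2 →L[ℂ] lp H 2) : γ A = A := by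
  have hγstar : ∀ B, γ (star B) = star (γ B) := γ.map_star'
  have hγsmul : ∀ (w : ℂ) B, γ (w • B) = w • γ B := γ.map_smul'
  set Ω := S.coh 0 with hΩ
  have hΩ1 : ⟪Ω, Ω⟫_ℂ = 1 := S.inner_coh_zero_self
  set P : lp H 2 →L[ℂ] lp H 2 := InnerProductSpace.rankOne ℂ Ω Ω with hP
  have hPx : ∀ x, P x = ⟪Ω, x⟫_ℂ • Ω := fun x => rfl
  have hPstar : star P = P := by
    rw [ContinuousLinearMap.star_eq_adjoint, hP, InnerProductSpace.adjoint_rankOne]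
  have hPAP : ∀ A : lp H 2 →L[ℂ] lp H 2, P * A * P = ⟪Ω, A Ω⟫_ℂ • P := fun A => by
    ext1 x
    rw [mul_apply_eq_comp, mul_apply_eq_comp, smul_apply, hPx x, map_smul, map_smul, hPx,
      smul_comm]
  -- The relation `P A P = ⟪Ω, A Ω⟫ P` for the vacuum projection is purely algebraic, so `γ`
  -- transports it to `Q` without any continuity.
  set Q := γ P with hQ
  have hQstar : star Q = Q := by rw [hQ, ← hγstar, hPstar]
  have hQin : ∀ x y, ⟪Q x, y⟫_ℂ = ⟪x, Q y⟫_ℂ := fun x y => by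
    rw [← ContinuousLinearMap.adjoint_inner_right, ← ContinuousLinearMap.star_eq_adjoint, hQstar]
  have hQAQ : ∀ A : lp H 2 →L[ℂ] lp H 2, Q * γ A * Q = ⟪Ω, A Ω⟫_ℂ • Q := fun A => by
    rw [hQ, ← map_mul, ← map_mul, hPAP, hγsmul]
  have hQQ : Q * Q = Q := by
    have := hQAQ 1
    rwa [map_one, mul_one, one_apply_eq_self, hΩ1, one_smul] at this
  -- The only continuity used is the strong continuity of `φ ↦ W(φ)`, which extends the relation
  -- from the dense labels to all `φ`.
  have hQW : ∀ φ x, Q (S.weylOp φ (Q x)) = ⟪Ω, S.weylOp φ Ω⟫_ℂ • Q x := by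
    intro φ x
    refine hr.induction_on (p := fun φ => Q (S.weylOp φ (Q x)) = ⟪Ω, S.weylOp φ Ω⟫_ℂ • Q x) φ
      (isClosed_eq (Q.continuous.comp (S.continuous_weylOp _))
        ((continuous_const.inner (S.continuous_weylOp Ω)).fun_smul continuous_const)) fun a => ?_
    have := congrArg (fun B : lp H 2 →L[ℂ] lp H 2 => B x) (hQAQ (S.weylOp (r a)))
    simpa only [hγ, mul_apply_eq_comp, smul_apply] using this
  have hQ0 : Q ≠ 0 := by
    intro h0
    have h1 : P = 0 := EquivLike.injective γ (by rw [← hQ, h0, map_zero])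
    have h2 := hPx Ω
    rw [h1, hΩ1, one_smul] at h2
    rw [← h2] at hΩ1
    simp at hΩ1
  obtain ⟨x₀, hx₀⟩ : ∃ x, Q x ≠ 0 := by
    by_contra! hc
    exact hQ0 (ContinuousLinearMap.ext hc)
  have hQQx : ∀ x, Q (Q x) = Q x := fun x => by rw [← mul_apply_eq_comp, hQQ]
  set c : ℂ := ((‖Q x₀‖⁻¹ : ℝ) : ℂ) with hc
  have hc0 : c ≠ 0 := by simpa [hc] using hx₀
  -- A unit vector in the range of `Q` has the vacuum expectation values of all Weyl operators, so
  -- it is proportional to `Ω`. Hence `Q Ω = Ω`.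
  obtain ⟨z, hz⟩ := S.eq_smul_coh_zero (ψ := Q (c • x₀)) fun φ => by
    have h1 : ⟪Q (c • x₀), Q (c • x₀)⟫_ℂ = 1 := by
      rw [inner_self_eq_norm_sq_to_K, map_smul, norm_smul, hc, Complex.norm_real, norm_inv,
        norm_norm, inv_mul_cancel₀ (norm_ne_zero_iff.2 hx₀)]
      simp
    rw [hQin, hQW, inner_smul_right, ← hQQx (c • x₀), ← hQin, h1, mul_one]
  have hz0 : z ≠ 0 := by
    rintro rfl
    rw [map_smul, zero_smul, smul_eq_zero] at hz
    exact hz.elim hc0 hx₀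
  have hQΩ : Q Ω = Ω := by
    have := hQQx (c • x₀)
    rw [hz, map_smul] at this
    exact smul_right_injective _ hz0 this
  refine (S.total_weylOp_coh_zero_dense hr).clm_ext ?_
  rintro _ ⟨a, rfl⟩
  refine (S.total_weylOp_coh_zero_dense hr).eq ?_
  rintro _ ⟨b, rfl⟩
  -- Since `γ` fixes the outer Weyl operators and `Q Ω = Ω`, this compares the matrix elements of `γ
  -- A` and `A` between the total vectors `W Ω`.
  have h1 := hQAQ (star (S.weylOp (r b)) * A * S.weylOp (r a))
  rw [map_mul, map_mul, hγstar, hγ, hγ] at h1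
  have h2 := congrArg (fun B : lp H 2 →L[ℂ] lp H 2 => ⟪Ω, B Ω⟫_ℂ) h1
  simp only [mul_apply_eq_comp, smul_apply, hQΩ, inner_smul_right, hΩ1, mul_one] at h2
  rw [← hQin, hQΩ, star_weylOp, ← inner_weylOp_left, ← inner_weylOp_left] at h2
  exact h2

end FockStructure

/-! ### The automorphism and the transformed state -/

section Conjugation

variable {K : Type*} [NormedAddCommGroup K] [InnerProductSpace ℂ K] [CompleteSpace K]

/-- A `*`-subalgebra that contains every operator is the algebra of all operators. -/
def equivOfEqTop (M : StarSubalgebra ℂ (K →L[ℂ] K)) (hM : M = ⊤) : M ≃⋆ₐ[ℂ] (K →L[ℂ] K) :=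
  StarAlgEquiv.ofBijective M.subtype
    ⟨Subtype.val_injective, fun x => ⟨⟨x, hM ▸ StarSubalgebra.mem_top⟩, rfl⟩⟩

variable {M : StarSubalgebra ℂ (K →L[ℂ] K)} (hM : M = ⊤)

theorem equivOfEqTop_apply (a : M) : equivOfEqTop M hM a = a := rfl

/-- Conjugation by a unitary operator as an automorphism. -/
def conjAut {V : K →L[ℂ] K} (hV : V ∈ unitary (K →L[ℂ] K)) : M ≃⋆ₐ[ℂ] M :=
  ((equivOfEqTop M hM).trans (Unitary.conjStarAlgAut ℂ _ ⟨V, hV⟩)).trans (equivOfEqTop M hM).symm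

theorem coe_conjAut_apply {V : K →L[ℂ] K} (hV : V ∈ unitary (K →L[ℂ] K)) (a : M) :
    (conjAut hM hV a : K →L[ℂ] K) = V * a * star V := by
  rw [← equivOfEqTop_apply hM, conjAut]
  exact (equivOfEqTop M hM).apply_symm_apply _

/-- An automorphism is a conjugation if it is so on a set of operators that no nontrivial
automorphism fixes. -/
theorem eq_conjAut {ι : Type*} {w : ι → K →L[ℂ] K}
    (hw : ∀ γ : (K →L[ℂ] K) ≃⋆ₐ[ℂ] (K →L[ℂ] K), (∀ i, γ (w i) = w i) → ∀ A, γ A = A)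
    (hwM : ∀ i, w i ∈ M) {V : K →L[ℂ] K} (hV : V ∈ unitary (K →L[ℂ] K)) (β : M ≃⋆ₐ[ℂ] M)
    (hβ : ∀ i, (β ⟨w i, hwM i⟩ : K →L[ℂ] K) = V * w i * star V) : β = conjAut hM hV := by
  have hU := Unitary.mem_iff.1 hV
  let γ : (K →L[ℂ] K) ≃⋆ₐ[ℂ] (K →L[ℂ] K) :=
    (((equivOfEqTop M hM).symm.trans β).trans (equivOfEqTop M hM)).trans
      (Unitary.conjStarAlgAut ℂ _ (star ⟨V, hV⟩))
  have hγ : ∀ a : M, γ a = star V * β a * V := fun a => by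
    have h1 : (equivOfEqTop M hM).symm (a : K →L[ℂ] K) = a :=
      (equivOfEqTop M hM).symm_apply_apply a
    change star V * (β ((equivOfEqTop M hM).symm a) : K →L[ℂ] K) * star (star V) = _
    rw [h1, star_star]
  have key := hw γ fun i => by
    refine (hγ ⟨w i, hwM i⟩).trans ?_
    rw [hβ, mul_assoc, mul_assoc, mul_assoc, hU.1, mul_one, ← mul_assoc, hU.1, one_mul]
  refine StarAlgEquiv.ext fun a => Subtype.ext ?_
  rw [coe_conjAut_apply, ← key a, hγ]
  rw [← mul_assoc, ← mul_assoc, hU.2, one_mul, mul_assoc, hU.2, mul_one]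

theorem coe_starAlgEquiv_one (α : M ≃⋆ₐ[ℂ] M) : (α 1 : K →L[ℂ] K) = 1 :=
  congrArg Subtype.val (map_one α)

theorem coe_starAlgEquiv_mul (α : M ≃⋆ₐ[ℂ] M) (a b : M) :
    (α (a * b) : K →L[ℂ] K) = α a * α b :=
  congrArg Subtype.val (map_mul α a b)

theorem inner_starAlgEquiv_star_mul (α : M ≃⋆ₐ[ℂ] M) (a : M) (Ω : K) :
    ⟪Ω, (α (star a * a) : K →L[ℂ] K) Ω⟫_ℂ = ((‖(α a : K →L[ℂ] K) Ω‖ ^ 2 : ℝ) : ℂ) := by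
  have h : (α (star a) : K →L[ℂ] K) = star (α a : K →L[ℂ] K) :=
    congrArg Subtype.val (α.map_star' a)
  rw [coe_starAlgEquiv_mul, h, mul_apply_eq_comp, ContinuousLinearMap.star_eq_adjoint,
    ContinuousLinearMap.adjoint_inner_right, inner_self_eq_norm_sq_to_K]
  norm_cast

end Conjugation

theorem RealOperator.map_ofReal_smul {E : Type*} [NormedAddCommGroup E] [InnerProductSpace ℂ E]
    (T : RealOperator E) (c : ℝ) (x : E) : T ((c : ℂ) • x) = (c : ℂ) • T x := by
  rw [Complex.coe_smul, Complex.coe_smul, map_smul]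

theorem RealOperator.map_add_apply {E : Type*} [NormedAddCommGroup E] [InnerProductSpace ℂ E]
    (T : RealOperator E) (x y : E) : T (x + y) = T x + T y := map_add T x y

theorem hasDerivAt_gaussian_right (a b : ℝ) (z : ℂ) (s : ℝ) :
    HasDerivAt (fun t : ℝ => Complex.exp (-((s ^ 2 * a + t ^ 2 * b : ℝ) + s * t * z)))
      (-(s * z) * Complex.exp (-(s ^ 2 * a : ℝ))) 0 := by
  have h0 := hasDerivAt_id ((0 : ℝ) : ℂ)
  have h := ((((h0.fun_pow 2).mul_const (b : ℂ)).const_add ((s : ℂ) ^ 2 * a)).fun_add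
    ((h0.const_mul (s : ℂ)).mul_const z)).fun_neg.cexp.comp_ofReal
  refine (h.congr_deriv ?_).congr_of_eventuallyEq (Filter.Eventually.of_forall fun t => ?_)
  · simp [mul_comm]
  · simp

theorem hasDerivAt_gaussian_left (a : ℝ) (z : ℂ) :
    HasDerivAt (fun s : ℝ => -(s * z) * Complex.exp (-(s ^ 2 * a : ℝ))) (-z) 0 := by
  have h0 := hasDerivAt_id ((0 : ℝ) : ℂ)
  have h := ((h0.mul_const z).fun_neg.fun_mul
    ((h0.fun_pow 2).mul_const (a : ℂ)).fun_neg.cexp).comp_ofReal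
  refine (h.congr_deriv ?_).congr_of_eventuallyEq (Filter.Eventually.of_forall fun t => ?_)
  · simp
  · simp

/-- The bound `|Im ⟪x, y⟫| ≤ ‖x‖ ‖y‖`, squared; the factor `2` and the division by `4` cancel. -/
theorem sq_im_inner_le {E : Type*} [NormedAddCommGroup E] [InnerProductSpace ℂ E] (x y : E) :
    (2 * (⟪x, y⟫_ℂ).im) ^ 2 / 4 ≤ (⟪x, x⟫_ℂ).re * (⟪y, y⟫_ℂ).re := by
  have h1 := (Complex.abs_im_le_norm ⟪x, y⟫_ℂ).trans (norm_inner_le_norm x y)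
  have h2 := pow_le_pow_left₀ (abs_nonneg _) h1 2
  have h3 : ∀ x : E, (⟪x, x⟫_ℂ).re = ‖x‖ ^ 2 := fun x => inner_self_eq_norm_sq (𝕜 := ℂ) x
  rw [sq_abs, mul_pow] at h2
  rw [h3, h3]
  linarith

theorem coe_weylElem (hm : 0 < m) (f : TestFun D) :
    (weylElem hm f : Fock D m →L[ℂ] Fock D m) = (fockStructure D m).weylOp (onShell hm f) :=
  weyl_eq_weylOp hm f

theorem weylAlgebra_eq_top (hm : 0 < m) : weylAlgebra D hm = ⊤ := by
  rw [weylAlgebra]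
  simp only [weyl_eq_weylOp]
  exact (fockStructure D m).doubleCommutant_weylOp (denseRange_onShell hm)

theorem vacuumState_comp_apply (hm : 0 < m) (α : weylAlgebra D hm ≃⋆ₐ[ℂ] weylAlgebra D hm)
    (a : weylAlgebra D hm) : (vacuumState D hm ∘ₗ α.toAlgEquiv.toLinearMap) a =
      ⟪vacuum D m, (α a : Fock D m →L[ℂ] Fock D m) (vacuum D m)⟫_ℂ := rfl

theorem isState_comp (hm : 0 < m) (α : weylAlgebra D hm ≃⋆ₐ[ℂ] weylAlgebra D hm) :
    IsState (vacuumState D hm ∘ₗ α.toAlgEquiv.toLinearMap) := by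
  refine ⟨?_, fun a => ?_⟩
  · rw [vacuumState_comp_apply, coe_starAlgEquiv_one, ← fockStructure_coh_zero]
    exact (fockStructure D m).inner_coh_zero_self
  · rw [vacuumState_comp_apply, inner_starAlgEquiv_star_mul]
    exact ⟨by rw [Complex.ofReal_re]; positivity, Complex.ofReal_im _⟩

theorem twoPoint_eq_inner (hm : 0 < m) {R : TestFun D → TestFun D}
    {T : RealOperator (OneParticle D m)} (hT : ∀ f, onShell hm (R f) = T (onShell hm f))
    (f g : TestFun D) :
    twoPoint m (R f) (R g) = ⟪T (onShell hm f), T (onShell hm g)⟫_ℂ := by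
  rw [← inner_onShell hm, hT, hT]

theorem hasTwoPointFunction_comp (hm : 0 < m) {R : TestFun D → TestFun D}
    {T : RealOperator (OneParticle D m)} (hT : ∀ f, onShell hm (R f) = T (onShell hm f))
    {α : weylAlgebra D hm ≃⋆ₐ[ℂ] weylAlgebra D hm}
    (hα : ∀ f, α (weylElem hm f) = weylElem hm (R f)) :
    HasTwoPointFunction (vacuumState D hm ∘ₗ α.toAlgEquiv.toLinearMap)
      (fun f g => twoPoint m (R f) (R g)) := by
  intro f g
  have hval : ∀ f, (α (weylElem hm f) : Fock D m →L[ℂ] Fock D m) =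
      (fockStructure D m).weylOp (T (onShell hm f)) := fun f => by
    rw [hα, ← hT, coe_weylElem]
  refine ⟨fun s => -(s * twoPoint m (R f) (R g)) *
    Complex.exp (-(s ^ 2 * (‖T (onShell hm f)‖ ^ 2 / 2) : ℝ)), fun s => ?_,
    hasDerivAt_gaussian_left _ _⟩
  refine (hasDerivAt_gaussian_right _ (‖T (onShell hm g)‖ ^ 2 / 2) _ s).congr_of_eventuallyEq
    (Filter.Eventually.of_forall fun t => ?_)
  beta_reduce
  rw [vacuumState_comp_apply, coe_starAlgEquiv_mul, hval, hval, ← fockStructure_coh_zero,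
    onShell_smul, onShell_smul, RealOperator.map_ofReal_smul, RealOperator.map_ofReal_smul,
    FockStructure.inner_coh_zero_weylOp_smul_mul, twoPoint_eq_inner hm hT]

/-- The vacuum, transformed by an implementable symplectic map, is quasi-free. -/
theorem isQuasiFree_comp (hm : 0 < m) {R : TestFun D → TestFun D}
    {T : RealOperator (OneParticle D m)} (hT : ∀ f, onShell hm (R f) = T (onShell hm f))
    (hsymp : ∀ x y, (⟪T x, T y⟫_ℂ).im = (⟪x, y⟫_ℂ).im)
    {α : weylAlgebra D hm ≃⋆ₐ[ℂ] weylAlgebra D hm}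
    (hα : ∀ f, α (weylElem hm f) = weylElem hm (R f)) :
    IsQuasiFree (vacuumState D hm ∘ₗ α.toAlgEquiv.toLinearMap)
      (fun f g => twoPoint m (R f) (R g)) := by
  have hw := twoPoint_eq_inner hm hT
  have hcomm : ∀ f g, 2 * (twoPoint m (R f) (R g)).im = commutatorFun m f g := fun f g => by
    rw [hw, hsymp, inner_onShell, commutatorFun]
  refine ⟨isState_comp hm α, fun f f' g => ?_, fun c f g => ?_, fun f g => ?_, hcomm,
    fun f => ?_, fun f g => ?_, fun f => ?_, hasTwoPointFunction_comp hm hT hα⟩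
  · rw [hw, hw, hw, onShell_add, RealOperator.map_add_apply, inner_add_left]
  · rw [hw, hw, onShell_smul, RealOperator.map_ofReal_smul, inner_smul_left, Complex.conj_ofReal]
  · rw [hw, hw]
    exact inner_conj_symm _ _
  · rw [hw]
    exact inner_self_nonneg (𝕜 := ℂ)
  · rw [← hcomm, hw, hw, hw]
    exact sq_im_inner_le _ _
  · rw [hw, inner_self_eq_norm_sq_to_K, vacuumState_comp_apply, hα, coe_weylElem, hT,
      ← fockStructure_coh_zero, FockStructure.inner_coh_zero_weylOp]
    simp [neg_div]

end LocalSqueezing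

end

/-! ### The main theorem -/

theorem mainTheorem2 (D : ℕ) (hD : 1 ≤ D) (m : ℝ) (hm : 0 < m)
    (h : LocalSqueezing.TestFun D) :
    -- the Weyl operators are the exponentials of the closed field operators
    (∀ f : LocalSqueezing.TestFun D,
      LocalSqueezing.IsExpI (LocalSqueezing.field hm f).closure (LocalSqueezing.weyl hm f)) ∧
    -- the exponential series defining `T_h g` converges in the Schwartz space
    (∀ g : LocalSqueezing.TestFun D, Summable (LocalSqueezing.squeezeTerm m h g)) ∧
    -- the transformed Weyl operators generate the same algebra
    LocalSqueezing.doubleCommutant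
        (Set.range fun f : LocalSqueezing.TestFun D =>
          LocalSqueezing.weyl hm (LocalSqueezing.squeeze m h f)) =
      LocalSqueezing.weylAlgebra D hm ∧
    -- `T_h` induces a (unique) automorphism, and the transformed vacuum is quasi-free
    ∃ α : LocalSqueezing.weylAlgebra D hm ≃⋆ₐ[ℂ] LocalSqueezing.weylAlgebra D hm,
      (∀ f : LocalSqueezing.TestFun D, α (LocalSqueezing.weylElem hm f) =
        LocalSqueezing.weylElem hm (LocalSqueezing.squeeze m h f)) ∧
      (∀ β : LocalSqueezing.weylAlgebra D hm ≃⋆ₐ[ℂ] LocalSqueezing.weylAlgebra D hm,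
        (∀ f : LocalSqueezing.TestFun D, β (LocalSqueezing.weylElem hm f) =
          LocalSqueezing.weylElem hm (LocalSqueezing.squeeze m h f)) → β = α) ∧
      LocalSqueezing.IsQuasiFree
        (LocalSqueezing.vacuumState D hm ∘ₗ α.toAlgEquiv.toLinearMap)
        (fun f g => LocalSqueezing.twoPoint m (LocalSqueezing.squeeze m h f)
          (LocalSqueezing.squeeze m h g)) := by
  choose T V hT hdense hsymp hV hVW using LocalSqueezing.exists_unitary_squeeze hm h
  have hM := LocalSqueezing.weylAlgebra_eq_top (D := D) hm
  have hconj : ∀ f, V * LocalSqueezing.weyl hm f * star V =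
      LocalSqueezing.weyl hm (LocalSqueezing.squeeze m h f) := fun f => by
    rw [LocalSqueezing.weyl_eq_weylOp, LocalSqueezing.weyl_eq_weylOp, hVW, hT, mul_assoc,
      (Unitary.mem_iff.1 hV).2, mul_one]
  have hα : ∀ f, LocalSqueezing.conjAut hM hV (LocalSqueezing.weylElem hm f) =
      LocalSqueezing.weylElem hm (LocalSqueezing.squeeze m h f) := fun f =>
    Subtype.ext ((LocalSqueezing.coe_conjAut_apply hM hV _).trans (hconj f))
  refine ⟨fun f => ?_, LocalSqueezing.summable_squeezeTerm hm h, ?_,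
    LocalSqueezing.conjAut hM hV, hα, fun β hβ => ?_, LocalSqueezing.isQuasiFree_comp hm hT hsymp hα⟩
  · rw [LocalSqueezing.weyl_eq_weylOp]
    exact LocalSqueezing.isExpI_field hm f
  -- The exponential is surjective and continuous, so the transformed labels are again dense; both
  -- algebras consist of all bounded operators.
  · rw [hM]
    simp only [LocalSqueezing.weyl_eq_weylOp, hT]
    exact (LocalSqueezing.fockStructure D m).doubleCommutant_weylOp hdense
  -- Undoing the conjugation by `V` turns `β` into an automorphism of all bounded operators that
  -- fixes the Weyl operators of test functions. Their labels are dense, so it is trivial.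
  · refine LocalSqueezing.eq_conjAut hM (w := fun f => LocalSqueezing.weyl hm f) (fun γ hγ A => ?_)
      (fun f => (LocalSqueezing.weylElem hm f).2) hV β fun f => ?_
    · refine (LocalSqueezing.fockStructure D m).starAlgEquiv_apply_eq_self
        (LocalSqueezing.denseRange_onShell hm) γ (fun f => ?_) A
      rw [← LocalSqueezing.weyl_eq_weylOp]
      exact hγ f
    · rw [hconj]
      exact congrArg Subtype.val (hβ f)
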